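/- Let $1<\alpha<2$, $\sigma>0$, and let $L=(L_t)_{t\in\mathbb R}$ be a two-sided $\mathbb R^{n_2}$-valued (strictly) $\alpha$-stable Lévy process on a probability space $(\Omega,\mathcal F,\mathbb P)$: $L_0=0$, càdlàg paths, independent stationary increments, and $L_{ct}\overset{d}{=}c^{1/\alpha}L_t$ for $c>0$. Write $L_s(\theta_t\omega)=L_{s+t}(\omega)-L_t(\omega)$ and $|\cdot|$ for the Euclidean norm. Let $S$ and $F$ be real $n_1\times n_1$ and $n_2\times n_2$ matrices and $g_i:\mathbb R^{n_1}\times\mathbb R^{n_2}\to\mathbb R^{n_i}$, $i=1,2$. Assume: (A1) there are $\gamma_s>0$ and $\gamma_f<0$ with $|e^{St}x|\le e^{\gamma_s t}|x|$ for $t\le 0$, $x\in\mathbb R^{n_1}$, and $|e^{Ft}y|\le e^{\gamma_f t}|y|$ for $t\ge 0$, $y\in\mathbb R^{n_2}$; (A2) there is $K>0$ with $|g_i(x_1,y_1)-g_i(x_2,y_2)|\le K(|x_1-x_2|+|y_1-y_2|)$ for $i=1,2$; (A3) $K<-\gamma_f$; fix $\gamma>0$ with $K<-(\gamma+\gamma_f)$.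 Assume moreover that $|g_1(x,y)|\le C$ for all $x,y$, with a constant $C$. For $\varepsilon>0$ put $\eta^{1/\varepsilon}(\omega)=\varepsilon^{-1/\alpha}\int_{-\infty}^0e^{-Fs/\varepsilon}\,dL_s(\omega)$ and $\xi(\omega)=\int_{-\infty}^0e^{-Fs}\,dL_s(\omega)$. For $\beta\in\mathbb R$ let $C_\beta^-$ be the set of continuous functions $(x,y):(-\infty,0]\to\mathbb R^{n_1}\times\mathbb R^{n_2}$ with $\sup_{t\le 0}e^{-\beta t}(|x(t)|+|y(t)|)<\infty$. Consider the random differential equations $$\text{(a)}\quad \dot x=Sx+g_1\big(x,y+\sigma\eta^{1/\varepsilon}(\theta_t\omega)\big),\qquad \dot y=\tfrac1\varepsilon Fy+\tfrac1\varepsilon g_2\big(x,y+\sigma\eta^{1/\varepsilon}(\theta_t\omega)\big),$$ $$\text{(b)}\quad \dot x=\varepsilon Sx+\varepsilon g_1\big(x,y+\sigma\xi(\theta_t\omega)\big),\qquad \dot y=Fy+g_2\big(x,y+\sigma\xi(\theta_t\omega)\big),$$ $$\text{(c)}\quad \dot x=0,\qquad \dot y=Fy+g_2\big(x,y+\sigma\xi(\theta_t\omega)\big).$$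 Let $\mathcal M^\varepsilon(\omega)$ be the set of those initial values at time $0$ whose backward orbit under (a) lies in $C^-_{-\gamma/\varepsilon}$, and let $\tilde{\mathcal M}^\varepsilon(\omega)$ and $\mathcal M^0(\omega)$ be the sets of those whose backward orbit under (b), respectively (c), lies in $C^-_{-\gamma}$. Then there is $\delta>0$ such that the following holds. (1) Almost surely, $\mathcal M^0(\omega)$ and, for all $\varepsilon\in(0,\delta)$, $\mathcal M^\varepsilon(\omega)$ and $\tilde{\mathcal M}^\varepsilon(\omega)$ are the graphs over $\mathbb R^{n_1}$ of $$\hat h^\varepsilon(\omega,x_0)=\frac1\varepsilon\int_{-\infty}^0e^{-Fs/\varepsilon}g_2\big(\hat x(s),\hat y(s)+\sigma\eta^{1/\varepsilon}(\theta_s\omega)\big)ds,\qquad \tilde h^\varepsilon(\omega,x_0)=\int_{-\infty}^0e^{-Fs}g_2\big(\tilde x(s),\tilde y(s)+\sigma\xi(\theta_s\omega)\big)ds,$$ $$h^0(\omega,x_0)=\int_{-\infty}^0e^{-Fs}g_2\big(x_0,y^0(s)+\sigma\xi(\theta_s\omega)\big)ds,$$ where $(\hat x,\hat y)\in C^-_{-\gamma/\varepsilon}$,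 $(\tilde x,\tilde y)\in C^-_{-\gamma}$ and $(x_0,y^0)\in C^-_{-\gamma}$ are the unique solutions of the integral (Lyapunov–Perron) equations $$\hat x(t)=e^{St}x_0+\int_0^te^{S(t-s)}g_1(\hat x,\hat y+\sigma\eta^{1/\varepsilon}(\theta_s\omega))ds,\quad \hat y(t)=\frac1\varepsilon\int_{-\infty}^te^{F(t-s)/\varepsilon}g_2(\hat x,\hat y+\sigma\eta^{1/\varepsilon}(\theta_s\omega))ds,$$ $$\tilde x(t)=e^{\varepsilon St}x_0+\varepsilon\int_0^te^{\varepsilon S(t-s)}g_1(\tilde x,\tilde y+\sigma\xi(\theta_s\omega))ds,\quad \tilde y(t)=\int_{-\infty}^te^{F(t-s)}g_2(\tilde x,\tilde y+\sigma\xi(\theta_s\omega))ds,$$ $$y^0(t)=\int_{-\infty}^te^{F(t-s)}g_2(x_0,y^0(s)+\sigma\xi(\theta_s\omega))ds,\qquad t\le 0.$$ (2) $\mathcal M^\varepsilon$ converges in distribution to the critical manifold $\mathcal M^0$ as $\varepsilon\to0$: for all $x_1,\dots,x_k\in\mathbb R^{n_1}$ (in particular for a single point $x_0$), $(\hat h^\varepsilon(\cdot,x_i))_{i\le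 k}$ converges in distribution to $(h^0(\cdot,x_i))_{i\le k}$. (3) More precisely, $\hat h^\varepsilon(\omega,x_0)\overset{d}{=}h^0(\omega,x_0)+\mathcal O(\varepsilon)$: for $\varepsilon\in(0,\delta)$ and all $x_1,\dots,x_k$ one has $(\hat h^\varepsilon(\cdot,x_i))_{i\le k}\overset{d}{=}(\tilde h^\varepsilon(\cdot,x_i))_{i\le k}$, and almost surely, for all $\varepsilon\in(0,\delta)$ and $x_0\in\mathbb R^{n_1}$, $$|\tilde h^\varepsilon(\omega,x_0)-h^0(\omega,x_0)|\le C_3\Big(\frac1{\gamma_f-\varepsilon\gamma_s}-\frac1{\gamma_f}\Big),\qquad C_3=\frac{K\gamma_f^2\,(|Sx_0|+C)}{\gamma_s(\gamma_f+K)^2},$$ and hence $|\tilde h^\varepsilon(\omega,x_0)-h^0(\omega,x_0)|\le \dfrac{K(|Sx_0|+C)}{(\gamma_f+K)^2}\,\varepsilon$. -/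

import Mathlib

open MeasureTheory ProbabilityTheory Filter Set Topology

noncomputable section

namespace SlowFast

section Noise

/-- A two-sided (strictly) `α`-stable Lévy process `(L t)`, `t ∈ ℝ`: it starts at `0`, has càdlàg
paths, independent and stationary increments, and is self-similar with index `1 / α`. -/
structure IsTwoSidedStableLevy {Ω E : Type*} [MeasurableSpace Ω] [NormedAddCommGroup E]
    [NormedSpace ℝ E] [MeasurableSpace E] (α : ℝ) (L : ℝ → Ω → E) (P : Measure Ω) : Prop where
  measurable : ∀ t, Measurable (L t)
  zero : ∀ᵐ ω ∂P, L 0 ω = 0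
  cadlag : ∀ᵐ ω ∂P, ∀ t, ContinuousWithinAt (fun s => L s ω) (Ici t) t ∧
    ∃ l, Tendsto (fun s => L s ω) (𝓝[<] t) (𝓝 l)
  indep_increments : HasIndepIncrements L P
  stationary_increments : ∀ s t r, s ≤ t →
    IdentDistrib (fun ω => L (t + r) ω - L (s + r) ω) (fun ω => L t ω - L s ω) P P
  self_similar : ∀ c, 0 < c → ∀ t,
    IdentDistrib (fun ω => L (c * t) ω) (fun ω => c ^ (1 / α) • L t ω) P P

variable {E : Type*} [NormedAddCommGroup E] [NormedSpace ℝ E]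

/-- The shift `θ_t w = w (· + t) - w t` on paths. -/
def shift (t : ℝ) (w : ℝ → E) : ℝ → E := fun s => w (s + t) - w t

/-- The left-point Riemann sum of `∫_a^b f(s) dw(s)` over the uniform grid with `N` cells. -/
def pathSum (f : ℝ → E →L[ℝ] E) (w : ℝ → E) (a b : ℝ) (N : ℕ) : E :=
  ∑ k ∈ Finset.range N, f (a + k * ((b - a) / N))
    (w (a + (k + 1) * ((b - a) / N)) - w (a + k * ((b - a) / N)))

/-- `∫_a^b f(s) dw(s)`, the limit of the left-point Riemann sums.  For a smooth integrand and a
càdlàg integrator the limit exists path by path and is a version of the stochastic integral. -/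
def pathIntegral (f : ℝ → E →L[ℝ] E) (w : ℝ → E) (a b : ℝ) : E :=
  limUnder atTop (pathSum f w a b)

/-- `∫_{-∞}^0 e^{-A s} dw(s)`, as the limit of the integrals over `[-T, 0]` for `T → ∞`. -/
def ouIntegral (A : E →L[ℝ] E) (w : ℝ → E) : E :=
  limUnder atTop (fun T : ℝ => pathIntegral (fun s => NormedSpace.exp ((-s) • A)) w (-T) 0)

/-- The limits in the definition of `ouIntegral A w` exist. -/
def OUConverges (A : E →L[ℝ] E) (w : ℝ → E) : Prop :=
  (∀ T : ℝ, 0 < T → ∃ I, Tendsto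
    (pathSum (fun s => NormedSpace.exp ((-s) • A)) w (-T) 0) atTop (𝓝 I)) ∧
  ∃ I, Tendsto (fun T : ℝ => pathIntegral (fun s => NormedSpace.exp ((-s) • A)) w (-T) 0)
    atTop (𝓝 I)

/-- `ξ(ω) = ∫_{-∞}^0 e^{-F s} dL_s(ω)`, evaluated at the path `w = L(ω)`. -/
def xi (F : E →L[ℝ] E) (w : ℝ → E) : E := ouIntegral F w

/-- `η^{1/ε}(ω) = ε^{-1/α} ∫_{-∞}^0 e^{-F s / ε} dL_s(ω)`, evaluated at the path `w = L(ω)`. -/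
def eta (α ε : ℝ) (F : E →L[ℝ] E) (w : ℝ → E) : E :=
  ε ^ (-(1 / α)) • ouIntegral (ε⁻¹ • F) w

end Noise

section Manifold

variable {E₁ E₂ : Type*} [NormedAddCommGroup E₁] [NormedSpace ℝ E₁]
  [NormedAddCommGroup E₂] [NormedSpace ℝ E₂]

/-- Membership in `C_β^-`: continuous on `(-∞, 0]` with `sup_{t ≤ 0} e^{-β t} |φ t| < ∞`. -/
def MemWeighted {E : Type*} [NormedAddCommGroup E] (β : ℝ) (φ : ℝ → E) : Prop :=
  ContinuousOn φ (Iic 0) ∧ BddAbove ((fun t => Real.exp (-β * t) * ‖φ t‖) '' Iic 0)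

/-- `(x, y)` solves on `(-∞, 0]`, in integrated form, the random differential equation
`x' = a (S x + g₁(x, y + z(t)))`, `y' = b (F y + g₂(x, y + z(t)))`
with noise path `z` and value `p` at time `0`. -/
def IsRDESolution (a b : ℝ) (S : E₁ →L[ℝ] E₁) (F : E₂ →L[ℝ] E₂) (g₁ : E₁ → E₂ → E₁)
    (g₂ : E₁ → E₂ → E₂) (z : ℝ → E₂) (p : E₁ × E₂) (x : ℝ → E₁) (y : ℝ → E₂) : Prop :=
  ∀ t ≤ 0,
    IntervalIntegrable (fun s => a • (S (x s) + g₁ (x s) (y s + z s))) volume 0 t ∧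
    IntervalIntegrable (fun s => b • (F (y s) + g₂ (x s) (y s + z s))) volume 0 t ∧
    x t = p.1 + ∫ s in (0 : ℝ)..t, a • (S (x s) + g₁ (x s) (y s + z s)) ∧
    y t = p.2 + ∫ s in (0 : ℝ)..t, b • (F (y s) + g₂ (x s) (y s + z s))

/-- The slow manifold of the above equation: the initial values whose backward orbit lies in
`C_β^-`. -/
def slowManifold (a b : ℝ) (S : E₁ →L[ℝ] E₁) (F : E₂ →L[ℝ] E₂) (g₁ : E₁ → E₂ → E₁)
    (g₂ : E₁ → E₂ → E₂) (z : ℝ → E₂) (β : ℝ) : Set (E₁ × E₂) :=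
  {p | ∃ (x : ℝ → E₁) (y : ℝ → E₂), MemWeighted β x ∧ MemWeighted β y ∧
    IsRDESolution a b S F g₁ g₂ z p x y}

/-- `(x, y)` is a solution in `C_β^-` of the Lyapunov-Perron integral equations
`x(t) = e^{a S t} x₀ + a ∫_0^t e^{a S (t-s)} g₁(x(s), y(s) + z(s)) ds`,
`y(t) = b ∫_{-∞}^t e^{b F (t-s)} g₂(x(s), y(s) + z(s)) ds`, for `t ≤ 0`. -/
def IsLPSolution (a b : ℝ) (S : E₁ →L[ℝ] E₁) (F : E₂ →L[ℝ] E₂) (g₁ : E₁ → E₂ → E₁)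
    (g₂ : E₁ → E₂ → E₂) (z : ℝ → E₂) (β : ℝ) (x₀ : E₁) (x : ℝ → E₁) (y : ℝ → E₂) : Prop :=
  MemWeighted β x ∧ MemWeighted β y ∧ ∀ t ≤ 0,
    IntervalIntegrable
      (fun s => NormedSpace.exp ((a * (t - s)) • S) (g₁ (x s) (y s + z s))) volume 0 t ∧
    IntegrableOn (fun s => NormedSpace.exp ((b * (t - s)) • F) (g₂ (x s) (y s + z s))) (Iic t) ∧
    x t = NormedSpace.exp ((a * t) • S) x₀ +
      a • ∫ s in (0 : ℝ)..t, NormedSpace.exp ((a * (t - s)) • S) (g₁ (x s) (y s + z s)) ∧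
    y t = b • ∫ s in Iic t, NormedSpace.exp ((b * (t - s)) • F) (g₂ (x s) (y s + z s))

open Classical in
/-- The graph map `h(x₀) = b ∫_{-∞}^0 e^{-b F s} g₂(x(s), y(s) + z(s)) ds`, where `(x, y)` is the
solution in `C_β^-` of the Lyapunov-Perron equations started from `x₀`. -/
def graphMap (a b : ℝ) (S : E₁ →L[ℝ] E₁) (F : E₂ →L[ℝ] E₂) (g₁ : E₁ → E₂ → E₁)
    (g₂ : E₁ → E₂ → E₂) (z : ℝ → E₂) (β : ℝ) (x₀ : E₁) : E₂ :=
  if hex : ∃ φ : (ℝ → E₁) × (ℝ → E₂), IsLPSolution a b S F g₁ g₂ z β x₀ φ.1 φ.2 then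
    b • ∫ s in Iic (0 : ℝ), NormedSpace.exp ((-(b * s)) • F)
      (g₂ ((Classical.choose hex).1 s) ((Classical.choose hex).2 s + z s))
  else 0

/-- The Lyapunov-Perron equations have, for every `x₀`, exactly one solution in `C_β^-`, and the
slow manifold is the graph of `graphMap`. -/
def IsGraph (a b : ℝ) (S : E₁ →L[ℝ] E₁) (F : E₂ →L[ℝ] E₂) (g₁ : E₁ → E₂ → E₁)
    (g₂ : E₁ → E₂ → E₂) (z : ℝ → E₂) (β : ℝ) : Prop :=
  (∀ x₀, ∃ x y, IsLPSolution a b S F g₁ g₂ z β x₀ x y ∧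
    ∀ x' y', IsLPSolution a b S F g₁ g₂ z β x₀ x' y' →
      EqOn x' x (Iic 0) ∧ EqOn y' y (Iic 0)) ∧
  slowManifold a b S F g₁ g₂ z β =
    range (fun x₀ => (x₀, graphMap a b S F g₁ g₂ z β x₀))

/-- The noise path `t ↦ σ η^{1/ε}(θ_t ω)`. -/
def noiseHat (α ε σ : ℝ) (F : E₂ →L[ℝ] E₂) (w : ℝ → E₂) : ℝ → E₂ :=
  fun t => σ • eta α ε F (shift t w)

/-- The noise path `t ↦ σ ξ(θ_t ω)`. -/
def noiseTilde (σ : ℝ) (F : E₂ →L[ℝ] E₂) (w : ℝ → E₂) : ℝ → E₂ :=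
  fun t => σ • xi F (shift t w)

/-- `ĥ^ε`, with `M^ε` its graph: the equation
`x' = S x + g₁(x, y + σ η(θ_t ω))`, `y' = (1/ε) (F y + g₂(x, y + σ η(θ_t ω)))`, in `C_{-γ/ε}^-`. -/
def hHat (α σ γ ε : ℝ) (S : E₁ →L[ℝ] E₁) (F : E₂ →L[ℝ] E₂) (g₁ : E₁ → E₂ → E₁)
    (g₂ : E₁ → E₂ → E₂) (w : ℝ → E₂) (x₀ : E₁) : E₂ :=
  graphMap 1 ε⁻¹ S F g₁ g₂ (noiseHat α ε σ F w) (-γ / ε) x₀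

/-- `h̃^ε`: the equation
`x' = ε (S x + g₁(x, y + σ ξ(θ_t ω)))`, `y' = F y + g₂(x, y + σ ξ(θ_t ω))`, in `C_{-γ}^-`. -/
def hTilde (σ γ ε : ℝ) (S : E₁ →L[ℝ] E₁) (F : E₂ →L[ℝ] E₂) (g₁ : E₁ → E₂ → E₁)
    (g₂ : E₁ → E₂ → E₂) (w : ℝ → E₂) (x₀ : E₁) : E₂ :=
  graphMap ε 1 S F g₁ g₂ (noiseTilde σ F w) (-γ) x₀

/-- `h^0`, with the critical manifold `M^0` its graph: the equation
`x' = 0`, `y' = F y + g₂(x, y + σ ξ(θ_t ω))`, in `C_{-γ}^-`; here `x(t) = x₀` for all `t ≤ 0`. -/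
def hZero (σ γ : ℝ) (S : E₁ →L[ℝ] E₁) (F : E₂ →L[ℝ] E₂) (g₁ : E₁ → E₂ → E₁)
    (g₂ : E₁ → E₂ → E₂) (w : ℝ → E₂) (x₀ : E₁) : E₂ :=
  graphMap 0 1 S F g₁ g₂ (noiseTilde σ F w) (-γ) x₀

end Manifold

end SlowFast

end

noncomputable section

namespace SlowFast

set_option linter.unusedSectionVars false

/-! ### Operator exponentials, variation of constants, weighted integral bounds. -/

section Exponential

variable {E : Type*} [NormedAddCommGroup E] [NormedSpace ℝ E] [CompleteSpace E] (A : E →L[ℝ] E)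

/-! Apart from laws and path growth, the argument is deterministic: it runs path by path on one
event of full measure, the paths that are càdlàg with subexponential growth at `-∞` (`IsTamePath`).

Noise. The integrand `e^{-As}` is smooth, so Abel summation moves the increments from the path to
the integrand, and on a tame path `ouIntegral A w = w 0 + ∫_{-∞}^0 A e^{-As} w(s) ds`
(`ouIntegral_eq`). Hence the stationary noise `t ↦ ξ(θ_t ω)` is right-continuous and `O(e^{-ct})` on
`t ≤ 0` for every `c > 0`. Almost every path is tame (`ae_isTamePath`): self-similarity and
independent increments yield a polynomial tail for the stable law, Ottaviani's inequality carries it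
to the running maximum over `[-2^m, 0]`, and Borel–Cantelli concludes.

Manifolds. The three equations are one system with speeds `(a, b) = (1, 1/ε)`, `(ε, 1)`, `(0, 1)`.
Let the fast flow decay at rate `κ`. A backward solution growing at most like `e^{-ρt}` with `ρ < κ`
has no homogeneous fast part to choose, so being such a solution is the same as solving the
Lyapunov–Perron equations. Their operator contracts with constant `aK/(μ+ρ) + bK/(κ-ρ)`, where `μ`
is the slow rate; the unique fixed point gives the graph (`LPContracting.isGraph`). For the systems
at hand the second summand is always `K/(-γf-γ) < 1`, while the first is at most `εK/γ`; this fixes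
the range of `ε`.

Error. Along the rescaled system `x(t)` stays within `((‖S x₀‖ + C)/γs)(1 - e^{εγs t})` of `x₀`. The
difference of the fast components then satisfies a linear integral inequality whose fixed point is
explicit, and iterating the inequality from a crude bound forces the difference below that fixed
point (`norm_fast_sub_le`).

Law. The time change `t ↦ t/ε` gives the pathwise identity `ĥ^ε(w) = h̃^ε(ε^{-1/α} w(ε ·))`
(`hHat_eq_hTilde_rescale`), and the rescaled process has the law of `L` on path space. Equality in
law of the graph maps follows once `h̃^ε` is a measurable function of the path, which holds because
it is the limit of Picard iterates. Convergence in distribution combines this equality with almost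
sure convergence `h̃^ε → h^0`. -/

lemma exp_add_smul (s t : ℝ) :
    NormedSpace.exp ((s + t) • A) = NormedSpace.exp (s • A) * NormedSpace.exp (t • A) := by
  let : NormedAlgebra ℚ (E →L[ℝ] E) := NormedAlgebra.restrictScalars ℚ ℝ _
  rw [add_smul, NormedSpace.exp_add_of_commute ((Commute.refl A).smul_left s |>.smul_right t)]

lemma exp_sub_smul_apply (t s : ℝ) (v : E) :
    NormedSpace.exp ((t - s) • A) v
      = NormedSpace.exp (t • A) (NormedSpace.exp ((-s) • A) v) := by
  rw [sub_eq_add_neg, exp_add_smul]; rfl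

lemma exp_smul_apply_neg (t : ℝ) (v : E) :
    NormedSpace.exp (t • A) (NormedSpace.exp ((-t) • A) v) = v := by
  rw [← exp_sub_smul_apply]; simp [NormedSpace.exp_zero]

lemma exp_neg_smul_apply (t : ℝ) (v : E) :
    NormedSpace.exp ((-t) • A) (NormedSpace.exp (t • A) v) = v := by
  simpa using exp_smul_apply_neg A (-t) v

lemma hasDerivAt_exp_smul (t : ℝ) :
    HasDerivAt (fun u : ℝ => NormedSpace.exp (u • A)) (A * NormedSpace.exp (t • A)) t :=
  hasDerivAt_exp_smul_const' A t

@[fun_prop]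
lemma continuous_exp_smul : Continuous fun t : ℝ => NormedSpace.exp (t • A) :=
  continuous_iff_continuousAt.2 fun t => (hasDerivAt_exp_smul A t).continuousAt

lemma mul_smul_eq_smul_smul (a t : ℝ) : (a * t) • A = t • (a • A) := by
  rw [smul_smul, mul_comm]

lemma aestronglyMeasurable_clm_apply {c : ℝ → E →L[ℝ] E} (hc : Continuous c) {u : ℝ → E}
    {μ : Measure ℝ} (hu : AEStronglyMeasurable u μ) :
    AEStronglyMeasurable (fun s => c s (u s)) μ :=
  (isBoundedBilinearMap_apply (𝕜 := ℝ) (E := E) (F := E)).continuous.comp_aestronglyMeasurable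
    (hc.aestronglyMeasurable.prodMk hu)

lemma intervalIntegrable_clm_apply {c : ℝ → E →L[ℝ] E} (hc : Continuous c) {u : ℝ → E} {a b : ℝ}
    (hu : IntervalIntegrable u volume a b) :
    IntervalIntegrable (fun s => c s (u s)) volume a b := by
  obtain ⟨M, hM⟩ := isCompact_uIcc.exists_bound_of_continuousOn (s := uIcc a b) hc.continuousOn
  rw [intervalIntegrable_iff] at hu ⊢
  refine (hu.norm.const_mul M).mono' (aestronglyMeasurable_clm_apply hc hu.1) ?_
  refine (ae_restrict_mem measurableSet_uIoc).mono fun s hs => ?_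
  exact (c s).le_of_opNorm_le (hM s (uIoc_subset_uIcc hs)) _

lemma hasDerivWithinAt_exp_smul_apply {v : ℝ → E} {v' : E} {s : Set ℝ} {t : ℝ}
    (hv : HasDerivWithinAt v v' s t) :
    HasDerivWithinAt (fun r => NormedSpace.exp (r • A) (v r))
      (A (NormedSpace.exp (t • A) (v t)) + NormedSpace.exp (t • A) v') s t := by
  simpa using (hasDerivAt_exp_smul A t).hasDerivWithinAt.clm_apply hv

lemma hasDerivWithinAt_exp_neg_smul_apply {v : ℝ → E} {v' : E} {s : Set ℝ} {t : ℝ}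
    (hv : HasDerivWithinAt v v' s t) :
    HasDerivWithinAt (fun r => NormedSpace.exp ((-r) • A) (v r))
      (NormedSpace.exp ((-t) • A) (v' - A (v t))) s t := by
  have h : HasDerivAt (fun u : ℝ => NormedSpace.exp ((-u) • A))
      (-(NormedSpace.exp ((-t) • A) * A)) t := by
    have h := (hasDerivAt_exp_smul_const A (-t)).scomp t (hasDerivAt_neg t)
    simpa [Function.comp_def] using h
  convert h.hasDerivWithinAt.clm_apply hv using 1
  simp [sub_eq_add_neg, add_comm]

/-- The forcing carries càdlàg noise and is only right-continuous, so its primitive has just a right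
derivative. The one-sided fundamental theorem of calculus used in `variation_of_constants` asks for
no more. -/
lemma hasDerivWithinAt_primitive {u : ℝ → E} {t : ℝ} (ht : t < 0)
    (hu : ContinuousWithinAt u (Ioi t) t) (hint : IntervalIntegrable u volume 0 t) :
    HasDerivWithinAt (fun r => ∫ s in (0 : ℝ)..r, u s) (u t) (Ioi t) t := by
  refine (intervalIntegral.integral_hasDerivWithinAt_right (s := Ici t) (t := Ioi t) hint ?_
    hu).mono Ioi_subset_Ici_self
  refine ⟨Ioc t 0, Ioc_mem_nhdsGT ht, ?_⟩
  exact ((intervalIntegrable_iff_integrableOn_Ioc_of_le ht.le).1 hint.symm).1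

lemma continuousOn_primitive_Iic {u : ℝ → E} (hint : ∀ t ≤ 0, IntervalIntegrable u volume 0 t) :
    ContinuousOn (fun r => ∫ s in (0 : ℝ)..r, u s) (Iic 0) := by
  intro t ht
  have h := intervalIntegral.continuousOn_primitive_interval' (hint (t - 1)
    (by simp only [mem_Iic] at ht; linarith)) left_mem_uIcc
  rw [uIcc_of_ge (by simp only [mem_Iic] at ht; linarith)] at h
  refine (h t ⟨by linarith, ht⟩).mono_of_mem_nhdsWithin ?_
  filter_upwards [self_mem_nhdsWithin, mem_nhdsWithin_of_mem_nhds (Ioi_mem_nhds (sub_one_lt t))]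
    with r h1 h2 using ⟨h2.le, h1⟩

/-- **Variation of constants** for a right-continuous, integrable forcing term. -/
theorem variation_of_constants {u : ℝ → E} (hu : ∀ t < 0, ContinuousWithinAt u (Ioi t) t)
    (hint : ∀ t ≤ 0, IntervalIntegrable u volume 0 t) (p : E) (x : ℝ → E) :
    (∀ t ≤ 0, x t = NormedSpace.exp (t • A) p +
      ∫ s in (0 : ℝ)..t, NormedSpace.exp ((t - s) • A) (u s)) ↔
    ContinuousOn x (Iic 0) ∧ ∀ t ≤ 0, x t = p + ∫ s in (0 : ℝ)..t, (A (x s) + u s) := by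
  have hc : Continuous fun s : ℝ => NormedSpace.exp ((-s) • A) :=
    (continuous_exp_smul A).comp continuous_neg
  have hexpu : ∀ t ≤ 0, IntervalIntegrable (fun s => NormedSpace.exp ((-s) • A) (u s))
      volume 0 t := fun t ht => intervalIntegrable_clm_apply hc (hint t ht)
  have hpull : ∀ t ≤ 0, ∫ s in (0 : ℝ)..t, NormedSpace.exp ((t - s) • A) (u s)
      = NormedSpace.exp (t • A) (∫ s in (0 : ℝ)..t, NormedSpace.exp ((-s) • A) (u s)) := by
    intro t ht
    rw [← ContinuousLinearMap.intervalIntegral_comp_comm _ (hexpu t ht)]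
    simp_rw [exp_sub_smul_apply]
  have hAx : ∀ t ≤ 0, ContinuousOn x (Iic 0) →
      IntervalIntegrable (fun s => A (x s) + u s) volume 0 t := by
    intro t ht hx
    refine IntervalIntegrable.add ?_ (hint t ht)
    refine (A.continuous.comp_continuousOn (hx.mono ?_)).intervalIntegrable
    rw [uIcc_of_ge ht]; exact Icc_subset_Iic_self
  constructor
  · intro hx
    -- Pulling `e^{tA}` out of the integral leaves a smooth factor applied to a primitive, so the
    -- product rule gives the right derivative.
    have hx' : ∀ t ≤ 0, x t = NormedSpace.exp (t • A)
        (p + ∫ s in (0 : ℝ)..t, NormedSpace.exp ((-s) • A) (u s)) := by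
      intro t ht
      rw [hx t ht, hpull t ht, map_add]
    have hcont : ContinuousOn x (Iic 0) :=
      ((continuous_exp_smul A).continuousOn.clm_apply
        (continuousOn_const.add (continuousOn_primitive_Iic hexpu))).congr fun t ht => hx' t ht
    refine ⟨hcont, fun t ht => ?_⟩
    rw [intervalIntegral.integral_eq_sub_of_hasDeriv_right (f := x)
      (hcont.mono (by rw [uIcc_of_ge ht]; exact Icc_subset_Iic_self)) ?_ (hAx t ht hcont)]
    · simp [hx' 0 le_rfl, NormedSpace.exp_zero]
    · intro r hr
      rw [min_eq_right ht, max_eq_left ht] at hr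
      have hd := hasDerivWithinAt_exp_smul_apply A (((hasDerivWithinAt_primitive hr.2
        (hc.continuousWithinAt.clm_apply (hu r hr.2)) (hexpu r hr.2.le)).const_add p))
      rw [exp_smul_apply_neg, ← hx' r hr.2.le] at hd
      refine hd.congr_of_eventuallyEq ?_ (hx' r hr.2.le)
      filter_upwards [Ioc_mem_nhdsGT hr.2] with q hq using hx' q hq.2
  · rintro ⟨hcont, hx⟩ t ht
    have hint' := fun t ht => hAx t ht hcont
    have hderiv : ∀ r < 0, HasDerivWithinAt x (A (x r) + u r) (Ioi r) r := by
      intro r hr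
      have hxr : ContinuousWithinAt x (Ioi r) r :=
        (hcont.continuousAt (Iic_mem_nhds hr)).continuousWithinAt
      refine ((hasDerivWithinAt_primitive hr ((A.continuous.continuousAt.comp_continuousWithinAt
        hxr).add (hu r hr)) (hint' r hr.le)).const_add p).congr_of_eventuallyEq ?_ (hx r hr.le)
      filter_upwards [Ioc_mem_nhdsGT hr] with q hq using hx q hq.2
    -- In the right derivative of `e^{-rA} x(r)` the linear term cancels and only `e^{-rA} u(r)` is
    -- left.
    have hFTC := intervalIntegral.integral_eq_sub_of_hasDeriv_right
      (f := fun r => NormedSpace.exp ((-r) • A) (x r)) (a := 0) (b := t)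
      (f' := fun s => NormedSpace.exp ((-s) • A) (u s))
      (hc.continuousOn.clm_apply (hcont.mono (by rw [uIcc_of_ge ht]; exact Icc_subset_Iic_self)))
      (fun r hr => by
        rw [min_eq_right ht, max_eq_left ht] at hr
        simpa using hasDerivWithinAt_exp_neg_smul_apply A (hderiv r hr.2)) (hexpu t ht)
    rw [hpull t ht, hFTC, ← map_add]
    simpa [hx 0 le_rfl, NormedSpace.exp_zero] using (exp_smul_apply_neg A t (x t)).symm

variable {A}

/-- Splitting `∫_{-∞}^t` at `0` exhibits the improper integral as a variation-of-constants formula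
whose initial value is its own value at time `0`. -/
lemma integral_Iic_exp_smul {u : ℝ → E}
    (hint : IntegrableOn (fun s => NormedSpace.exp ((-s) • A) (u s)) (Iic 0)) {t : ℝ} (ht : t ≤ 0) :
    ∫ s in Iic t, NormedSpace.exp ((t - s) • A) (u s) =
      NormedSpace.exp (t • A) ((∫ s in Iic (0 : ℝ), NormedSpace.exp ((-s) • A) (u s)) +
        ∫ s in (0 : ℝ)..t, NormedSpace.exp ((-s) • A) (u s)) := by
  have hint' := hint.mono_set (Iic_subset_Iic.2 ht)
  rw [← intervalIntegral.integral_Iic_sub_Iic hint hint', add_sub_cancel,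
    ← ContinuousLinearMap.integral_comp_comm _ hint']
  simp_rw [exp_sub_smul_apply]

lemma norm_exp_apply_le_of_decay {κ ρ M : ℝ}
    (hA : ∀ t ≥ (0 : ℝ), ‖NormedSpace.exp (t • A)‖ ≤ Real.exp (-κ * t)) {u : ℝ → E} {s t : ℝ}
    (hu : ‖u s‖ ≤ M * Real.exp (-ρ * s)) (hst : s ≤ t) :
    ‖NormedSpace.exp ((t - s) • A) (u s)‖
      ≤ M * Real.exp (-κ * t) * Real.exp ((κ - ρ) * s) := by
  refine ((NormedSpace.exp ((t - s) • A)).le_of_opNorm_le (hA _ (sub_nonneg.2 hst)) _).trans ?_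
  refine (mul_le_mul_of_nonneg_left hu (Real.exp_pos _).le).trans (le_of_eq ?_)
  rw [mul_left_comm, mul_assoc, ← Real.exp_add, ← Real.exp_add]
  ring_nf

lemma integrableOn_exp_Iic {κ ρ M : ℝ} (hκ : ρ < κ)
    (hA : ∀ t ≥ (0 : ℝ), ‖NormedSpace.exp (t • A)‖ ≤ Real.exp (-κ * t)) {u : ℝ → E} {t : ℝ}
    (hum : AEStronglyMeasurable u (volume.restrict (Iic t)))
    (hu : ∀ s ≤ t, ‖u s‖ ≤ M * Real.exp (-ρ * s)) :
    IntegrableOn (fun s => NormedSpace.exp ((t - s) • A) (u s)) (Iic t) := by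
  refine ((integrableOn_exp_mul_Iic (sub_pos.2 hκ) t).const_mul
    (M * Real.exp (-κ * t))).mono' (aestronglyMeasurable_clm_apply
      ((continuous_exp_smul A).comp (continuous_const.sub continuous_id)) hum) ?_
  refine (ae_restrict_mem measurableSet_Iic).mono fun s hs => ?_
  exact norm_exp_apply_le_of_decay hA (hu s hs) hs

/-- Since `∫_{-∞}^t e^{-κ(t-s)} e^{-ρs} ds = e^{-ρt}/(κ-ρ)`, the fast convolution preserves the
weight, at the cost of the factor `1/(κ-ρ)`. -/
lemma norm_integral_exp_Iic_le {κ ρ M : ℝ} (hκ : ρ < κ)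
    (hA : ∀ t ≥ (0 : ℝ), ‖NormedSpace.exp (t • A)‖ ≤ Real.exp (-κ * t)) {u : ℝ → E} {t : ℝ}
    (hu : ∀ s ≤ t, ‖u s‖ ≤ M * Real.exp (-ρ * s)) :
    ‖∫ s in Iic t, NormedSpace.exp ((t - s) • A) (u s)‖ ≤ M / (κ - ρ) * Real.exp (-ρ * t) := by
  have hpos : 0 < κ - ρ := sub_pos.2 hκ
  refine (norm_integral_le_of_norm_le ((integrableOn_exp_mul_Iic hpos t).const_mul
    (M * Real.exp (-κ * t))) ((ae_restrict_mem measurableSet_Iic).mono fun s hs =>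
      norm_exp_apply_le_of_decay hA (hu s hs) hs)).trans (le_of_eq ?_)
  rw [integral_const_mul, integral_exp_mul_Iic hpos]
  have : Real.exp (-ρ * t) = Real.exp (-κ * t) * Real.exp ((κ - ρ) * t) := by
    rw [← Real.exp_add]; ring_nf
  rw [this]; ring

/-- The slow counterpart: `∫_t^0 e^{μ(t-s)} e^{-ρs} ds = (e^{-ρt} - e^{μt})/(μ+ρ)`, and the negative
term is dropped. -/
lemma norm_integral_exp_le {μ ρ M : ℝ} (hμ : 0 < μ + ρ)
    (hA : ∀ t ≤ (0 : ℝ), ‖NormedSpace.exp (t • A)‖ ≤ Real.exp (μ * t)) {u : ℝ → E} {t : ℝ}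
    (ht : t ≤ 0) (hu : ∀ s ≤ 0, ‖u s‖ ≤ M * Real.exp (-ρ * s)) :
    ‖∫ s in (0 : ℝ)..t, NormedSpace.exp ((t - s) • A) (u s)‖
      ≤ M / (μ + ρ) * Real.exp (-ρ * t) := by
  have hM : 0 ≤ M := by simpa using (norm_nonneg _).trans (hu 0 le_rfl)
  rw [intervalIntegral.integral_symm, norm_neg]
  have hbd : ∀ s ∈ Ioc t 0, ‖NormedSpace.exp ((t - s) • A) (u s)‖
      ≤ M * Real.exp (μ * t) * Real.exp (-(μ + ρ) * s) := by
    intro s hs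
    refine ((NormedSpace.exp ((t - s) • A)).le_of_opNorm_le
      (hA _ (sub_nonpos.2 hs.1.le)) _).trans ?_
    refine (mul_le_mul_of_nonneg_left (hu s hs.2) (Real.exp_pos _).le).trans (le_of_eq ?_)
    rw [mul_left_comm, mul_assoc, ← Real.exp_add, ← Real.exp_add]
    ring_nf
  refine (intervalIntegral.norm_integral_le_of_norm_le ht (Eventually.of_forall hbd)
    (Continuous.intervalIntegrable (by fun_prop) _ _)).trans ?_
  rw [intervalIntegral.integral_const_mul,
    intervalIntegral.integral_comp_mul_left (fun x => Real.exp x) (by linarith), integral_exp]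
  have h1 : Real.exp (-ρ * t) = Real.exp (μ * t) * Real.exp (-(μ + ρ) * t) := by
    rw [← Real.exp_add]; ring_nf
  have h2 : M * Real.exp (μ * t) * ((-(μ + ρ))⁻¹ • (Real.exp (-(μ + ρ) * 0)
      - Real.exp (-(μ + ρ) * t))) = M / (μ + ρ) * Real.exp (-ρ * t)
        - M / (μ + ρ) * Real.exp (μ * t) := by
    rw [h1, smul_eq_mul, inv_neg, mul_zero, Real.exp_zero]; ring
  rw [h2]
  exact sub_le_self _ (by positivity)

end Exponential

/-! ### The Lyapunov–Perron operator on weighted functions. -/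

section LyapunovPerron

lemma memWeighted_neg_iff {E : Type*} [NormedAddCommGroup E] {ρ : ℝ} {φ : ℝ → E} :
    MemWeighted (-ρ) φ ↔
      ContinuousOn φ (Iic 0) ∧ ∃ M, ∀ t ≤ 0, ‖φ t‖ ≤ M * Real.exp (-ρ * t) := by
  refine and_congr_right fun _ => ⟨?_, ?_⟩
  · rintro ⟨M, hM⟩
    refine ⟨M, fun t ht => ?_⟩
    have h : Real.exp (- -ρ * t) * ‖φ t‖ ≤ M := hM ⟨t, ht, rfl⟩
    calc ‖φ t‖ = (Real.exp (- -ρ * t) * ‖φ t‖) * Real.exp (-ρ * t) := by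
          rw [mul_right_comm, ← Real.exp_add]; simp
      _ ≤ M * Real.exp (-ρ * t) := by gcongr
  · rintro ⟨M, hM⟩
    refine ⟨M, ?_⟩
    rintro _ ⟨t, ht, rfl⟩
    calc Real.exp (- -ρ * t) * ‖φ t‖ ≤ Real.exp (- -ρ * t) * (M * Real.exp (-ρ * t)) := by
          gcongr; exact hM t ht
      _ = M := by rw [mul_left_comm, ← Real.exp_add]; simp

variable {E₁ E₂ : Type*} [NormedAddCommGroup E₁] [NormedSpace ℝ E₁]
  [NormedAddCommGroup E₂] [NormedSpace ℝ E₂]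

/-- The standing assumptions under which the Lyapunov-Perron operator is a contraction of the
space of pairs of continuous functions on `(-∞, 0]` that are `O(e^{-ρ t})`. -/
structure LPContracting (a b : ℝ) (S : E₁ →L[ℝ] E₁) (F : E₂ →L[ℝ] E₂) (g₁ : E₁ → E₂ → E₁)
    (g₂ : E₁ → E₂ → E₂) (z : ℝ → E₂) (ρ K μ κ : ℝ) : Prop where
  a_nonneg : 0 ≤ a
  b_nonneg : 0 ≤ b
  K_nonneg : 0 ≤ K
  rho_pos : 0 < ρ
  mu_nonneg : 0 ≤ μ
  rho_lt : ρ < κ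
  exp_S : ∀ t ≤ (0 : ℝ), ‖NormedSpace.exp ((a * t) • S)‖ ≤ Real.exp (μ * t)
  exp_F : ∀ t ≥ (0 : ℝ), ‖NormedSpace.exp ((b * t) • F)‖ ≤ Real.exp (-κ * t)
  lip₁ : ∀ x₁ y₁ x₂ y₂, ‖g₁ x₁ y₁ - g₁ x₂ y₂‖ ≤ K * (‖x₁ - x₂‖ + ‖y₁ - y₂‖)
  lip₂ : ∀ x₁ y₁ x₂ y₂, ‖g₂ x₁ y₁ - g₂ x₂ y₂‖ ≤ K * (‖x₁ - x₂‖ + ‖y₁ - y₂‖)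
  contraction : a * K / (μ + ρ) + b * K / (κ - ρ) < 1
  noise_right_cont : ∀ t < 0, ContinuousWithinAt z (Ioi t) t
  noise_meas : StronglyMeasurable z
  noise_bound : ∃ M, ∀ t ≤ 0, ‖z t‖ ≤ M * Real.exp (-ρ * t)

lemma continuous_uncurry_of_lip {E : Type*} [NormedAddCommGroup E] {g : E₁ → E₂ → E} {K : ℝ}
    (hg : ∀ x₁ y₁ x₂ y₂, ‖g x₁ y₁ - g x₂ y₂‖ ≤ K * (‖x₁ - x₂‖ + ‖y₁ - y₂‖)) :
    Continuous fun p : E₁ × E₂ => g p.1 p.2 := by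
  refine continuous_iff_continuousAt.2 fun p => ?_
  refine tendsto_iff_norm_sub_tendsto_zero.2 ?_
  refine squeeze_zero (fun _ => norm_nonneg _) (fun q => hg _ _ _ _) ?_
  have : Continuous fun q : E₁ × E₂ => K * (‖q.1 - p.1‖ + ‖q.2 - p.2‖) := by fun_prop
  simpa using this.tendsto p

/-- The first component of the Lyapunov-Perron operator. -/
def lpX (a : ℝ) (S : E₁ →L[ℝ] E₁) (g₁ : E₁ → E₂ → E₁) (z : ℝ → E₂) (x₀ : E₁)
    (x : ℝ → E₁) (y : ℝ → E₂) (t : ℝ) : E₁ :=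
  NormedSpace.exp ((a * t) • S) x₀ +
    a • ∫ s in (0 : ℝ)..t, NormedSpace.exp ((a * (t - s)) • S) (g₁ (x s) (y s + z s))

/-- The second component of the Lyapunov-Perron operator. -/
def lpY (b : ℝ) (F : E₂ →L[ℝ] E₂) (g₂ : E₁ → E₂ → E₂) (z : ℝ → E₂)
    (x : ℝ → E₁) (y : ℝ → E₂) (t : ℝ) : E₂ :=
  b • ∫ s in Iic t, NormedSpace.exp ((b * (t - s)) • F) (g₂ (x s) (y s + z s))

/-- The iterates of the Lyapunov-Perron operator, started from `0`. -/
def lpIter (a b : ℝ) (S : E₁ →L[ℝ] E₁) (F : E₂ →L[ℝ] E₂) (g₁ : E₁ → E₂ → E₁)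
    (g₂ : E₁ → E₂ → E₂) (z : ℝ → E₂) (x₀ : E₁) : ℕ → (ℝ → E₁) × (ℝ → E₂)
  | 0 => (fun _ => 0, fun _ => 0)
  | n + 1 =>
    let φ := lpIter a b S F g₁ g₂ z x₀ n
    (lpX a S g₁ z x₀ φ.1 φ.2, lpY b F g₂ z φ.1 φ.2)

variable [CompleteSpace E₁] [CompleteSpace E₂]

namespace LPContracting

variable {a b : ℝ} {S : E₁ →L[ℝ] E₁} {F : E₂ →L[ℝ] E₂} {g₁ : E₁ → E₂ → E₁}
  {g₂ : E₁ → E₂ → E₂} {z : ℝ → E₂} {ρ K μ κ : ℝ} {x x' : ℝ → E₁} {y y' : ℝ → E₂} {x₀ : E₁}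

section Forcing

variable {E : Type*} [NormedAddCommGroup E] {g : E₁ → E₂ → E}

lemma forcing_meas (h : LPContracting a b S F g₁ g₂ z ρ K μ κ)
    (hg : ∀ x₁ y₁ x₂ y₂, ‖g x₁ y₁ - g x₂ y₂‖ ≤ K * (‖x₁ - x₂‖ + ‖y₁ - y₂‖))
    (hx : MemWeighted (-ρ) x) (hy : MemWeighted (-ρ) y) :
    AEStronglyMeasurable (fun s => g (x s) (y s + z s)) (volume.restrict (Iic 0)) :=
  (continuous_uncurry_of_lip hg).comp_aestronglyMeasurable
    ((hx.1.aestronglyMeasurable measurableSet_Iic).prodMk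
      ((hy.1.aestronglyMeasurable measurableSet_Iic).add h.noise_meas.aestronglyMeasurable))

lemma forcing_right_cont (h : LPContracting a b S F g₁ g₂ z ρ K μ κ)
    (hg : ∀ x₁ y₁ x₂ y₂, ‖g x₁ y₁ - g x₂ y₂‖ ≤ K * (‖x₁ - x₂‖ + ‖y₁ - y₂‖))
    (hx : MemWeighted (-ρ) x) (hy : MemWeighted (-ρ) y) (t : ℝ) (ht : t < 0) :
    ContinuousWithinAt (fun s => g (x s) (y s + z s)) (Ioi t) t :=
  (continuous_uncurry_of_lip hg).continuousAt.comp_continuousWithinAt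
    (f := fun s => (x s, y s + z s))
    ((hx.1.continuousAt (Iic_mem_nhds ht)).continuousWithinAt.prodMk
      ((hy.1.continuousAt (Iic_mem_nhds ht)).continuousWithinAt.add (h.noise_right_cont t ht)))

lemma forcing_bound (h : LPContracting a b S F g₁ g₂ z ρ K μ κ)
    (hg : ∀ x₁ y₁ x₂ y₂, ‖g x₁ y₁ - g x₂ y₂‖ ≤ K * (‖x₁ - x₂‖ + ‖y₁ - y₂‖))
    (hx : MemWeighted (-ρ) x) (hy : MemWeighted (-ρ) y) :
    ∃ M, ∀ s ≤ 0, ‖g (x s) (y s + z s)‖ ≤ M * Real.exp (-ρ * s) := by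
  obtain ⟨M₁, h₁⟩ := (memWeighted_neg_iff.1 hx).2
  obtain ⟨M₂, h₂⟩ := (memWeighted_neg_iff.1 hy).2
  obtain ⟨M₃, h₃⟩ := h.noise_bound
  refine ⟨‖g 0 0‖ + K * (M₁ + (M₂ + M₃)), fun s hs => ?_⟩
  -- The weight is at least `1` on the negative half-line, so it absorbs the constant `‖g 0 0‖`.
  have he : 1 ≤ Real.exp (-ρ * s) := Real.one_le_exp (by nlinarith [h.rho_pos])
  have hK := h.K_nonneg
  have hb := hg (x s) (y s + z s) 0 0
  simp only [sub_zero] at hb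
  have hK' : K * (‖x s‖ + ‖y s + z s‖) ≤ K * (M₁ + (M₂ + M₃)) * Real.exp (-ρ * s) := by
    rw [mul_assoc]
    refine mul_le_mul_of_nonneg_left ?_ hK
    linarith [h₁ s hs, h₂ s hs, h₃ s hs, norm_add_le (y s) (z s)]
  calc ‖g (x s) (y s + z s)‖ ≤ ‖g 0 0‖ + ‖g (x s) (y s + z s) - g 0 0‖ := norm_le_insert' _ _
    _ ≤ ‖g 0 0‖ * Real.exp (-ρ * s) + K * (M₁ + (M₂ + M₃)) * Real.exp (-ρ * s) :=
        add_le_add (le_mul_of_one_le_right (norm_nonneg _) he) (hb.trans hK')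
    _ = _ := by ring

lemma forcing_intervalIntegrable (h : LPContracting a b S F g₁ g₂ z ρ K μ κ)
    (hg : ∀ x₁ y₁ x₂ y₂, ‖g x₁ y₁ - g x₂ y₂‖ ≤ K * (‖x₁ - x₂‖ + ‖y₁ - y₂‖))
    (hx : MemWeighted (-ρ) x) (hy : MemWeighted (-ρ) y) (t : ℝ) (ht : t ≤ 0) :
    IntervalIntegrable (fun s => g (x s) (y s + z s)) volume 0 t := by
  obtain ⟨M, hM⟩ := h.forcing_bound hg hx hy
  have hc : Continuous fun s : ℝ => M * Real.exp (-ρ * s) := by fun_prop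
  refine (hc.intervalIntegrable 0 t).mono_fun' ?_ ?_
  · rw [uIoc_of_ge ht]
    exact (h.forcing_meas hg hx hy).mono_set Ioc_subset_Iic_self
  · rw [uIoc_of_ge ht]
    exact (ae_restrict_mem measurableSet_Ioc).mono fun s hs => hM s hs.2

end Forcing

lemma exp_smul_S (h : LPContracting a b S F g₁ g₂ z ρ K μ κ) (t : ℝ) (ht : t ≤ 0) :
    ‖NormedSpace.exp (t • (a • S))‖ ≤ Real.exp (μ * t) := by
  rw [← mul_smul_eq_smul_smul]; exact h.exp_S t ht

lemma exp_smul_F (h : LPContracting a b S F g₁ g₂ z ρ K μ κ) (t : ℝ) (ht : t ≥ 0) :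
    ‖NormedSpace.exp (t • (b • F))‖ ≤ Real.exp (-κ * t) := by
  rw [← mul_smul_eq_smul_smul]; exact h.exp_F t ht

lemma lpX_eq (t : ℝ) : lpX a S g₁ z x₀ x y t = NormedSpace.exp (t • (a • S)) x₀ +
    ∫ s in (0 : ℝ)..t, NormedSpace.exp ((t - s) • (a • S)) (a • g₁ (x s) (y s + z s)) := by
  simp_rw [lpX, mul_smul_eq_smul_smul, map_smul, intervalIntegral.integral_smul]

lemma lpY_eq (t : ℝ) : lpY b F g₂ z x y t =
    ∫ s in Iic t, NormedSpace.exp ((t - s) • (b • F)) (b • g₂ (x s) (y s + z s)) := by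
  simp_rw [lpY, mul_smul_eq_smul_smul, map_smul, integral_smul]

lemma integrableOn_Y (h : LPContracting a b S F g₁ g₂ z ρ K μ κ)
    (hx : MemWeighted (-ρ) x) (hy : MemWeighted (-ρ) y) (t : ℝ) (ht : t ≤ 0) :
    IntegrableOn (fun s => NormedSpace.exp ((t - s) • (b • F)) (g₂ (x s) (y s + z s))) (Iic t) := by
  obtain ⟨M, hM⟩ := h.forcing_bound h.lip₂ hx hy
  exact integrableOn_exp_Iic h.rho_lt h.exp_smul_F
    ((h.forcing_meas h.lip₂ hx hy).mono_set (Iic_subset_Iic.2 ht)) fun s hs => hM s (hs.trans ht)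

lemma intervalIntegrable_X (h : LPContracting a b S F g₁ g₂ z ρ K μ κ)
    (hx : MemWeighted (-ρ) x) (hy : MemWeighted (-ρ) y) (t : ℝ) (ht : t ≤ 0) :
    IntervalIntegrable (fun s => NormedSpace.exp ((t - s) • (a • S)) (g₁ (x s) (y s + z s)))
      volume 0 t :=
  intervalIntegrable_clm_apply ((continuous_exp_smul _).comp (continuous_const.sub continuous_id))
    (h.forcing_intervalIntegrable h.lip₁ hx hy t ht)

/-- For weighted functions the integrability clauses hold automatically, which leaves a pure
fixed-point equation. -/
lemma isLPSolution_iff (h : LPContracting a b S F g₁ g₂ z ρ K μ κ) :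
    IsLPSolution a b S F g₁ g₂ z (-ρ) x₀ x y ↔ MemWeighted (-ρ) x ∧ MemWeighted (-ρ) y ∧
      ∀ t ≤ 0, x t = lpX a S g₁ z x₀ x y t ∧ y t = lpY b F g₂ z x y t := by
  refine and_congr_right fun hx => and_congr_right fun hy => forall₂_congr fun t ht => ?_
  refine ⟨fun H => H.2.2, fun H => ⟨?_, ?_, H⟩⟩
  · simpa only [mul_smul_eq_smul_smul] using h.intervalIntegrable_X hx hy t ht
  · simpa only [mul_smul_eq_smul_smul] using h.integrableOn_Y hx hy t ht

lemma lpX_ode (h : LPContracting a b S F g₁ g₂ z ρ K μ κ)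
    (hx : MemWeighted (-ρ) x) (hy : MemWeighted (-ρ) y) (X : ℝ → E₁) :
    (∀ t ≤ 0, X t = lpX a S g₁ z x₀ x y t) ↔ ContinuousOn X (Iic 0) ∧
      ∀ t ≤ 0, X t = x₀ + ∫ s in (0 : ℝ)..t, ((a • S) (X s) + a • g₁ (x s) (y s + z s)) := by
  simp_rw [lpX_eq]
  exact variation_of_constants (a • S) (fun t ht => (h.forcing_right_cont h.lip₁ hx hy t ht).const_smul a)
    (fun t ht => (h.forcing_intervalIntegrable h.lip₁ hx hy t ht).smul a) x₀ X

lemma lpY_eq_add (h : LPContracting a b S F g₁ g₂ z ρ K μ κ)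
    (hx : MemWeighted (-ρ) x) (hy : MemWeighted (-ρ) y) (t : ℝ) (ht : t ≤ 0) :
    lpY b F g₂ z x y t = NormedSpace.exp (t • (b • F)) (lpY b F g₂ z x y 0) +
      ∫ s in (0 : ℝ)..t, NormedSpace.exp ((t - s) • (b • F)) (b • g₂ (x s) (y s + z s)) := by
  have hi : IntegrableOn (fun s => NormedSpace.exp ((-s) • (b • F)) (b • g₂ (x s) (y s + z s)))
      (Iic 0) := by
    have := (h.integrableOn_Y hx hy 0 le_rfl).smul b
    simpa only [zero_sub, map_smul] using! this
  have hi' : IntervalIntegrable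
      (fun s => NormedSpace.exp ((-s) • (b • F)) (b • g₂ (x s) (y s + z s))) volume 0 t :=
    intervalIntegrable_clm_apply ((continuous_exp_smul _).comp continuous_neg)
      ((h.forcing_intervalIntegrable h.lip₂ hx hy t ht).smul b)
  rw [lpY_eq, lpY_eq, integral_Iic_exp_smul hi ht, map_add,
    ← ContinuousLinearMap.intervalIntegral_comp_comm _ hi']
  simp_rw [zero_sub, exp_sub_smul_apply]

lemma lpY_ode (h : LPContracting a b S F g₁ g₂ z ρ K μ κ)
    (hx : MemWeighted (-ρ) x) (hy : MemWeighted (-ρ) y) (p : E₂) (Y : ℝ → E₂) :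
    (∀ t ≤ 0, Y t = NormedSpace.exp (t • (b • F)) p +
      ∫ s in (0 : ℝ)..t, NormedSpace.exp ((t - s) • (b • F)) (b • g₂ (x s) (y s + z s))) ↔
      ContinuousOn Y (Iic 0) ∧
      ∀ t ≤ 0, Y t = p + ∫ s in (0 : ℝ)..t, ((b • F) (Y s) + b • g₂ (x s) (y s + z s)) :=
  variation_of_constants (b • F) (fun t ht => (h.forcing_right_cont h.lip₂ hx hy t ht).const_smul b)
    (fun t ht => (h.forcing_intervalIntegrable h.lip₂ hx hy t ht).smul b) p Y

lemma memWeighted_lpX (h : LPContracting a b S F g₁ g₂ z ρ K μ κ)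
    (hx : MemWeighted (-ρ) x) (hy : MemWeighted (-ρ) y) :
    MemWeighted (-ρ) (lpX a S g₁ z x₀ x y) := by
  refine memWeighted_neg_iff.2 ⟨((h.lpX_ode hx hy _).1 fun _ _ => rfl).1, ?_⟩
  obtain ⟨M, hM⟩ := h.forcing_bound h.lip₁ hx hy
  refine ⟨‖x₀‖ + a * (M / (μ + ρ)), fun t ht => ?_⟩
  have hμ : 0 < μ + ρ := add_pos_of_nonneg_of_pos h.mu_nonneg h.rho_pos
  have he : 1 ≤ Real.exp (-ρ * t) := Real.one_le_exp (by nlinarith [h.rho_pos])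
  have h1 : ‖NormedSpace.exp ((a * t) • S) x₀‖ ≤ ‖x₀‖ * Real.exp (-ρ * t) := by
    refine ((NormedSpace.exp ((a * t) • S)).le_of_opNorm_le (h.exp_S t ht) x₀).trans ?_
    have : Real.exp (μ * t) ≤ 1 := Real.exp_le_one_iff.2 (by nlinarith [h.mu_nonneg])
    nlinarith [norm_nonneg x₀]
  have h2 := norm_integral_exp_le hμ h.exp_smul_S ht hM
  have ha := h.a_nonneg
  simp_rw [← mul_smul_eq_smul_smul] at h2
  calc ‖lpX a S g₁ z x₀ x y t‖ ≤ ‖x₀‖ * Real.exp (-ρ * t)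
        + a * (M / (μ + ρ) * Real.exp (-ρ * t)) := by
        refine (norm_add_le _ _).trans (add_le_add h1 ?_)
        rw [norm_smul, Real.norm_of_nonneg ha]
        gcongr
    _ = _ := by ring

lemma memWeighted_lpY (h : LPContracting a b S F g₁ g₂ z ρ K μ κ)
    (hx : MemWeighted (-ρ) x) (hy : MemWeighted (-ρ) y) :
    MemWeighted (-ρ) (lpY b F g₂ z x y) := by
  refine memWeighted_neg_iff.2
    ⟨((h.lpY_ode hx hy _ _).1 fun t ht => h.lpY_eq_add hx hy t ht).1, ?_⟩
  obtain ⟨M, hM⟩ := h.forcing_bound h.lip₂ hx hy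
  refine ⟨b * (M / (κ - ρ)), fun t ht => ?_⟩
  have h2 := norm_integral_exp_Iic_le h.rho_lt h.exp_smul_F fun s hs => hM s (hs.trans ht)
  have hb := h.b_nonneg
  simp_rw [← mul_smul_eq_smul_smul] at h2
  rw [lpY, norm_smul, Real.norm_of_nonneg hb, mul_assoc]
  gcongr

end LPContracting

end LyapunovPerron

/-! ### Unique fixed point, and the slow manifold as its graph. -/

section FixedPoint

variable {E₁ E₂ : Type*} [NormedAddCommGroup E₁] [NormedSpace ℝ E₁] [CompleteSpace E₁]
  [NormedAddCommGroup E₂] [NormedSpace ℝ E₂] [CompleteSpace E₂]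

namespace LPContracting

variable {a b : ℝ} {S : E₁ →L[ℝ] E₁} {F : E₂ →L[ℝ] E₂} {g₁ : E₁ → E₂ → E₁}
  {g₂ : E₁ → E₂ → E₂} {z : ℝ → E₂} {ρ K μ κ : ℝ} {x x' : ℝ → E₁} {y y' : ℝ → E₂} {x₀ : E₁}

lemma contraction_nonneg (h : LPContracting a b S F g₁ g₂ z ρ K μ κ) :
    0 ≤ a * K / (μ + ρ) + b * K / (κ - ρ) := by
  have h1 := h.a_nonneg; have h2 := h.b_nonneg; have h3 := h.K_nonneg
  have h4 : 0 ≤ μ + ρ := add_nonneg h.mu_nonneg h.rho_pos.le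
  have h5 : 0 ≤ κ - ρ := (sub_pos.2 h.rho_lt).le
  positivity

/-- The contraction estimate, phrased with pointwise bounds `D e^{-ρt}` in place of a norm on a
function space. Both components are added up, so that the factor is exactly the constant of the
field `contraction`. -/
lemma dist_lp_le (h : LPContracting a b S F g₁ g₂ z ρ K μ κ)
    (hx : MemWeighted (-ρ) x) (hy : MemWeighted (-ρ) y)
    (hx' : MemWeighted (-ρ) x') (hy' : MemWeighted (-ρ) y') {D : ℝ}
    (hD : ∀ s ≤ 0, ‖x s - x' s‖ + ‖y s - y' s‖ ≤ D * Real.exp (-ρ * s)) (t : ℝ) (ht : t ≤ 0) :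
    ‖lpX a S g₁ z x₀ x y t - lpX a S g₁ z x₀ x' y' t‖
      + ‖lpY b F g₂ z x y t - lpY b F g₂ z x' y' t‖
      ≤ (a * K / (μ + ρ) + b * K / (κ - ρ)) * D * Real.exp (-ρ * t) := by
  have ha := h.a_nonneg
  have hb := h.b_nonneg
  have hK := h.K_nonneg
  have hμ : 0 < μ + ρ := add_pos_of_nonneg_of_pos h.mu_nonneg h.rho_pos
  have hlip : ∀ s ≤ 0, K * (‖x s - x' s‖ + ‖y s + z s - (y' s + z s)‖)
      ≤ K * D * Real.exp (-ρ * s) := by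
    intro s hs
    rw [add_sub_add_right_eq_sub, mul_assoc]
    exact mul_le_mul_of_nonneg_left (hD s hs) hK
  have hX : ‖lpX a S g₁ z x₀ x y t - lpX a S g₁ z x₀ x' y' t‖
      ≤ a * (K * D / (μ + ρ) * Real.exp (-ρ * t)) := by
    simp only [lpX, mul_smul_eq_smul_smul]
    rw [add_sub_add_left_eq_sub, ← smul_sub, ← intervalIntegral.integral_sub
      (h.intervalIntegrable_X hx hy t ht) (h.intervalIntegrable_X hx' hy' t ht), norm_smul,
      Real.norm_of_nonneg ha]
    refine mul_le_mul_of_nonneg_left ?_ ha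
    simp_rw [← map_sub]
    exact norm_integral_exp_le hμ h.exp_smul_S ht fun s hs => (h.lip₁ _ _ _ _).trans (hlip s hs)
  have hY : ‖lpY b F g₂ z x y t - lpY b F g₂ z x' y' t‖
      ≤ b * (K * D / (κ - ρ) * Real.exp (-ρ * t)) := by
    simp only [lpY, mul_smul_eq_smul_smul]
    rw [← smul_sub, ← integral_sub
      (h.integrableOn_Y hx hy t ht) (h.integrableOn_Y hx' hy' t ht), norm_smul,
      Real.norm_of_nonneg hb]
    refine mul_le_mul_of_nonneg_left ?_ hb
    simp_rw [← map_sub]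
    exact norm_integral_exp_Iic_le h.rho_lt h.exp_smul_F
      fun s hs => (h.lip₂ _ _ _ _).trans (hlip s (hs.trans ht))
  refine (add_le_add hX hY).trans (le_of_eq ?_)
  ring

lemma exists_dist_bound (hx : MemWeighted (-ρ) x) (hy : MemWeighted (-ρ) y)
    (hx' : MemWeighted (-ρ) x') (hy' : MemWeighted (-ρ) y') :
    ∃ D, ∀ s ≤ 0, ‖x s - x' s‖ + ‖y s - y' s‖ ≤ D * Real.exp (-ρ * s) := by
  obtain ⟨M₁, h₁⟩ := (memWeighted_neg_iff.1 hx).2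
  obtain ⟨M₂, h₂⟩ := (memWeighted_neg_iff.1 hy).2
  obtain ⟨M₃, h₃⟩ := (memWeighted_neg_iff.1 hx').2
  obtain ⟨M₄, h₄⟩ := (memWeighted_neg_iff.1 hy').2
  refine ⟨M₁ + M₂ + M₃ + M₄, fun s hs => ?_⟩
  linarith [h₁ s hs, h₂ s hs, h₃ s hs, h₄ s hs, norm_sub_le (x s) (x' s), norm_sub_le (y s) (y' s)]

lemma unique (h : LPContracting a b S F g₁ g₂ z ρ K μ κ)
    (hs : IsLPSolution a b S F g₁ g₂ z (-ρ) x₀ x y)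
    (hs' : IsLPSolution a b S F g₁ g₂ z (-ρ) x₀ x' y') :
    EqOn x x' (Iic 0) ∧ EqOn y y' (Iic 0) := by
  obtain ⟨hx, hy, hxy⟩ := h.isLPSolution_iff.1 hs
  obtain ⟨hx', hy', hxy'⟩ := h.isLPSolution_iff.1 hs'
  obtain ⟨D, hD⟩ := exists_dist_bound hx hy hx' hy'
  set q := a * K / (μ + ρ) + b * K / (κ - ρ) with hq
  have hiter : ∀ n : ℕ, ∀ t ≤ 0, ‖x t - x' t‖ + ‖y t - y' t‖ ≤ q ^ n * D * Real.exp (-ρ * t) := by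
    intro n
    induction n with
    | zero => simpa using hD
    | succ n ih =>
      intro t ht
      have := h.dist_lp_le (x₀ := x₀) hx hy hx' hy' ih t ht
      rw [← (hxy t ht).1, ← (hxy t ht).2, ← (hxy' t ht).1, ← (hxy' t ht).2] at this
      rwa [pow_succ', mul_assoc q]
  have hzero : ∀ t ≤ 0, ‖x t - x' t‖ + ‖y t - y' t‖ ≤ 0 := by
    intro t ht
    have hlim : Tendsto (fun n : ℕ => q ^ n * D * Real.exp (-ρ * t)) atTop (𝓝 0) := by
      simpa [mul_assoc] using (tendsto_pow_atTop_nhds_zero_of_lt_one h.contraction_nonneg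
        h.contraction).mul_const (D * Real.exp (-ρ * t))
    exact ge_of_tendsto' hlim fun n => hiter n t ht
  constructor <;> intro t ht
  · refine sub_eq_zero.1 (norm_le_zero_iff.1 ?_)
    linarith [hzero t ht, norm_nonneg (y t - y' t)]
  · refine sub_eq_zero.1 (norm_le_zero_iff.1 ?_)
    linarith [hzero t ht, norm_nonneg (x t - x' t)]

lemma memWeighted_lpIter (h : LPContracting a b S F g₁ g₂ z ρ K μ κ) (n : ℕ) :
    MemWeighted (-ρ) (lpIter a b S F g₁ g₂ z x₀ n).1 ∧
      MemWeighted (-ρ) (lpIter a b S F g₁ g₂ z x₀ n).2 := by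
  induction n with
  | zero =>
    exact ⟨memWeighted_neg_iff.2 ⟨continuousOn_const, 0, fun t _ => by simp [lpIter]⟩,
      memWeighted_neg_iff.2 ⟨continuousOn_const, 0, fun t _ => by simp [lpIter]⟩⟩
  | succ n ih => exact ⟨h.memWeighted_lpX ih.1 ih.2, h.memWeighted_lpY ih.1 ih.2⟩

lemma dist_lpIter (h : LPContracting a b S F g₁ g₂ z ρ K μ κ) :
    ∃ D, ∀ (n : ℕ), ∀ t ≤ 0,
      ‖(lpIter a b S F g₁ g₂ z x₀ (n + 1)).1 t - (lpIter a b S F g₁ g₂ z x₀ n).1 t‖ +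
      ‖(lpIter a b S F g₁ g₂ z x₀ (n + 1)).2 t - (lpIter a b S F g₁ g₂ z x₀ n).2 t‖ ≤
      (a * K / (μ + ρ) + b * K / (κ - ρ)) ^ n * D * Real.exp (-ρ * t) := by
  have hm := fun n => h.memWeighted_lpIter (x₀ := x₀) n
  obtain ⟨D, hD⟩ := exists_dist_bound (hm 1).1 (hm 1).2 (hm 0).1 (hm 0).2
  refine ⟨D, fun n => ?_⟩
  induction n with
  | zero => simpa using hD
  | succ n ih =>
    intro t ht
    rw [pow_succ', mul_assoc (a * K / (μ + ρ) + b * K / (κ - ρ))]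
    exact h.dist_lp_le (x₀ := x₀) (hm (n + 1)).1 (hm (n + 1)).2 (hm n).1 (hm n).2 ih t ht

/-- A sequence of weighted functions with geometrically decaying increments converges to a
weighted function, at a geometric rate. -/
lemma _root_.SlowFast.exists_limit_of_geometric {E : Type*} [NormedAddCommGroup E]
    [CompleteSpace E] {ρ q D : ℝ} (hρ : 0 < ρ) (hq : 0 ≤ q) (hq1 : q < 1) {f : ℕ → ℝ → E}
    (hf : ∀ n, MemWeighted (-ρ) (f n))
    (hd : ∀ n, ∀ t ≤ 0, ‖f (n + 1) t - f n t‖ ≤ q ^ n * D * Real.exp (-ρ * t)) :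
    ∃ φ : ℝ → E, MemWeighted (-ρ) φ ∧
      ∀ n, ∀ t ≤ 0, ‖f n t - φ t‖ ≤ D / (1 - q) * q ^ n * Real.exp (-ρ * t) := by
  have hd' : ∀ t ≤ 0, ∀ n, dist (f n t) (f (n + 1) t) ≤ D * Real.exp (-ρ * t) * q ^ n := by
    intro t ht n
    rw [dist_comm, dist_eq_norm]
    exact (hd n t ht).trans (le_of_eq (by ring))
  have hlim : ∀ t ≤ 0, ∃ l, Tendsto (fun n => f n t) atTop (𝓝 l) := fun t ht =>
    cauchySeq_tendsto_of_complete (cauchySeq_of_le_geometric q _ hq1 (hd' t ht))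
  -- The limit gets the arbitrary value `0` at positive times, so that `choose` yields a function on
  -- all of `ℝ`.
  have : ∀ t, ∃ l, t ≤ 0 → Tendsto (fun n => f n t) atTop (𝓝 l) := fun t => by
    by_cases ht : t ≤ 0
    · exact (hlim t ht).imp fun l hl _ => hl
    · exact ⟨0, fun h => (ht h).elim⟩
  choose φ hφ using this
  have hb : ∀ n, ∀ t ≤ 0, ‖f n t - φ t‖ ≤ D / (1 - q) * q ^ n * Real.exp (-ρ * t) := by
    intro n t ht
    rw [← dist_eq_norm]
    refine (dist_le_of_le_geometric_of_tendsto q _ hq1 (hd' t ht) (hφ t ht) n).trans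
      (le_of_eq (by ring))
  have hD : 0 ≤ D := by
    have := (norm_nonneg _).trans (hd 0 0 le_rfl)
    simpa using this
  refine ⟨φ, memWeighted_neg_iff.2 ⟨?_, ?_⟩, hb⟩
  · refine TendstoLocallyUniformlyOn.continuousOn (F := f) (p := atTop) ?_
      (Frequently.of_forall fun n => (hf n).1)
    refine Metric.tendstoLocallyUniformlyOn_iff.2 fun ε hε t ht => ?_
    -- The weight is unbounded at `-∞`, so convergence is only locally uniform; on `(t-1, 0]` the
    -- weight is at most `e^{-ρ(t-1)}`.
    refine ⟨Iic 0 ∩ Ioi (t - 1), inter_mem self_mem_nhdsWithin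
      (mem_nhdsWithin_of_mem_nhds (Ioi_mem_nhds (sub_one_lt t))), ?_⟩
    have hto : Tendsto (fun n => D / (1 - q) * q ^ n * Real.exp (-ρ * (t - 1))) atTop (𝓝 0) := by
      simpa using ((tendsto_pow_atTop_nhds_zero_of_lt_one hq hq1).const_mul
        (D / (1 - q))).mul_const (Real.exp (-ρ * (t - 1)))
    filter_upwards [hto.eventually_lt_const hε] with n hn s hs
    rw [dist_comm, dist_eq_norm]
    refine ((hb n s hs.1).trans ?_).trans_lt hn
    have h1q : 0 < 1 - q := sub_pos.2 hq1
    refine mul_le_mul_of_nonneg_left (Real.exp_le_exp.2 ?_) (by positivity)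
    nlinarith [hs.2.out]
  · obtain ⟨M, hM⟩ := (memWeighted_neg_iff.1 (hf 0)).2
    refine ⟨M + D / (1 - q), fun t ht => ?_⟩
    have h0 := hb 0 t ht
    rw [pow_zero, mul_one] at h0
    have := norm_sub_norm_le (φ t) (f 0 t)
    rw [norm_sub_rev] at this
    rw [add_mul]
    linarith [hM t ht]

/-- Picard iteration from `0`. The convergence of the iterates is kept in the conclusion because
measurability in the path is later read off from them. -/
lemma exists_solution (h : LPContracting a b S F g₁ g₂ z ρ K μ κ) (x₀ : E₁) :
    ∃ x y, IsLPSolution a b S F g₁ g₂ z (-ρ) x₀ x y ∧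
      ∀ t ≤ 0, Tendsto (fun n => (lpIter a b S F g₁ g₂ z x₀ n).2 t) atTop (𝓝 (y t)) := by
  obtain ⟨D, hD⟩ := h.dist_lpIter (x₀ := x₀)
  have hm := fun n => h.memWeighted_lpIter (x₀ := x₀) n
  have hq := h.contraction_nonneg
  have hq1 := h.contraction
  obtain ⟨X, hX, hX'⟩ := exists_limit_of_geometric h.rho_pos hq hq1 (fun n => (hm n).1)
    fun n t ht => (le_add_of_nonneg_right (norm_nonneg _)).trans (hD n t ht)
  obtain ⟨Y, hY, hY'⟩ := exists_limit_of_geometric h.rho_pos hq hq1 (fun n => (hm n).2)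
    fun n t ht => (le_add_of_nonneg_left (norm_nonneg _)).trans (hD n t ht)
  set q := a * K / (μ + ρ) + b * K / (κ - ρ) with hqdef
  have hgeo : ∀ (c t : ℝ), Tendsto (fun n : ℕ => c * q ^ n * Real.exp (-ρ * t)) atTop (𝓝 0) :=
    fun c t => by
      simpa using ((tendsto_pow_atTop_nhds_zero_of_lt_one hq hq1).const_mul c).mul_const
        (Real.exp (-ρ * t))
  have hXlim : ∀ t ≤ 0, Tendsto (fun n => (lpIter a b S F g₁ g₂ z x₀ n).1 t) atTop (𝓝 (X t)) :=
    fun t ht => tendsto_iff_norm_sub_tendsto_zero.2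
      (squeeze_zero (fun _ => norm_nonneg _) (fun n => hX' n t ht) (hgeo _ t))
  have hYlim : ∀ t ≤ 0, Tendsto (fun n => (lpIter a b S F g₁ g₂ z x₀ n).2 t) atTop (𝓝 (Y t)) :=
    fun t ht => tendsto_iff_norm_sub_tendsto_zero.2
      (squeeze_zero (fun _ => norm_nonneg _) (fun n => hY' n t ht) (hgeo _ t))
  refine ⟨X, Y, h.isLPSolution_iff.2 ⟨hX, hY, fun t ht => ?_⟩, hYlim⟩
  have hstep : ∀ n, ‖(lpIter a b S F g₁ g₂ z x₀ (n + 1)).1 t - lpX a S g₁ z x₀ X Y t‖ +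
      ‖(lpIter a b S F g₁ g₂ z x₀ (n + 1)).2 t - lpY b F g₂ z X Y t‖ ≤
      q * (D / (1 - q) + D / (1 - q)) * q ^ n * Real.exp (-ρ * t) := by
    intro n
    refine (h.dist_lp_le (x₀ := x₀) (hm n).1 (hm n).2 hX hY
      (D := (D / (1 - q) + D / (1 - q)) * q ^ n) (fun s hs => ?_) t ht).trans
      (le_of_eq (by rw [← mul_assoc]))
    rw [add_mul, add_mul]
    exact add_le_add (hX' n s hs) (hY' n s hs)
  constructor
  · refine tendsto_nhds_unique ((tendsto_add_atTop_iff_nat 1).2 (hXlim t ht)) ?_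
    refine tendsto_iff_norm_sub_tendsto_zero.2 (squeeze_zero (fun _ => norm_nonneg _)
      (fun n => (le_add_of_nonneg_right (norm_nonneg _)).trans (hstep n)) (hgeo _ t))
  · refine tendsto_nhds_unique ((tendsto_add_atTop_iff_nat 1).2 (hYlim t ht)) ?_
    refine tendsto_iff_norm_sub_tendsto_zero.2 (squeeze_zero (fun _ => norm_nonneg _)
      (fun n => (le_add_of_nonneg_left (norm_nonneg _)).trans (hstep n)) (hgeo _ t))

/-- The graph map is the second component at time `0` of any Lyapunov-Perron solution. -/
lemma graphMap_eq (h : LPContracting a b S F g₁ g₂ z ρ K μ κ)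
    (hs : IsLPSolution a b S F g₁ g₂ z (-ρ) x₀ x y) :
    graphMap a b S F g₁ g₂ z (-ρ) x₀ = y 0 := by
  have hex : ∃ φ : (ℝ → E₁) × (ℝ → E₂), IsLPSolution a b S F g₁ g₂ z (-ρ) x₀ φ.1 φ.2 :=
    ⟨(x, y), hs⟩
  have hc := Classical.choose_spec hex
  rw [graphMap, dif_pos hex, (h.unique hs hc).2 self_mem_Iic, (hc.2.2 0 le_rfl).2.2.2]
  simp only [zero_sub, mul_neg]

/-- `graphMap` is defined by choice; this presents it as a limit of explicit expressions in the
noise. -/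
lemma tendsto_lpIter (h : LPContracting a b S F g₁ g₂ z ρ K μ κ) (x₀ : E₁) :
    Tendsto (fun n => (lpIter a b S F g₁ g₂ z x₀ n).2 0) atTop
      (𝓝 (graphMap a b S F g₁ g₂ z (-ρ) x₀)) := by
  obtain ⟨x, y, hs, hlim⟩ := h.exists_solution x₀
  rw [h.graphMap_eq hs]
  exact hlim 0 le_rfl

lemma isRDESolution_of_isLPSolution (h : LPContracting a b S F g₁ g₂ z ρ K μ κ)
    (hs : IsLPSolution a b S F g₁ g₂ z (-ρ) x₀ x y) :
    IsRDESolution a b S F g₁ g₂ z (x₀, y 0) x y := by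
  obtain ⟨hx, hy, hxy⟩ := h.isLPSolution_iff.1 hs
  have h1 := ((h.lpX_ode hx hy x).1 fun t ht => (hxy t ht).1).2
  have h2 := ((h.lpY_ode hx hy (y 0) y).1 fun t ht => by
    rw [(hxy t ht).2, (hxy 0 le_rfl).2]
    exact h.lpY_eq_add hx hy t ht).2
  have hcx : ∀ t ≤ 0, ContinuousOn x (uIcc 0 t) := fun t ht =>
    hx.1.mono (by rw [uIcc_of_ge ht]; exact Icc_subset_Iic_self)
  have hcy : ∀ t ≤ 0, ContinuousOn y (uIcc 0 t) := fun t ht =>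
    hy.1.mono (by rw [uIcc_of_ge ht]; exact Icc_subset_Iic_self)
  refine fun t ht => ⟨?_, ?_, ?_, ?_⟩
  · exact ((S.continuous.comp_continuousOn (hcx t ht)).intervalIntegrable.add
      (h.forcing_intervalIntegrable h.lip₁ hx hy t ht)).smul a
  · exact ((F.continuous.comp_continuousOn (hcy t ht)).intervalIntegrable.add
      (h.forcing_intervalIntegrable h.lip₂ hx hy t ht)).smul b
  · simpa only [smul_add] using! h1 t ht
  · simpa only [smul_add] using! h2 t ht

/-- By variation of constants `y` and the Lyapunov–Perron integral differ by `e^{tbF} v` for a fixed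
`v`. Both are `O(e^{-ρt})`, and `‖e^{-tbF}‖ ≤ e^{κt}`, so `‖v‖ = O(e^{(κ-ρ)t})`. Letting `t → -∞`
gives `v = 0`. -/
lemma isLPSolution_of_isRDESolution (h : LPContracting a b S F g₁ g₂ z ρ K μ κ) {p : E₁ × E₂}
    (hx : MemWeighted (-ρ) x) (hy : MemWeighted (-ρ) y)
    (hs : IsRDESolution a b S F g₁ g₂ z p x y) :
    IsLPSolution a b S F g₁ g₂ z (-ρ) p.1 x y := by
  have h1 := (h.lpX_ode hx hy (x₀ := p.1) x).2 ⟨hx.1, fun t ht => by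
    simpa only [smul_add] using! (hs t ht).2.2.1⟩
  have h2 := (h.lpY_ode hx hy p.2 y).2 ⟨hy.1, fun t ht => by
    simpa only [smul_add] using! (hs t ht).2.2.2⟩
  refine h.isLPSolution_iff.2 ⟨hx, hy, fun t ht => ⟨h1 t ht, ?_⟩⟩
  suffices hp : p.2 = lpY b F g₂ z x y 0 by
    rw [h2 t ht, h.lpY_eq_add hx hy t ht, hp]
  have hdiff : ∀ t ≤ 0, p.2 - lpY b F g₂ z x y 0
      = NormedSpace.exp ((-t) • (b • F)) (y t - lpY b F g₂ z x y t) := by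
    intro t ht
    rw [h2 t ht, h.lpY_eq_add hx hy t ht, add_sub_add_right_eq_sub, ← map_sub,
      exp_neg_smul_apply]
  obtain ⟨M₁, hM₁⟩ := (memWeighted_neg_iff.1 hy).2
  obtain ⟨M₂, hM₂⟩ := (memWeighted_neg_iff.1 (h.memWeighted_lpY hx hy)).2
  have hbd : ∀ t ≤ 0, ‖p.2 - lpY b F g₂ z x y 0‖ ≤ (M₁ + M₂) * Real.exp ((κ - ρ) * t) := by
    intro t ht
    rw [hdiff t ht]
    refine ((NormedSpace.exp ((-t) • (b • F))).le_of_opNorm_le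
      (h.exp_smul_F (-t) (by simpa using ht)) _).trans ?_
    have h3 : ‖y t - lpY b F g₂ z x y t‖ ≤ (M₁ + M₂) * Real.exp (-ρ * t) := by
      rw [add_mul]
      exact (norm_sub_le _ _).trans (add_le_add (hM₁ t ht) (hM₂ t ht))
    refine (mul_le_mul_of_nonneg_left h3 (Real.exp_pos _).le).trans (le_of_eq ?_)
    rw [mul_left_comm, ← Real.exp_add]
    ring_nf
  have hlim : Tendsto (fun t => (M₁ + M₂) * Real.exp ((κ - ρ) * t)) atBot (𝓝 0) := by
    simpa using (Real.tendsto_exp_atBot.comp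
      (tendsto_id.const_mul_atBot (sub_pos.2 h.rho_lt))).const_mul (M₁ + M₂)
  exact sub_eq_zero.1 (norm_le_zero_iff.1 (ge_of_tendsto hlim
    ((eventually_le_atBot 0).mono fun t ht => hbd t ht)))

theorem isGraph (h : LPContracting a b S F g₁ g₂ z ρ K μ κ) :
    IsGraph a b S F g₁ g₂ z (-ρ) := by
  refine ⟨fun x₀ => ?_, ?_⟩
  · obtain ⟨x, y, hs, -⟩ := h.exists_solution x₀
    exact ⟨x, y, hs, fun x' y' hs' => h.unique hs' hs⟩
  · ext p
    constructor
    · rintro ⟨x, y, hx, hy, hs⟩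
      refine ⟨p.1, Prod.ext rfl ?_⟩
      change graphMap a b S F g₁ g₂ z (-ρ) p.1 = p.2
      rw [h.graphMap_eq (h.isLPSolution_of_isRDESolution hx hy hs), (hs 0 le_rfl).2.2.2]
      simp
    · rintro ⟨x₀, rfl⟩
      obtain ⟨x, y, hs, -⟩ := h.exists_solution x₀
      refine ⟨x, y, hs.1, hs.2.1, ?_⟩
      simp only [h.graphMap_eq hs]
      exact h.isRDESolution_of_isLPSolution hs

end LPContracting

end FixedPoint

/-! ### Distance between the rescaled and the critical graph. -/

section ErrorEstimate

variable {E₁ E₂ : Type*} [NormedAddCommGroup E₁] [NormedSpace ℝ E₁] [CompleteSpace E₁]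
  [NormedAddCommGroup E₂] [NormedSpace ℝ E₂] [CompleteSpace E₂]

namespace LPContracting

variable {ε : ℝ} {S : E₁ →L[ℝ] E₁} {F : E₂ →L[ℝ] E₂} {g₁ : E₁ → E₂ → E₁}
  {g₂ : E₁ → E₂ → E₂} {z : ℝ → E₂} {ρ K γs κ C : ℝ} {x : ℝ → E₁} {y y' : ℝ → E₂} {x₀ : E₁}

/-- The displacement `u = x - x₀` solves `u' = εSu + ε(S x₀ + g₁)` with `u(0) = 0`, and its forcing
is at most `ε(‖S x₀‖ + C)`. Integrating `e^{εγs(t-s)}` keeps the estimate bounded as `t → -∞`. -/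
lemma norm_slow_sub_le (hε : 0 < ε) (hγs : 0 < γs) (hC : ∀ x y, ‖g₁ x y‖ ≤ C)
    (h : LPContracting ε 1 S F g₁ g₂ z ρ K (ε * γs) κ)
    (hs : IsLPSolution ε 1 S F g₁ g₂ z (-ρ) x₀ x y) (t : ℝ) (ht : t ≤ 0) :
    ‖x t - x₀‖ ≤ (‖S x₀‖ + C) / γs * (1 - Real.exp (ε * γs * t)) := by
  obtain ⟨hx, hy, hxy⟩ := h.isLPSolution_iff.1 hs
  obtain ⟨hc, hode⟩ := (h.lpX_ode hx hy x).1 fun t ht => (hxy t ht).1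
  have he : 0 < ε * γs := mul_pos hε hγs
  have hvc := (variation_of_constants (ε • S)
    (u := fun s => (ε • S) x₀ + ε • g₁ (x s) (y s + z s))
    (fun t ht => continuousWithinAt_const.add
      ((h.forcing_right_cont h.lip₁ hx hy t ht).const_smul ε))
    (fun t ht => intervalIntegrable_const.add
      ((h.forcing_intervalIntegrable h.lip₁ hx hy t ht).smul ε)) 0 (fun t => x t - x₀)).2
    ⟨hc.sub continuousOn_const, fun t ht => by
      rw [zero_add, hode t ht, add_sub_cancel_left]
      congr 1
      ext s
      rw [← add_assoc, map_sub, sub_add_cancel]⟩ t ht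
  simp only [map_zero, zero_add] at hvc
  rw [hvc, intervalIntegral.integral_symm, norm_neg]
  have hB : ∀ s, ‖(ε • S) x₀ + ε • g₁ (x s) (y s + z s)‖ ≤ ε * (‖S x₀‖ + C) := by
    intro s
    rw [_root_.smul_apply, ← smul_add, norm_smul, Real.norm_of_nonneg hε.le]
    exact mul_le_mul_of_nonneg_left ((norm_add_le _ _).trans (by gcongr; exact hC _ _)) hε.le
  have hbd : ∀ s ∈ Ioc t 0, ‖NormedSpace.exp ((t - s) • (ε • S))
      ((ε • S) x₀ + ε • g₁ (x s) (y s + z s))‖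
      ≤ ε * (‖S x₀‖ + C) * Real.exp (ε * γs * t) * Real.exp (-(ε * γs) * s) := by
    intro s hs
    refine ((NormedSpace.exp ((t - s) • (ε • S))).le_of_opNorm_le
      (h.exp_smul_S _ (sub_nonpos.2 hs.1.le)) _).trans ?_
    refine (mul_le_mul_of_nonneg_left (hB s) (Real.exp_pos _).le).trans (le_of_eq ?_)
    have h1 : Real.exp (ε * γs * (t - s))
        = Real.exp (ε * γs * t) * Real.exp (-(ε * γs) * s) := by
      rw [← Real.exp_add]; ring_nf
    rw [h1]; ring
  refine (intervalIntegral.norm_integral_le_of_norm_le ht (Eventually.of_forall hbd)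
    (Continuous.intervalIntegrable (by fun_prop) _ _)).trans (le_of_eq ?_)
  rw [intervalIntegral.integral_const_mul,
    intervalIntegral.integral_comp_mul_left (fun x => Real.exp x) (neg_ne_zero.2 he.ne'),
    integral_exp]
  have h1 : Real.exp (ε * γs * t) * Real.exp (-(ε * γs) * t) = 1 := by
    rw [← Real.exp_add]; simp
  rw [smul_eq_mul, mul_zero, Real.exp_zero]
  calc _ = ε / (ε * γs) * (‖S x₀‖ + C) * (Real.exp (ε * γs * t) * Real.exp (-(ε * γs) * t)
        - Real.exp (ε * γs * t)) := by rw [inv_neg]; ring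
    _ = _ := by rw [h1]; field_simp

/-- With `D = (‖S x₀‖ + C)/γs` and `e = εγs`, the difference `u` of the fast components satisfies
`u(t) ≤ K ∫_{-∞}^t e^{-κ(t-s)} (D(1 - e^{es}) + u(s)) ds`. The right-hand side is the fixed point of
this affine map, and every iteration shrinks the excess over it by `K/(κ-ρ) < 1`. -/
lemma norm_fast_sub_le (hε : 0 < ε) (hγs : 0 < γs) (hC : ∀ x y, ‖g₁ x y‖ ≤ C)
    (h : LPContracting ε 1 S F g₁ g₂ z ρ K (ε * γs) κ)
    (h0 : LPContracting 0 1 S F g₁ g₂ z ρ K 0 κ)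
    (hsol : IsLPSolution ε 1 S F g₁ g₂ z (-ρ) x₀ x y) {x' : ℝ → E₁}
    (hs' : IsLPSolution 0 1 S F g₁ g₂ z (-ρ) x₀ x' y') (t : ℝ) (ht : t ≤ 0) :
    ‖y t - y' t‖ ≤ K * ((‖S x₀‖ + C) / γs) *
      (1 / (κ - K) - Real.exp (ε * γs * t) / (κ - K + ε * γs)) := by
  obtain ⟨hx, hy, hxy⟩ := h.isLPSolution_iff.1 hsol
  obtain ⟨hx', hy', hxy'⟩ := h0.isLPSolution_iff.1 hs'
  have hC0 : 0 ≤ C := (norm_nonneg _).trans (hC 0 0)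
  have hK := h.K_nonneg
  set D := (‖S x₀‖ + C) / γs with hD
  have hD0 : 0 ≤ D := by positivity
  set e := ε * γs with he
  have he0 : 0 < e := mul_pos hε hγs
  have hρ := h.rho_pos
  have hκρ : 0 < κ - ρ := sub_pos.2 h.rho_lt
  have hq : K / (κ - ρ) < 1 := by simpa using h0.contraction
  have hKκ : 0 < κ - K := by
    have := (div_lt_one hκρ).1 hq
    linarith
  have hκ : 0 < κ := by linarith
  have hx₀ : ∀ t ≤ 0, x' t = x₀ := fun t ht => by
    rw [(hxy' t ht).1]; simp [lpX, NormedSpace.exp_zero]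
  -- A crude a priori bound from membership in the weighted space starts the iteration; it occurs in
  -- the excess term only.
  obtain ⟨M, hM⟩ := exists_dist_bound hx hy hx' hy'
  have hstep : ∀ n : ℕ, ∀ t ≤ 0, ‖y t - y' t‖ ≤ K * D *
      (1 / (κ - K) - Real.exp (e * t) / (κ - K + e)) +
        M * (K / (κ - ρ)) ^ n * Real.exp (-ρ * t) := by
    intro n
    induction n with
    | zero =>
      intro t ht
      have h1 : Real.exp (e * t) / (κ - K + e) ≤ 1 / (κ - K) := by
        have : Real.exp (e * t) ≤ 1 := Real.exp_le_one_iff.2 (by nlinarith)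
        gcongr
        linarith
      have h2 : 0 ≤ K * D * (1 / (κ - K) - Real.exp (e * t) / (κ - K + e)) :=
        mul_nonneg (mul_nonneg hK hD0) (sub_nonneg.2 h1)
      have h3 := hM t ht
      rw [pow_zero, mul_one]
      linarith [norm_nonneg (x t - x' t)]
    | succ n ih =>
      intro t ht
      rw [(hxy t ht).2, (hxy' t ht).2]
      simp only [lpY, mul_smul_eq_smul_smul, one_smul]
      have hi1 := h.integrableOn_Y hx hy t ht
      have hi2 := h0.integrableOn_Y hx' hy' t ht
      simp only [one_smul] at hi1 hi2
      rw [← integral_sub hi1 hi2]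
      simp_rw [← map_sub]
      -- These are the coefficients of `K(D(1 - e^{es}) + induction bound)`. Integration divides
      -- them by `κ`, `κ + e` and `κ - ρ`, which reproduces the fixed point and one more factor
      -- `K/(κ-ρ)`.
      set c₁ := K * D * κ / (κ - K)
      set c₂ := K * D * (κ + e) / (κ - K + e)
      set c₃ := K * (M * (K / (κ - ρ)) ^ n)
      have hbd : ∀ s ∈ Iic t, ‖NormedSpace.exp ((t - s) • F)
          (g₂ (x s) (y s + z s) - g₂ (x' s) (y' s + z s))‖ ≤ Real.exp (-κ * t) *
            (c₁ * Real.exp (κ * s) - c₂ * Real.exp ((κ + e) * s)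
              + c₃ * Real.exp ((κ - ρ) * s)) := by
        intro s hs
        have hs0 : s ≤ 0 := le_trans hs ht
        have hF := h.exp_smul_F (t - s) (sub_nonneg.2 hs)
        rw [one_smul] at hF
        refine ((NormedSpace.exp ((t - s) • F)).le_of_opNorm_le hF _).trans ?_
        have hg := h.lip₂ (x s) (y s + z s) (x' s) (y' s + z s)
        rw [hx₀ s hs0, add_sub_add_right_eq_sub] at hg
        have h1 : ‖g₂ (x s) (y s + z s) - g₂ (x' s) (y' s + z s)‖ ≤
            c₁ - c₂ * Real.exp (e * s) + c₃ * Real.exp (-ρ * s) := by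
          rw [hx₀ s hs0]
          refine hg.trans ((mul_le_mul_of_nonneg_left (add_le_add
            (h.norm_slow_sub_le hε hγs hC hsol s hs0) (ih s hs0)) hK).trans (le_of_eq ?_))
          simp only [c₁, c₂, c₃, ← hD, ← he]
          have hne : κ - K + e ≠ 0 := by positivity
          field_simp
          ring
        refine (mul_le_mul_of_nonneg_left h1 (Real.exp_pos _).le).trans (le_of_eq ?_)
        have e1 : Real.exp (-κ * (t - s)) = Real.exp (-κ * t) * Real.exp (κ * s) := by
          rw [← Real.exp_add]; ring_nf
        have e2 : Real.exp ((κ + e) * s) = Real.exp (κ * s) * Real.exp (e * s) := by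
          rw [← Real.exp_add]; ring_nf
        have e3 : Real.exp ((κ - ρ) * s) = Real.exp (κ * s) * Real.exp (-ρ * s) := by
          rw [← Real.exp_add]; ring_nf
        rw [e1, e2, e3]
        ring
      have hκe : 0 < κ + e := by linarith
      have j1 := (integrableOn_exp_mul_Iic hκ t).const_mul c₁
      have j2 := (integrableOn_exp_mul_Iic hκe t).const_mul c₂
      have j3 := (integrableOn_exp_mul_Iic hκρ t).const_mul c₃
      refine (norm_integral_le_of_norm_le (((j1.sub j2).add j3).const_mul _)
        ((ae_restrict_mem measurableSet_Iic).mono hbd)).trans (le_of_eq ?_)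
      rw [integral_const_mul, integral_add' (j1.sub j2) j3, integral_sub' j1 j2]
      simp only [integral_const_mul]
      rw [integral_exp_mul_Iic hκ, integral_exp_mul_Iic hκe, integral_exp_mul_Iic hκρ]
      have e1 : Real.exp (-κ * t) * Real.exp (κ * t) = 1 := by
        rw [← Real.exp_add]; simp
      have e2 : Real.exp ((κ + e) * t) = Real.exp (κ * t) * Real.exp (e * t) := by
        rw [← Real.exp_add]; ring_nf
      have e3 : Real.exp ((κ - ρ) * t) = Real.exp (κ * t) * Real.exp (-ρ * t) := by
        rw [← Real.exp_add]; ring_nf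
      rw [e2, e3]
      have hne : κ - K + e ≠ 0 := by positivity
      calc _ = (Real.exp (-κ * t) * Real.exp (κ * t)) * (c₁ / κ - c₂ * Real.exp (e * t) / (κ + e)
              + c₃ * Real.exp (-ρ * t) / (κ - ρ)) := by ring
        _ = _ := by
          rw [e1, one_mul]
          simp only [c₁, c₂, c₃]
          rw [pow_succ]
          field_simp
  have hlim : Tendsto (fun n : ℕ => K * D *
      (1 / (κ - K) - Real.exp (e * t) / (κ - K + e)) +
        M * (K / (κ - ρ)) ^ n * Real.exp (-ρ * t)) atTop
      (𝓝 (K * D * (1 / (κ - K) - Real.exp (e * t) / (κ - K + e)))) := by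
    simpa using (((tendsto_pow_atTop_nhds_zero_of_lt_one (div_nonneg hK hκρ.le) hq).const_mul
      M).mul_const (Real.exp (-ρ * t))).const_add
        (K * D * (1 / (κ - K) - Real.exp (e * t) / (κ - K + e)))
  exact ge_of_tendsto' hlim fun n => hstep n t ht

theorem norm_graphMap_sub_le (hε : 0 < ε) (hγs : 0 < γs) (hC : ∀ x y, ‖g₁ x y‖ ≤ C)
    (h : LPContracting ε 1 S F g₁ g₂ z ρ K (ε * γs) κ)
    (h0 : LPContracting 0 1 S F g₁ g₂ z ρ K 0 κ) (x₀ : E₁) :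
    ‖graphMap ε 1 S F g₁ g₂ z (-ρ) x₀ - graphMap 0 1 S F g₁ g₂ z (-ρ) x₀‖ ≤
      K * ((‖S x₀‖ + C) / γs) * (1 / (κ - K) - 1 / (κ - K + ε * γs)) := by
  obtain ⟨x, y, hs, -⟩ := h.exists_solution x₀
  obtain ⟨x', y', hs', -⟩ := h0.exists_solution x₀
  rw [h.graphMap_eq hs, h0.graphMap_eq hs']
  simpa using h.norm_fast_sub_le hε hγs hC h0 hs hs' 0 le_rfl

end LPContracting

/-- With `m = -γf - K` and `e = εγs` the claims reduce to `e/(m(m+e)) ≤ (m+K)e/(m²(m+K+e)) ≤ e/m²`: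
the constant of the theorem is slightly weaker than the estimate obtained above. -/
lemma error_bound_le {K B γs γf ε : ℝ} (hK : 0 < K) (hB : 0 ≤ B) (hγs : 0 < γs)
    (hKf : K < -γf) (hε : 0 < ε) :
    K * (B / γs) * (1 / (-γf - K) - 1 / (-γf - K + ε * γs)) ≤
      K * γf ^ 2 * B / (γs * (γf + K) ^ 2) * (1 / (γf - ε * γs) - 1 / γf) ∧
    K * γf ^ 2 * B / (γs * (γf + K) ^ 2) * (1 / (γf - ε * γs) - 1 / γf) ≤
      K * B / (γf + K) ^ 2 * ε := by
  obtain ⟨m, hm⟩ : ∃ m, m = -γf - K := ⟨_, rfl⟩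
  obtain ⟨e, he⟩ : ∃ e, e = ε * γs := ⟨_, rfl⟩
  have hm0 : 0 < m := by linarith
  have he0 : 0 < e := by rw [he]; positivity
  have hγf : γf = -(m + K) := by linarith
  have hmid : K * γf ^ 2 * B / (γs * (γf + K) ^ 2) * (1 / (γf - ε * γs) - 1 / γf)
      = K * (B / γs) * ((m + K) * e / (m ^ 2 * (m + K + e))) := by
    rw [hγf, ← he]
    have h1 : -(m + K) - e ≠ 0 := by linarith
    have h2 : -(m + K) ≠ 0 := by linarith
    have h3 : -(m + K) + K = -m := by ring
    have h4 : 1 / (-(m + K) - e) - 1 / -(m + K) = e / ((m + K) * (m + K + e)) := by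
      rw [show -(m + K) - e = -(m + K + e) by ring]
      field_simp
      ring
    rw [h3, h4]
    field_simp
  have hA : 0 ≤ K * (B / γs) := by positivity
  rw [hmid, ← hm, ← he]
  constructor
  · refine mul_le_mul_of_nonneg_left ?_ hA
    rw [div_sub_div _ _ hm0.ne' (by positivity), div_le_div_iff₀ (by positivity) (by positivity)]
    have : 0 ≤ e * m * (K * e) := by positivity
    nlinarith
  · have h5 : (m + K) * e / (m ^ 2 * (m + K + e)) ≤ e / m ^ 2 := by
      rw [div_le_div_iff₀ (by positivity) (by positivity)]
      have : 0 ≤ e * m ^ 2 * e := by positivity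
      nlinarith
    refine (mul_le_mul_of_nonneg_left h5 hA).trans (le_of_eq ?_)
    rw [show γf + K = -m by rw [hγf]; ring, he]
    field_simp

end ErrorEstimate

/-! ### Càdlàg paths and pathwise Riemann–Stieltjes integrals. -/

section Paths

variable {E : Type*} [NormedAddCommGroup E] [NormedSpace ℝ E]

/-- The first point strictly to the right of `t` of the grid `a + h ℤ`. -/
def gridRight (a h t : ℝ) : ℝ := a + (⌊(t - a) / h⌋ + 1) * h

lemma lt_gridRight {a h : ℝ} (hh : 0 < h) (t : ℝ) : t < gridRight a h t := by
  have := (div_lt_iff₀ hh).1 (Int.lt_floor_add_one ((t - a) / h))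
  rw [gridRight]; linarith

lemma gridRight_le {a h : ℝ} (hh : 0 < h) (t : ℝ) : gridRight a h t ≤ t + h := by
  have := (le_div_iff₀ hh).1 (Int.floor_le ((t - a) / h))
  rw [gridRight, add_mul, one_mul]; linarith

lemma gridRight_eq {a h t : ℝ} (hh : 0 < h) {k : ℕ} (h1 : a + k * h ≤ t)
    (h2 : t < a + (k + 1) * h) : gridRight a h t = a + (k + 1) * h := by
  have : ⌊(t - a) / h⌋ = (k : ℤ) := by
    rw [Int.floor_eq_iff]
    push_cast
    exact ⟨(le_div_iff₀ hh).2 (by linarith), (div_lt_iff₀ hh).2 (by linarith)⟩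
  rw [gridRight, this]; push_cast; rfl

lemma tendsto_gridRight {a : ℝ} {h : ℕ → ℝ} (hh : ∀ᶠ n in atTop, 0 < h n)
    (h0 : Tendsto h atTop (𝓝 0)) (t : ℝ) :
    Tendsto (fun n => gridRight a (h n) t) atTop (𝓝[≥] t) := by
  refine tendsto_nhdsWithin_iff.2 ⟨?_, hh.mono fun n hn => (lt_gridRight hn t).le⟩
  refine tendsto_of_tendsto_of_tendsto_of_le_of_le' tendsto_const_nhds
    (by simpa using h0.const_add t) (hh.mono fun n hn => (lt_gridRight hn t).le)
    (hh.mono fun n hn => gridRight_le hn t)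

/-- No regularity of `w` is needed: the time enters only through an integer-valued floor. -/
lemma stronglyMeasurable_comp_gridRight (w : ℝ → E) (a h : ℝ) :
    StronglyMeasurable fun t => w (gridRight a h t) := by
  have h1 : StronglyMeasurable fun k : ℤ => w (a + (k + 1) * h) := .of_discrete
  exact h1.comp_measurable (((measurable_id.sub_const a).div_const h).floor)

lemma tendsto_inv_succ : Tendsto (fun n : ℕ => ((n : ℝ) + 1)⁻¹) atTop (𝓝 0) := by
  simpa using tendsto_one_div_add_atTop_nhds_zero_nat (𝕜 := ℝ)

lemma stronglyMeasurable_of_right_cont {w : ℝ → E}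
    (hw : ∀ t, ContinuousWithinAt w (Ici t) t) : StronglyMeasurable w := by
  refine stronglyMeasurable_of_tendsto atTop
    (f := fun (n : ℕ) t => w (gridRight 0 ((n : ℝ) + 1)⁻¹ t))
    (fun n => stronglyMeasurable_comp_gridRight w _ _) (tendsto_pi_nhds.2 fun t => ?_)
  exact (hw t).tendsto.comp
    (tendsto_gridRight (Eventually.of_forall fun n => by positivity) tendsto_inv_succ t)

/-- Càdlàg paths of subexponential growth at `-∞`. -/
structure IsTamePath (w : ℝ → E) : Prop where
  right_cont : ∀ t, ContinuousWithinAt w (Ici t) t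
  left_lim : ∀ t, ∃ l, Tendsto w (𝓝[<] t) (𝓝 l)
  growth : ∀ c > 0, ∃ C, ∀ s ≤ 0, ‖w s‖ ≤ C * Real.exp (-c * s)

/-- One-sided limits bound the path near every point, and compactness patches the local bounds. -/
lemma exists_bound_of_cadlag {w : ℝ → E} (hr : ∀ t, ContinuousWithinAt w (Ici t) t)
    (hl : ∀ t, ∃ l, Tendsto w (𝓝[<] t) (𝓝 l)) (a b : ℝ) :
    ∃ M, ∀ t ∈ Icc a b, ‖w t‖ ≤ M := by
  refine isCompact_Icc.induction_on (p := fun s => ∃ M, ∀ t ∈ s, ‖w t‖ ≤ M)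
    ⟨0, by simp⟩ (fun s t hst ⟨M, hM⟩ => ⟨M, fun r hr => hM r (hst hr)⟩)
    (fun s t ⟨M, hM⟩ ⟨M', hM'⟩ => ⟨max M M', ?_⟩) fun t _ => ?_
  · rintro r (hr | hr)
    · exact (hM r hr).trans (le_max_left _ _)
    · exact (hM' r hr).trans (le_max_right _ _)
  · obtain ⟨l, hl⟩ := hl t
    have h1 : ∀ᶠ s in 𝓝[≥] t, ‖w s‖ ≤ max (‖w t‖ + 1) (‖l‖ + 1) :=
      ((hr t).norm.tendsto.eventually_lt_const (lt_add_one _)).mono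
        fun s hs => hs.le.trans (le_max_left _ _)
    have h2 : ∀ᶠ s in 𝓝[<] t, ‖w s‖ ≤ max (‖w t‖ + 1) (‖l‖ + 1) :=
      (hl.norm.eventually_lt_const (lt_add_one _)).mono
        fun s hs => hs.le.trans (le_max_right _ _)
    have h3 : ∀ᶠ s in 𝓝 t, ‖w s‖ ≤ max (‖w t‖ + 1) (‖l‖ + 1) := by
      rw [← nhdsLT_sup_nhdsGE]; exact eventually_sup.2 ⟨h2, h1⟩
    exact ⟨_, mem_nhdsWithin_of_mem_nhds h3, _, fun s hs => hs⟩

namespace IsTamePath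

variable {w : ℝ → E}

lemma stronglyMeasurable (hw : IsTamePath w) : StronglyMeasurable w :=
  stronglyMeasurable_of_right_cont hw.right_cont

lemma exists_bound (hw : IsTamePath w) (a b : ℝ) : ∃ M, ∀ t ∈ Icc a b, ‖w t‖ ≤ M :=
  exists_bound_of_cadlag hw.right_cont hw.left_lim a b

lemma growth_Iic (hw : IsTamePath w) {c : ℝ} (hc : 0 < c) (T : ℝ) :
    ∃ C, 0 ≤ C ∧ ∀ s ≤ T, ‖w s‖ ≤ C * Real.exp (-c * s) := by
  obtain ⟨C, hC⟩ := hw.growth c hc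
  obtain ⟨M, hM⟩ := hw.exists_bound 0 T
  refine ⟨max C (max 0 M * Real.exp (c * T)), le_max_of_le_right (by positivity), fun s hs => ?_⟩
  rcases le_total s 0 with h0 | h0
  · exact (hC s h0).trans (mul_le_mul_of_nonneg_right (le_max_left _ _) (Real.exp_pos _).le)
  · refine (hM s ⟨h0, hs⟩).trans ((le_max_right 0 M).trans ?_)
    have h1 : 1 ≤ Real.exp (c * T) * Real.exp (-c * s) := by
      rw [← Real.exp_add]; exact Real.one_le_exp (by nlinarith)
    calc max 0 M ≤ max 0 M * (Real.exp (c * T) * Real.exp (-c * s)) :=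
          le_mul_of_one_le_right (le_max_left _ _) h1
      _ = max 0 M * Real.exp (c * T) * Real.exp (-c * s) := by ring
      _ ≤ _ := mul_le_mul_of_nonneg_right (le_max_right _ _) (Real.exp_pos _).le

lemma shift (hw : IsTamePath w) (t : ℝ) : IsTamePath (SlowFast.shift t w) where
  right_cont s := by
    refine ContinuousWithinAt.sub (ContinuousWithinAt.comp (t := Ici (s + t)) (hw.right_cont (s + t))
      (continuous_add_const t).continuousWithinAt ?_) continuousWithinAt_const
    intro r hr
    exact add_le_add_left hr t
  left_lim s := by
    obtain ⟨l, hl⟩ := hw.left_lim (s + t)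
    refine ⟨l - w t, (hl.comp (tendsto_nhdsWithin_iff.2 ⟨?_, ?_⟩)).sub_const (w t)⟩
    · exact ((continuous_add_const t).tendsto s).mono_left nhdsWithin_le_nhds
    · filter_upwards [self_mem_nhdsWithin] with r hr using add_lt_add_left hr t
  growth c hc := by
    obtain ⟨C, hC0, hC⟩ := hw.growth_Iic hc t
    refine ⟨C * Real.exp (-c * t) + ‖w t‖, fun s hs => ?_⟩
    have h1 : 1 ≤ Real.exp (-c * s) := Real.one_le_exp (by nlinarith)
    have h2 := hC (s + t) (by linarith)
    have h3 : Real.exp (-c * (s + t)) = Real.exp (-c * t) * Real.exp (-c * s) := by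
      rw [← Real.exp_add]; ring_nf
    calc ‖w (s + t) - w t‖ ≤ ‖w (s + t)‖ + ‖w t‖ := norm_sub_le _ _
      _ ≤ C * Real.exp (-c * t) * Real.exp (-c * s) + ‖w t‖ * Real.exp (-c * s) := by
        refine add_le_add (h2.trans (by rw [h3, mul_assoc])) ?_
        exact le_mul_of_one_le_right (norm_nonneg _) h1
      _ = _ := by ring

lemma rescale (hw : IsTamePath w) (a : ℝ) {ε : ℝ} (hε : 0 < ε) :
    IsTamePath (fun s => a • w (ε * s)) where
  right_cont s := by
    refine ContinuousWithinAt.const_smul (ContinuousWithinAt.comp (t := Ici (ε * s))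
      (hw.right_cont (ε * s)) (continuous_const_mul ε).continuousWithinAt ?_) a
    intro r hr
    exact mul_le_mul_of_nonneg_left hr.out hε.le
  left_lim s := by
    obtain ⟨l, hl⟩ := hw.left_lim (ε * s)
    refine ⟨a • l, (hl.comp (tendsto_nhdsWithin_iff.2 ⟨?_, ?_⟩)).const_smul a⟩
    · exact ((continuous_const_mul ε).tendsto s).mono_left nhdsWithin_le_nhds
    · filter_upwards [self_mem_nhdsWithin] with r hr using mul_lt_mul_of_pos_left hr hε
  growth c hc := by
    obtain ⟨C, hC⟩ := hw.growth (c / ε) (div_pos hc hε)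
    refine ⟨‖a‖ * C, fun s hs => ?_⟩
    rw [norm_smul, mul_assoc]
    refine mul_le_mul_of_nonneg_left ((hC _ (mul_nonpos_of_nonneg_of_nonpos hε.le hs)).trans
      (le_of_eq ?_)) (norm_nonneg a)
    congr 2
    field_simp

end IsTamePath

variable [CompleteSpace E]

/-- Abel summation: each difference `f(s_{k+1}) - f(s_k)` multiplies the path value at the right end
of its cell, and it is the integral of `f'` over that cell. -/
lemma pathSum_eq_integral {f f' : ℝ → E →L[ℝ] E} (hf : ∀ s, HasDerivAt f (f' s) s)
    (hf' : Continuous f') (w : ℝ → E) {a b : ℝ} (hab : a < b) {N : ℕ} (hN : 0 < N) :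
    pathSum f w a b N = f b (w b) - f a (w a) -
      ∫ s in a..b, f' s (w (gridRight a ((b - a) / N) s)) := by
  have hN' : (0 : ℝ) < N := Nat.cast_pos.2 hN
  set h := (b - a) / N with hh
  have hh0 : 0 < h := div_pos (sub_pos.2 hab) hN'
  let s : ℕ → ℝ := fun k => a + k * h
  have hs : ∀ k, s (k + 1) = a + (k + 1) * h := fun k => by simp [s]
  have hcell : ∀ k, ∫ r in s k..s (k + 1), f' r (w (gridRight a h r))
      = (f (s (k + 1)) - f (s k)) (w (s (k + 1))) := by
    intro k
    have hle : s k ≤ s (k + 1) := by rw [hs]; simp only [s]; nlinarith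
    have hae : ∫ r in s k..s (k + 1), f' r (w (gridRight a h r))
        = ∫ r in s k..s (k + 1), f' r (w (s (k + 1))) := by
      refine intervalIntegral.integral_congr_ae_restrict ?_
      -- `gridRight` is constant on the cell closed on the left, so the integration interval is
      -- changed at its null endpoints.
      rw [uIoc_of_le hle, ← restrict_Ico_eq_restrict_Ioc]
      refine (ae_restrict_mem measurableSet_Ico).mono fun r hr => ?_
      simp only
      rw [gridRight_eq hh0 hr.1 (by rw [← hs]; exact hr.2), hs]
    rw [hae, intervalIntegral.integral_eq_sub_of_hasDerivAt
      (f := fun r => f r (w (s (k + 1))))]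
    · rfl
    · intro r _
      simpa using (hf r).clm_apply (hasDerivAt_const r (w (s (k + 1))))
    · exact (hf'.clm_apply continuous_const).intervalIntegrable _ _
  have hint : ∀ k, IntervalIntegrable (fun r => f' r (w (gridRight a h r)))
      volume (s k) (s (k + 1)) := by
    intro k
    have hle : s k ≤ s (k + 1) := by rw [hs]; simp only [s]; nlinarith
    refine IntervalIntegrable.congr_ae (f := fun r => f' r (w (s (k + 1))))
      ((hf'.clm_apply continuous_const).intervalIntegrable _ _) ?_
    rw [uIoc_of_le hle, ← restrict_Ico_eq_restrict_Ioc]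
    refine (ae_restrict_mem measurableSet_Ico).mono fun r hr => ?_
    simp only
    rw [gridRight_eq hh0 hr.1 (by rw [← hs]; exact hr.2), hs]
  have hsum := intervalIntegral.sum_integral_adjacent_intervals (n := N) fun k _ => hint k
  have hs0 : s 0 = a := by simp [s]
  have hsN : s N = b := by simp only [s, hh]; field_simp; ring
  rw [hs0, hsN] at hsum
  rw [← hsum, Finset.sum_congr rfl fun k _ => hcell k, pathSum, ← hh]
  have key : ∀ n : ℕ, ∑ k ∈ Finset.range n, f (s k) (w (s (k + 1)) - w (s k))
      = f (s n) (w (s n)) - f (s 0) (w (s 0))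
        - ∑ k ∈ Finset.range n, (f (s (k + 1)) - f (s k)) (w (s (k + 1))) := by
    intro n
    induction n with
    | zero => simp
    | succ n ih =>
      rw [Finset.sum_range_succ, Finset.sum_range_succ, ih]
      simp only [map_sub, _root_.sub_apply]
      abel
  have := key N
  rw [hs0, hsN] at this
  rw [← this]
  refine Finset.sum_congr rfl fun k _ => ?_
  rw [hs]

/-- Grid points approach each time from the right, so right-continuity and dominated convergence
suffice; bounded variation of the path is never used. -/
lemma tendsto_pathSum {f f' : ℝ → E →L[ℝ] E} (hf : ∀ s, HasDerivAt f (f' s) s)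
    (hf' : Continuous f') {w : ℝ → E} (hr : ∀ t, ContinuousWithinAt w (Ici t) t)
    (hl : ∀ t, ∃ l, Tendsto w (𝓝[<] t) (𝓝 l)) {a b : ℝ} (hab : a < b) :
    Tendsto (pathSum f w a b) atTop
      (𝓝 (f b (w b) - f a (w a) - ∫ s in a..b, f' s (w s))) := by
  have hstep : Tendsto (fun N : ℕ => (b - a) / N) atTop (𝓝 0) :=
    tendsto_const_div_atTop_nhds_zero_nat _
  have hpos : ∀ᶠ N : ℕ in atTop, 0 < (b - a) / N := (eventually_gt_atTop 0).mono fun N hN =>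
    div_pos (sub_pos.2 hab) (Nat.cast_pos.2 hN)
  suffices H : Tendsto (fun N : ℕ => ∫ s in a..b, f' s (w (gridRight a ((b - a) / N) s))) atTop
      (𝓝 (∫ s in a..b, f' s (w s))) by
    refine (H.const_sub (f b (w b) - f a (w a))).congr' ?_
    filter_upwards [eventually_gt_atTop 0] with N hN
    rw [pathSum_eq_integral hf hf' w hab hN]
  -- A grid point to the right of `s ≤ b` may overshoot `b` by one cell, of length at most `b - a`.
  obtain ⟨M, hM⟩ := exists_bound_of_cadlag hr hl a (b + (b - a))
  refine intervalIntegral.tendsto_integral_filter_of_dominated_convergence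
    (fun s => ‖f' s‖ * M) (Eventually.of_forall fun N => ?_) ?_
    ((hf'.norm.mul continuous_const).intervalIntegrable _ _) (Eventually.of_forall fun s _ => ?_)
  · exact aestronglyMeasurable_clm_apply hf'
      (stronglyMeasurable_comp_gridRight w _ _).aestronglyMeasurable
  · filter_upwards [eventually_gt_atTop 0] with N hN
    refine Eventually.of_forall fun s hs => ?_
    rw [uIoc_of_le hab.le] at hs
    have hN1 : (1 : ℝ) ≤ N := Nat.one_le_cast.2 hN
    have hh0 : 0 < (b - a) / N := div_pos (sub_pos.2 hab) (by linarith)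
    have hhle : (b - a) / N ≤ b - a := div_le_self (sub_pos.2 hab).le hN1
    refine (f' s).le_of_opNorm_le_of_le le_rfl (hM _ ⟨?_, ?_⟩)
    · exact hs.1.le.trans (lt_gridRight hh0 s).le
    · exact (gridRight_le hh0 s).trans (by linarith [hs.2])
  · exact ((f' s).continuous.tendsto _).comp ((hr s).tendsto.comp (tendsto_gridRight hpos hstep s))

end Paths

/-! ### The stationary Ornstein–Uhlenbeck noise on tame paths. -/

section OrnsteinUhlenbeck

variable {E : Type*} [NormedAddCommGroup E] [NormedSpace ℝ E] [CompleteSpace E]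
  {A : E →L[ℝ] E} {w : ℝ → E} {κ : ℝ}

lemma norm_exp_neg_apply_le (hA : ∀ t ≥ (0 : ℝ), ‖NormedSpace.exp (t • A)‖ ≤ Real.exp (-κ * t))
    {v : E} {C c s : ℝ} (hs : s ≤ 0) (hv : ‖v‖ ≤ C * Real.exp (-c * s)) :
    ‖A (NormedSpace.exp ((-s) • A) v)‖ ≤ ‖A‖ * C * Real.exp ((κ - c) * s) := by
  refine (A.le_opNorm _).trans ?_
  rw [mul_assoc]
  refine mul_le_mul_of_nonneg_left ?_ (norm_nonneg _)
  refine ((NormedSpace.exp ((-s) • A)).le_of_opNorm_le (hA (-s) (by simpa using hs)) v).trans ?_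
  refine (mul_le_mul_of_nonneg_left hv (Real.exp_pos _).le).trans (le_of_eq ?_)
  rw [mul_left_comm, ← Real.exp_add]
  ring_nf

lemma aestronglyMeasurable_exp_neg_apply {u : ℝ → E} {μ : Measure ℝ}
    (hu : AEStronglyMeasurable u μ) :
    AEStronglyMeasurable (fun s => A (NormedSpace.exp ((-s) • A) (u s))) μ :=
  A.continuous.comp_aestronglyMeasurable (aestronglyMeasurable_clm_apply
    ((continuous_exp_smul A).comp continuous_neg) hu)

namespace IsTamePath

lemma integrableOn_exp (hw : IsTamePath w) (hκ : 0 < κ)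
    (hA : ∀ t ≥ (0 : ℝ), ‖NormedSpace.exp (t • A)‖ ≤ Real.exp (-κ * t)) :
    IntegrableOn (fun s => A (NormedSpace.exp ((-s) • A) (w s))) (Iic 0) := by
  obtain ⟨C, hC⟩ := hw.growth (κ / 2) (by linarith)
  refine ((integrableOn_exp_mul_Iic (a := κ - κ / 2) (by linarith) 0).const_mul
    (‖A‖ * C)).mono' (aestronglyMeasurable_exp_neg_apply
      hw.stronglyMeasurable.aestronglyMeasurable) ?_
  exact (ae_restrict_mem measurableSet_Iic).mono fun s hs =>
    norm_exp_neg_apply_le hA hs (hC s hs)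

lemma tendsto_pathSum_exp (hw : IsTamePath w) {T : ℝ} (hT : 0 < T) :
    Tendsto (pathSum (fun s => NormedSpace.exp ((-s) • A)) w (-T) 0) atTop
      (𝓝 (w 0 - NormedSpace.exp (T • A) (w (-T)) +
        ∫ s in (-T)..0, A (NormedSpace.exp ((-s) • A) (w s)))) := by
  have hd : ∀ s : ℝ, HasDerivAt (fun u : ℝ => NormedSpace.exp ((-u) • A))
      (-(A * NormedSpace.exp ((-s) • A))) s := by
    intro s
    have h := (hasDerivAt_exp_smul A (-s)).scomp s (hasDerivAt_neg s)
    simpa [Function.comp_def] using h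
  have hc : Continuous fun s : ℝ => -(A * NormedSpace.exp ((-s) • A)) :=
    (continuous_const.mul ((continuous_exp_smul A).comp continuous_neg)).neg
  have h := tendsto_pathSum hd hc hw.right_cont hw.left_lim (neg_lt_zero.2 hT)
  convert h using 2
  simp [NormedSpace.exp_zero]

lemma pathIntegral_exp (hw : IsTamePath w) {T : ℝ} (hT : 0 < T) :
    pathIntegral (fun s => NormedSpace.exp ((-s) • A)) w (-T) 0 =
      w 0 - NormedSpace.exp (T • A) (w (-T)) +
        ∫ s in (-T)..0, A (NormedSpace.exp ((-s) • A) (w s)) :=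
  (hw.tendsto_pathSum_exp hT).limUnder_eq

lemma tendsto_pathIntegral_exp (hw : IsTamePath w) (hκ : 0 < κ)
    (hA : ∀ t ≥ (0 : ℝ), ‖NormedSpace.exp (t • A)‖ ≤ Real.exp (-κ * t)) :
    Tendsto (fun T : ℝ => pathIntegral (fun s => NormedSpace.exp ((-s) • A)) w (-T) 0) atTop
      (𝓝 (w 0 + ∫ s in Iic (0 : ℝ), A (NormedSpace.exp ((-s) • A) (w s)))) := by
  -- The boundary term vanishes because growth at rate `κ/2` loses against decay at rate `κ`.
  have h1 : Tendsto (fun T : ℝ => NormedSpace.exp (T • A) (w (-T))) atTop (𝓝 0) := by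
    obtain ⟨C, hC⟩ := hw.growth (κ / 2) (by linarith)
    have hlim : Tendsto (fun T : ℝ => C * Real.exp (-(κ / 2) * T)) atTop (𝓝 0) := by
      simpa using (Real.tendsto_exp_atBot.comp
        (tendsto_id.const_mul_atTop_of_neg (r := -(κ / 2)) (by linarith))).const_mul C
    refine squeeze_zero_norm' ?_ hlim
    filter_upwards [eventually_ge_atTop 0] with T hT
    refine ((NormedSpace.exp (T • A)).le_of_opNorm_le (hA T hT) _).trans ?_
    refine (mul_le_mul_of_nonneg_left (hC (-T) (by simpa using hT))
      (Real.exp_pos _).le).trans (le_of_eq ?_)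
    rw [mul_left_comm, ← Real.exp_add]
    ring_nf
  have h2 : Tendsto (fun T : ℝ => ∫ s in (-T)..0, A (NormedSpace.exp ((-s) • A) (w s))) atTop
      (𝓝 (∫ s in Iic (0 : ℝ), A (NormedSpace.exp ((-s) • A) (w s)))) :=
    intervalIntegral_tendsto_integral_Iic 0 (hw.integrableOn_exp hκ hA) tendsto_neg_atTop_atBot
  have h3 := (h1.const_sub (w 0)).add h2
  rw [sub_zero] at h3
  refine h3.congr' ?_
  filter_upwards [eventually_gt_atTop 0] with T hT
  rw [hw.pathIntegral_exp hT]

lemma ouConverges (hw : IsTamePath w) (hκ : 0 < κ)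
    (hA : ∀ t ≥ (0 : ℝ), ‖NormedSpace.exp (t • A)‖ ≤ Real.exp (-κ * t)) : OUConverges A w :=
  ⟨fun _ hT => ⟨_, hw.tendsto_pathSum_exp hT⟩, _, hw.tendsto_pathIntegral_exp hκ hA⟩

lemma ouIntegral_eq (hw : IsTamePath w) (hκ : 0 < κ)
    (hA : ∀ t ≥ (0 : ℝ), ‖NormedSpace.exp (t • A)‖ ≤ Real.exp (-κ * t)) :
    ouIntegral A w = w 0 + ∫ s in Iic (0 : ℝ), A (NormedSpace.exp ((-s) • A) (w s)) :=
  (hw.tendsto_pathIntegral_exp hκ hA).limUnder_eq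

lemma ouIntegral_shift (hw : IsTamePath w) (hκ : 0 < κ)
    (hA : ∀ t ≥ (0 : ℝ), ‖NormedSpace.exp (t • A)‖ ≤ Real.exp (-κ * t)) (t : ℝ) :
    ouIntegral A (SlowFast.shift t w) =
      ∫ s in Iic (0 : ℝ), A (NormedSpace.exp ((-s) • A) (w (s + t) - w t)) := by
  rw [(hw.shift t).ouIntegral_eq hκ hA]
  simp [SlowFast.shift]

lemma continuousWithinAt_ouIntegral_shift (hw : IsTamePath w) (hκ : 0 < κ)
    (hA : ∀ t ≥ (0 : ℝ), ‖NormedSpace.exp (t • A)‖ ≤ Real.exp (-κ * t)) (t : ℝ) :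
    ContinuousWithinAt (fun t => ouIntegral A (SlowFast.shift t w)) (Ici t) t := by
  simp_rw [hw.ouIntegral_shift hκ hA]
  have hκ2 : 0 < κ / 2 := by linarith
  obtain ⟨C, hC0, hC⟩ := hw.growth_Iic hκ2 (t + 1)
  refine continuousWithinAt_of_dominated (bound := fun s => ‖A‖ *
    (C * Real.exp (-(κ / 2) * t) + C * Real.exp (-(κ / 2) * t)) * Real.exp ((κ - κ / 2) * s))
    (Eventually.of_forall fun r => ?_) ?_ ?_ ?_
  · refine aestronglyMeasurable_exp_neg_apply (StronglyMeasurable.aestronglyMeasurable ?_)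
    exact (hw.stronglyMeasurable.comp_measurable (measurable_add_const r)).sub
      stronglyMeasurable_const
  · have hev : ∀ᶠ r in 𝓝[≥] t, r ∈ Icc t (t + 1) := Icc_mem_nhdsGE (lt_add_one t)
    filter_upwards [hev] with r hr
    refine (ae_restrict_mem measurableSet_Iic).mono fun s hs => ?_
    refine norm_exp_neg_apply_le hA hs ?_
    have hs' : s ≤ 0 := hs
    have h1 : Real.exp (-(κ / 2) * (s + r)) ≤ Real.exp (-(κ / 2) * t) * Real.exp (-(κ / 2) * s) := by
      rw [← Real.exp_add]; exact Real.exp_le_exp.2 (by nlinarith [hr.1])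
    have h2 : Real.exp (-(κ / 2) * r) ≤ Real.exp (-(κ / 2) * t) * Real.exp (-(κ / 2) * s) := by
      rw [← Real.exp_add]; exact Real.exp_le_exp.2 (by nlinarith [hr.1])
    have h3 := hC (s + r) (by linarith [hr.2])
    have h4 := hC r hr.2
    refine (norm_sub_le _ _).trans ?_
    rw [add_mul, mul_assoc]
    exact add_le_add (h3.trans (mul_le_mul_of_nonneg_left h1 hC0))
      (h4.trans (mul_le_mul_of_nonneg_left h2 hC0))
  · exact (integrableOn_exp_mul_Iic (a := κ - κ / 2) (by linarith) 0).const_mul _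
  · refine Eventually.of_forall fun s => ?_
    refine A.continuous.continuousAt.comp_continuousWithinAt
      ((NormedSpace.exp ((-s) • A)).continuous.continuousAt.comp_continuousWithinAt ?_)
    refine ContinuousWithinAt.sub (ContinuousWithinAt.comp (t := Ici (s + t))
      (hw.right_cont (s + t)) (continuous_const_add s).continuousWithinAt ?_) (hw.right_cont t)
    intro r hr
    exact add_le_add_right hr.out s

lemma ouIntegral_shift_bound (hw : IsTamePath w) (hκ : 0 < κ)
    (hA : ∀ t ≥ (0 : ℝ), ‖NormedSpace.exp (t • A)‖ ≤ Real.exp (-κ * t)) {c : ℝ} (hc : 0 < c) :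
    ∃ M, ∀ t ≤ 0, ‖ouIntegral A (SlowFast.shift t w)‖ ≤ M * Real.exp (-c * t) := by
  -- The rate `d` must be below `κ` for the integral to converge, and at most `c` for the weight
  -- claimed.
  obtain ⟨d, hd0, hdc, hdκ⟩ : ∃ d, 0 < d ∧ d ≤ c ∧ d < κ :=
    ⟨min c (κ / 2), lt_min hc (by linarith), min_le_left _ _,
      (min_le_right _ _).trans_lt (by linarith)⟩
  obtain ⟨C, hC0, hC⟩ := hw.growth_Iic hd0 0
  refine ⟨‖A‖ * (2 * C) / (κ - d), fun t ht => ?_⟩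
  rw [hw.ouIntegral_shift hκ hA]
  have hpos : 0 < κ - d := sub_pos.2 hdκ
  have hbd : ∀ s ∈ Iic (0 : ℝ), ‖A (NormedSpace.exp ((-s) • A) (w (s + t) - w t))‖
      ≤ ‖A‖ * (2 * C * Real.exp (-d * t)) * Real.exp ((κ - d) * s) := by
    intro s hs
    have hs' : s ≤ 0 := hs
    refine norm_exp_neg_apply_le hA hs ?_
    have h1 : Real.exp (-d * (s + t)) = Real.exp (-d * t) * Real.exp (-d * s) := by
      rw [← Real.exp_add]; ring_nf
    have h2 : Real.exp (-d * t) ≤ Real.exp (-d * t) * Real.exp (-d * s) := by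
      rw [← Real.exp_add]; exact Real.exp_le_exp.2 (by nlinarith)
    have h3 := hC (s + t) (by linarith)
    have h4 := (hC t ht).trans (mul_le_mul_of_nonneg_left h2 hC0)
    rw [h1] at h3
    refine (norm_sub_le _ _).trans ((add_le_add h3 h4).trans (le_of_eq (by ring)))
  refine (norm_integral_le_of_norm_le ((integrableOn_exp_mul_Iic hpos 0).const_mul _)
    ((ae_restrict_mem measurableSet_Iic).mono hbd)).trans ?_
  rw [integral_const_mul, integral_exp_mul_Iic hpos, mul_zero, Real.exp_zero]
  have h5 : Real.exp (-d * t) ≤ Real.exp (-c * t) := Real.exp_le_exp.2 (by nlinarith)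
  calc ‖A‖ * (2 * C * Real.exp (-d * t)) * (1 / (κ - d))
      = ‖A‖ * (2 * C) / (κ - d) * Real.exp (-d * t) := by ring
    _ ≤ _ := mul_le_mul_of_nonneg_left h5 (by positivity)

end IsTamePath

end OrnsteinUhlenbeck

/-! ### Parameters of the three systems, and the time change between them. -/

section SlowFastSystem

variable {E₁ E₂ : Type*} [NormedAddCommGroup E₁] [NormedSpace ℝ E₁] [CompleteSpace E₁]
  [NormedAddCommGroup E₂] [NormedSpace ℝ E₂] [CompleteSpace E₂]

/-- The assumptions on the coefficients of the slow-fast system. -/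
structure HasSpectralGap (S : E₁ →L[ℝ] E₁) (F : E₂ →L[ℝ] E₂) (g₁ : E₁ → E₂ → E₁)
    (g₂ : E₁ → E₂ → E₂) (γs γf K γ : ℝ) : Prop where
  slow_pos : 0 < γs
  fast_neg : γf < 0
  exp_S : ∀ t ≤ (0 : ℝ), ‖NormedSpace.exp (t • S)‖ ≤ Real.exp (γs * t)
  exp_F : ∀ t ≥ (0 : ℝ), ‖NormedSpace.exp (t • F)‖ ≤ Real.exp (γf * t)
  K_pos : 0 < K
  lip₁ : ∀ x₁ y₁ x₂ y₂, ‖g₁ x₁ y₁ - g₁ x₂ y₂‖ ≤ K * (‖x₁ - x₂‖ + ‖y₁ - y₂‖)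
  lip₂ : ∀ x₁ y₁ x₂ y₂, ‖g₂ x₁ y₁ - g₂ x₂ y₂‖ ≤ K * (‖x₁ - x₂‖ + ‖y₁ - y₂‖)
  rate_pos : 0 < γ
  gap : K < -(γ + γf)

/-- An admissible range for the time-scale separation parameter. -/
def maxEps (γf K γ : ℝ) : ℝ := (1 - K / (-γf - γ)) * γ / K

lemma integral_comp_mul_left_Iic {E : Type*} [NormedAddCommGroup E] [NormedSpace ℝ E]
    (f : ℝ → E) (a : ℝ) {b : ℝ} (hb : 0 < b) :
    ∫ s in Iic a, f (b * s) = b⁻¹ • ∫ s in Iic (b * a), f s := by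
  have h := integral_comp_mul_left_Ioi (fun s => f (-s)) (-a) hb
  rw [← integral_comp_neg_Iic a (fun s => f (-(b * s)))] at h
  rw [mul_neg, ← integral_comp_neg_Iic (b * a) (fun s => f (-s))] at h
  simpa using h

lemma norm_exp_smul_inv_smul_le {E : Type*} [NormedAddCommGroup E] [NormedSpace ℝ E]
    {F : E →L[ℝ] E} {γf b : ℝ} (hb : 0 < b)
    (hF : ∀ t ≥ (0 : ℝ), ‖NormedSpace.exp (t • F)‖ ≤ Real.exp (γf * t)) (t : ℝ) (ht : t ≥ 0) :
    ‖NormedSpace.exp (t • (b • F))‖ ≤ Real.exp (-(-γf * b) * t) := by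
  rw [smul_smul]
  refine (hF (t * b) (mul_nonneg ht hb.le)).trans (le_of_eq ?_)
  ring_nf

namespace HasSpectralGap

variable {S : E₁ →L[ℝ] E₁} {F : E₂ →L[ℝ] E₂} {g₁ : E₁ → E₂ → E₁} {g₂ : E₁ → E₂ → E₂}
  {γs γf K γ : ℝ}

lemma gap_pos (h : HasSpectralGap S F g₁ g₂ γs γf K γ) : 0 < -γf - γ := by
  linarith [h.gap, h.K_pos]

lemma ratio_lt (h : HasSpectralGap S F g₁ g₂ γs γf K γ) : K / (-γf - γ) < 1 := by
  rw [div_lt_one h.gap_pos]; linarith [h.gap]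

lemma maxEps_pos (h : HasSpectralGap S F g₁ g₂ γs γf K γ) : 0 < maxEps γf K γ :=
  div_pos (mul_pos (sub_pos.2 h.ratio_lt) h.rate_pos) h.K_pos

/-- All rates scale with the speeds: `ρ = γb`, `μ = aγs`, `κ = -γf b`. In the fast summand `b`
cancels, so only the slow summand depends on the system. -/
lemma lpContracting (h : HasSpectralGap S F g₁ g₂ γs γf K γ) {a b : ℝ} (ha : 0 ≤ a) (hb : 0 < b)
    (hab : a * K / (a * γs + γ * b) + K / (-γf - γ) < 1) {z : ℝ → E₂}
    (hz : ∀ t, ContinuousWithinAt z (Ici t) t)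
    (hzb : ∃ M, ∀ t ≤ 0, ‖z t‖ ≤ M * Real.exp (-(γ * b) * t)) :
    LPContracting a b S F g₁ g₂ z (γ * b) K (a * γs) (-γf * b) where
  a_nonneg := ha
  b_nonneg := hb.le
  K_nonneg := h.K_pos.le
  rho_pos := mul_pos h.rate_pos hb
  mu_nonneg := mul_nonneg ha h.slow_pos.le
  rho_lt := mul_lt_mul_of_pos_right (by linarith [h.gap_pos]) hb
  exp_S t ht := (h.exp_S (a * t) (mul_nonpos_of_nonneg_of_nonpos ha ht)).trans
    (le_of_eq (by ring_nf))
  exp_F t ht := (h.exp_F (b * t) (mul_nonneg hb.le ht)).trans (le_of_eq (by ring_nf))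
  lip₁ := h.lip₁
  lip₂ := h.lip₂
  contraction := by
    have hne := h.gap_pos.ne'
    have : b * K / (-γf * b - γ * b) = K / (-γf - γ) := by
      rw [← sub_mul, mul_comm b K, mul_div_mul_right _ _ hb.ne']
    rwa [this]
  noise_right_cont t _ := (hz t).mono Ioi_subset_Ici_self
  noise_meas := stronglyMeasurable_of_right_cont hz
  noise_bound := hzb

lemma contraction_eps (h : HasSpectralGap S F g₁ g₂ γs γf K γ) {ε : ℝ}
    (hε : ε ∈ Ioo 0 (maxEps γf K γ)) : ε * K / (ε * γs + γ) + K / (-γf - γ) < 1 := by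
  have h1 := h.rate_pos
  have h2 := h.slow_pos
  have h3 := h.K_pos
  have h4 := hε.1
  -- Dropping `εγs` makes the condition linear in `ε`; solving it gives `maxEps`.
  have h5 : ε * K / (ε * γs + γ) ≤ ε * K / γ := by
    have : 0 < ε * γs := mul_pos h4 h2
    gcongr
    linarith
  have h6 : ε * K / γ < 1 - K / (-γf - γ) := by
    rw [div_lt_iff₀ h1, ← lt_div_iff₀ h3]
    exact hε.2
  linarith

variable {w : ℝ → E₂} {α σ ε : ℝ}

lemma tilde_noise (h : HasSpectralGap S F g₁ g₂ γs γf K γ) (hw : IsTamePath w) :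
    (∀ t, ContinuousWithinAt (noiseTilde σ F w) (Ici t) t) ∧
      ∃ M, ∀ t ≤ 0, ‖noiseTilde σ F w t‖ ≤ M * Real.exp (-(γ * 1) * t) := by
  have hF : ∀ t ≥ (0 : ℝ), ‖NormedSpace.exp (t • F)‖ ≤ Real.exp (-(-γf) * t) := by
    simpa using h.exp_F
  have hκ : 0 < -γf := neg_pos.2 h.fast_neg
  refine ⟨fun t => (hw.continuousWithinAt_ouIntegral_shift hκ hF t).const_smul σ, ?_⟩
  obtain ⟨M, hM⟩ := hw.ouIntegral_shift_bound hκ hF h.rate_pos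
  refine ⟨‖σ‖ * M, fun t ht => ?_⟩
  rw [noiseTilde, norm_smul, mul_assoc, mul_one]
  exact mul_le_mul_of_nonneg_left (hM t ht) (norm_nonneg σ)

lemma hat_noise (h : HasSpectralGap S F g₁ g₂ γs γf K γ) (hw : IsTamePath w) (hε : 0 < ε) :
    (∀ t, ContinuousWithinAt (noiseHat α ε σ F w) (Ici t) t) ∧
      ∃ M, ∀ t ≤ 0, ‖noiseHat α ε σ F w t‖ ≤ M * Real.exp (-(γ * ε⁻¹) * t) := by
  have hε' := inv_pos.2 hε
  have hF := norm_exp_smul_inv_smul_le hε' h.exp_F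
  have hκ : 0 < -γf * ε⁻¹ := mul_pos (neg_pos.2 h.fast_neg) hε'
  refine ⟨fun t => ((hw.continuousWithinAt_ouIntegral_shift hκ hF t).const_smul _).const_smul σ, ?_⟩
  obtain ⟨M, hM⟩ := hw.ouIntegral_shift_bound hκ hF (mul_pos h.rate_pos hε')
  refine ⟨‖σ‖ * (‖ε ^ (-(1 / α))‖ * M), fun t ht => ?_⟩
  rw [noiseHat, eta, norm_smul, norm_smul, mul_assoc, mul_assoc]
  gcongr
  exact hM t ht

lemma contracting_zero (h : HasSpectralGap S F g₁ g₂ γs γf K γ) (hw : IsTamePath w) :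
    LPContracting 0 1 S F g₁ g₂ (noiseTilde σ F w) γ K 0 (-γf) := by
  simpa using h.lpContracting le_rfl one_pos (by simpa using h.ratio_lt)
    (h.tilde_noise hw).1 (h.tilde_noise (σ := σ) hw).2

lemma contracting_tilde (h : HasSpectralGap S F g₁ g₂ γs γf K γ) (hw : IsTamePath w)
    (hε : ε ∈ Ioo 0 (maxEps γf K γ)) :
    LPContracting ε 1 S F g₁ g₂ (noiseTilde σ F w) γ K (ε * γs) (-γf) := by
  simpa using h.lpContracting hε.1.le one_pos (by simpa using h.contraction_eps hε)
    (h.tilde_noise hw).1 (h.tilde_noise (σ := σ) hw).2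

lemma contracting_hat (h : HasSpectralGap S F g₁ g₂ γs γf K γ) (hw : IsTamePath w)
    (hε : ε ∈ Ioo 0 (maxEps γf K γ)) :
    LPContracting 1 ε⁻¹ S F g₁ g₂ (noiseHat α ε σ F w) (γ * ε⁻¹) K (1 * γs) (-γf * ε⁻¹) := by
  refine h.lpContracting zero_le_one (inv_pos.2 hε.1) ?_
    (h.hat_noise hw hε.1).1 (h.hat_noise hw hε.1).2
  have h1 := h.contraction_eps hε
  have hε0 := hε.1
  -- The original and the rescaled system have the same contraction constant, as a change of time
  -- should give.
  have h2 : 1 * K / (1 * γs + γ * ε⁻¹) = ε * K / (ε * γs + γ) := by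
    have := h.rate_pos
    have := h.slow_pos
    field_simp
  rwa [h2]

/-- Self-similarity links the noise of the original system to that of the rescaled one. -/
lemma noiseHat_eq (h : HasSpectralGap S F g₁ g₂ γs γf K γ) (hw : IsTamePath w) (hε : 0 < ε) :
    noiseHat α ε σ F w =
      fun t => noiseTilde σ F (fun s => ε ^ (-(1 / α)) • w (ε * s)) (ε⁻¹ * t) := by
  funext t
  have hε' := inv_pos.2 hε
  have hF : ∀ t ≥ (0 : ℝ), ‖NormedSpace.exp (t • F)‖ ≤ Real.exp (-(-γf) * t) := by
    simpa using h.exp_F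
  rw [noiseHat, noiseTilde, eta, xi,
    hw.ouIntegral_shift (mul_pos (neg_pos.2 h.fast_neg) hε')
      (norm_exp_smul_inv_smul_le hε' h.exp_F),
    (hw.rescale (ε ^ (-(1 / α))) hε).ouIntegral_shift (neg_pos.2 h.fast_neg) hF]
  congr 1
  simp_rw [← smul_sub, map_smul]
  rw [integral_smul]
  congr 1
  have h1 := integral_comp_mul_left_Iic (fun r => F (NormedSpace.exp ((-r) • F)
    (w (ε * (r + ε⁻¹ * t)) - w (ε * (ε⁻¹ * t))))) 0 hε'
  rw [inv_inv, mul_zero] at h1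
  rw [← one_smul ℝ (∫ s in Iic (0 : ℝ), F _), ← inv_mul_cancel₀ hε.ne', mul_smul, ← h1,
    ← integral_smul]
  congr 1
  ext s
  rw [mul_add, mul_inv_cancel_left₀ hε.ne', mul_inv_cancel_left₀ hε.ne', _root_.smul_apply,
    smul_smul, neg_mul, mul_comm s]

end HasSpectralGap

lemma MemWeighted.time_change {E : Type*} [NormedAddCommGroup E] {φ : ℝ → E} {ρ c : ℝ}
    (hφ : MemWeighted (-ρ) φ) (hc : 0 < c) : MemWeighted (-(ρ * c)) fun t => φ (c * t) := by
  obtain ⟨hcont, M, hM⟩ := memWeighted_neg_iff.1 hφ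
  have hneg : ∀ t ≤ 0, c * t ≤ 0 := fun t ht => mul_nonpos_of_nonneg_of_nonpos hc.le ht
  refine memWeighted_neg_iff.2
    ⟨hcont.comp (continuous_const_mul _).continuousOn hneg, M, fun t ht => ?_⟩
  refine (hM _ (hneg t ht)).trans (le_of_eq ?_)
  ring_nf

/-- Solutions of the Lyapunov-Perron equations under the change of time `t ↦ t / ε`. -/
lemma IsLPSolution.time_change {ε : ℝ} (hε : 0 < ε) {S : E₁ →L[ℝ] E₁} {F : E₂ →L[ℝ] E₂}
    {g₁ : E₁ → E₂ → E₁} {g₂ : E₁ → E₂ → E₂} {z : ℝ → E₂} {ρ K μ κ K' μ' κ' : ℝ}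
    {x : ℝ → E₁} {y : ℝ → E₂} {x₀ : E₁}
    (h : LPContracting ε 1 S F g₁ g₂ z ρ K μ κ)
    (h' : LPContracting 1 ε⁻¹ S F g₁ g₂ (fun t => z (ε⁻¹ * t)) (ρ * ε⁻¹) K' μ' κ')
    (hs : IsLPSolution ε 1 S F g₁ g₂ z (-ρ) x₀ x y) :
    IsLPSolution 1 ε⁻¹ S F g₁ g₂ (fun t => z (ε⁻¹ * t)) (-(ρ * ε⁻¹)) x₀
      (fun t => x (ε⁻¹ * t)) (fun t => y (ε⁻¹ * t)) := by
  have hε' := inv_pos.2 hε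
  obtain ⟨hx, hy, hxy⟩ := h.isLPSolution_iff.1 hs
  refine h'.isLPSolution_iff.2 ⟨hx.time_change hε', hy.time_change hε', fun t ht => ?_⟩
  obtain ⟨h1, h2⟩ := hxy (ε⁻¹ * t) (mul_nonpos_of_nonneg_of_nonpos hε'.le ht)
  constructor
  · rw [h1, lpX, lpX]
    have h3 := intervalIntegral.integral_comp_mul_left (a := 0) (b := t)
      (fun s => NormedSpace.exp ((ε * (ε⁻¹ * t - s)) • S) (g₁ (x s) (y s + z s))) hε'.ne'
    rw [inv_inv, mul_zero] at h3
    rw [← h3, one_smul, one_mul, mul_inv_cancel_left₀ hε.ne']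
    simp_rw [mul_sub, mul_inv_cancel_left₀ hε.ne', one_mul]
  · rw [h2, lpY, lpY]
    have h3 := integral_comp_mul_left_Iic
      (fun s => NormedSpace.exp ((1 * (ε⁻¹ * t - s)) • F) (g₂ (x s) (y s + z s))) t hε'
    rw [inv_inv] at h3
    simp_rw [mul_sub, one_mul] at h3 ⊢
    rw [h3, smul_smul, inv_mul_cancel₀ hε.ne']

namespace HasSpectralGap

variable {S : E₁ →L[ℝ] E₁} {F : E₂ →L[ℝ] E₂} {g₁ : E₁ → E₂ → E₁} {g₂ : E₁ → E₂ → E₂}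
  {γs γf K γ : ℝ} {w : ℝ → E₂} {α σ ε : ℝ}

/-- A pathwise identity: the time change fixes `t = 0`, so the fast components agree there, and the
noise path becomes that of the rescaled driving path. -/
lemma hHat_eq_hTilde_rescale (h : HasSpectralGap S F g₁ g₂ γs γf K γ) (hw : IsTamePath w)
    (hε : ε ∈ Ioo 0 (maxEps γf K γ)) (x₀ : E₁) :
    hHat α σ γ ε S F g₁ g₂ w x₀ =
      hTilde σ γ ε S F g₁ g₂ (fun s => ε ^ (-(1 / α)) • w (ε * s)) x₀ := by
  have h1 := h.contracting_tilde (σ := σ) (hw.rescale (ε ^ (-(1 / α))) hε.1) hε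
  have h2 := h.contracting_hat (α := α) (σ := σ) hw hε
  rw [h.noiseHat_eq hw hε.1] at h2
  obtain ⟨x, y, hs, -⟩ := h1.exists_solution x₀
  rw [hHat, hTilde, h.noiseHat_eq hw hε.1, h1.graphMap_eq hs,
    show -γ / ε = -(γ * ε⁻¹) by rw [neg_div, div_eq_mul_inv],
    h2.graphMap_eq (hs.time_change hε.1 h1 h2), mul_zero]

end HasSpectralGap

end SlowFastSystem

/-! ### Measurability of the graph map in the driving path. -/

section Measurability

variable {E₁ E₂ : Type*} [NormedAddCommGroup E₁] [NormedSpace ℝ E₁] [CompleteSpace E₁]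
  [NormedAddCommGroup E₂] [NormedSpace ℝ E₂] [CompleteSpace E₂] [MeasurableSpace E₂]
  [BorelSpace E₂] [SecondCountableTopology E₂]

/-- The right-continuous regularization of a path; it depends measurably on the path. -/
def regularize (u : ℝ → E₂) (t : ℝ) : E₂ :=
  limUnder atTop fun n : ℕ => u (gridRight 0 ((n : ℝ) + 1)⁻¹ t)

lemma regularize_eq {w : ℝ → E₂} (hw : ∀ t, ContinuousWithinAt w (Ici t) t) :
    regularize w = w := by
  funext t
  exact ((hw t).tendsto.comp
    (tendsto_gridRight (Eventually.of_forall fun n => by positivity) tendsto_inv_succ t)).limUnder_eq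

lemma stronglyMeasurable_regularize :
    StronglyMeasurable fun p : (ℝ → E₂) × ℝ => regularize p.1 p.2 := by
  refine StronglyMeasurable.limUnder
    (f := fun (n : ℕ) (p : (ℝ → E₂) × ℝ) => p.1 (gridRight 0 ((n : ℝ) + 1)⁻¹ p.2)) fun n => ?_
  have h1 : Measurable fun q : (ℝ → E₂) × ℤ => q.1 (0 + (q.2 + 1) * ((n : ℝ) + 1)⁻¹) :=
    measurable_from_prod_countable_left fun k =>
      measurable_pi_apply (0 + ((k : ℝ) + 1) * ((n : ℝ) + 1)⁻¹)
  have h2 : Measurable fun p : (ℝ → E₂) × ℝ =>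
      (p.1, ⌊(p.2 - 0) / ((n : ℝ) + 1)⁻¹⌋) :=
    measurable_fst.prodMk (((measurable_snd.sub_const 0).div_const _).floor)
  exact (h1.comp h2).stronglyMeasurable

/-- Moving the varying domain into an indicator brings the integral within reach of Fubini-type
measurability. -/
lemma stronglyMeasurable_setIntegral {X E : Type*} [MeasurableSpace X] [NormedAddCommGroup E]
    [NormedSpace ℝ E] {f : X → ℝ → E} (hf : StronglyMeasurable (Function.uncurry f))
    {s : Set (X × ℝ)} (hs : MeasurableSet s) :
    StronglyMeasurable fun x => ∫ r in {r | (x, r) ∈ s}, f x r := by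
  have h : ∀ x, ∫ r in {r | (x, r) ∈ s}, f x r
      = ∫ r, s.indicator (Function.uncurry f) (x, r) := by
    intro x
    exact (integral_indicator (f := fun r => f x r) (measurable_prodMk_left hs)).symm
  simp_rw [h]
  exact (hf.indicator hs).integral_prod_right'

lemma StronglyMeasurable.clm_exp_apply {X E : Type*} [MeasurableSpace X] [NormedAddCommGroup E]
    [NormedSpace ℝ E] [CompleteSpace E] (A : E →L[ℝ] E) {c : X → ℝ} (hc : Measurable c)
    {f : X → E} (hf : StronglyMeasurable f) :
    StronglyMeasurable fun x => NormedSpace.exp (c x • A) (f x) :=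
  (isBoundedBilinearMap_apply (𝕜 := ℝ) (E := E) (F := E)).continuous.comp_stronglyMeasurable
    (((continuous_exp_smul A).stronglyMeasurable.comp_measurable hc).prodMk hf)

/-- A version of the noise that depends measurably on the path. -/
def noiseReg (σ : ℝ) (F : E₂ →L[ℝ] E₂) (u : ℝ → E₂) (t : ℝ) : E₂ :=
  σ • ∫ s in Iic (0 : ℝ),
    F (NormedSpace.exp ((-s) • F) (regularize u (s + t) - regularize u t))

lemma stronglyMeasurable_noiseReg (σ : ℝ) (F : E₂ →L[ℝ] E₂) :
    StronglyMeasurable fun p : (ℝ → E₂) × ℝ => noiseReg σ F p.1 p.2 := by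
  refine StronglyMeasurable.const_smul ?_ σ
  have hm₁ : Measurable fun q : ((ℝ → E₂) × ℝ) × ℝ => (q.1.1, q.2 + q.1.2) :=
    (measurable_fst.comp measurable_fst).prodMk
      (measurable_snd.add (measurable_snd.comp measurable_fst))
  have hm₂ : Measurable fun q : ((ℝ → E₂) × ℝ) × ℝ => q.1 := measurable_fst
  have h1 := (stronglyMeasurable_regularize (E₂ := E₂)).comp_measurable hm₁
  have h2 := (stronglyMeasurable_regularize (E₂ := E₂)).comp_measurable hm₂
  have h3 : Measurable fun q : ((ℝ → E₂) × ℝ) × ℝ => -q.2 := measurable_snd.neg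
  exact (F.continuous.comp_stronglyMeasurable
    (StronglyMeasurable.clm_exp_apply F h3 (h1.sub h2))).integral_prod_right'

lemma noiseReg_eq {σ κ : ℝ} {F : E₂ →L[ℝ] E₂} {w : ℝ → E₂} (hw : IsTamePath w) (hκ : 0 < κ)
    (hF : ∀ t ≥ (0 : ℝ), ‖NormedSpace.exp (t • F)‖ ≤ Real.exp (-κ * t)) :
    noiseReg σ F w = noiseTilde σ F w := by
  funext t
  rw [noiseReg, noiseTilde, xi, hw.ouIntegral_shift hκ hF, regularize_eq hw.right_cont]

variable {S : E₁ →L[ℝ] E₁} {F : E₂ →L[ℝ] E₂} {g₁ : E₁ → E₂ → E₁} {g₂ : E₁ → E₂ → E₂}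

/-- Joint measurability in parameter and time is what the induction needs, since each iterate
integrates the previous one in time. -/
lemma stronglyMeasurable_lpIter {X : Type*} [MeasurableSpace X] {z : X → ℝ → E₂}
    (hz : StronglyMeasurable (Function.uncurry z))
    (hg₁ : Continuous fun p : E₁ × E₂ => g₁ p.1 p.2)
    (hg₂ : Continuous fun p : E₁ × E₂ => g₂ p.1 p.2) (a b : ℝ) (x₀ : E₁) (n : ℕ) :
    (StronglyMeasurable fun p : X × ℝ => (lpIter a b S F g₁ g₂ (z p.1) x₀ n).1 p.2) ∧
      StronglyMeasurable fun p : X × ℝ => (lpIter a b S F g₁ g₂ (z p.1) x₀ n).2 p.2 := by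
  induction n with
  | zero => exact ⟨stronglyMeasurable_const, stronglyMeasurable_const⟩
  | succ n ih =>
    have hpair : Measurable fun q : (X × ℝ) × ℝ => (q.1.1, q.2) :=
      measurable_fst.fst.prodMk measurable_snd
    have hu := (ih.1.comp_measurable hpair).prodMk
      ((ih.2.comp_measurable hpair).add (hz.comp_measurable hpair))
    have hu₁ := hg₁.comp_stronglyMeasurable hu
    have hu₂ := hg₂.comp_stronglyMeasurable hu
    have hdiff : ∀ c : ℝ, Measurable fun q : (X × ℝ) × ℝ => c * (q.1.2 - q.2) := fun c =>
      (measurable_fst.snd.sub measurable_snd).const_mul c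
    have h₁ := StronglyMeasurable.clm_exp_apply S (hdiff a) hu₁
    have h₂ := StronglyMeasurable.clm_exp_apply F (hdiff b) hu₂
    constructor
    · refine StronglyMeasurable.add (StronglyMeasurable.clm_exp_apply S
        (measurable_snd.const_mul a) stronglyMeasurable_const) (StronglyMeasurable.const_smul ?_ a)
      refine StronglyMeasurable.sub ?_ ?_
      · exact stronglyMeasurable_setIntegral
          (s := {q : (X × ℝ) × ℝ | 0 < q.2 ∧ q.2 ≤ q.1.2}) h₁
          ((measurableSet_lt measurable_const measurable_snd).inter
            (measurableSet_le measurable_snd measurable_fst.snd))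
      · exact stronglyMeasurable_setIntegral
          (s := {q : (X × ℝ) × ℝ | q.1.2 < q.2 ∧ q.2 ≤ 0}) h₁
          ((measurableSet_lt measurable_fst.snd measurable_snd).inter
            (measurableSet_le measurable_snd measurable_const))
    · refine StronglyMeasurable.const_smul ?_ b
      exact stronglyMeasurable_setIntegral (s := {q : (X × ℝ) × ℝ | q.2 ≤ q.1.2}) h₂
        (measurableSet_le measurable_snd measurable_fst.snd)

/-- On tame paths the graph map is a measurable function of the driving path. -/
lemma exists_measurable_graphMap {γs γf K γ : ℝ} (h : HasSpectralGap S F g₁ g₂ γs γf K γ)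
    (a σ : ℝ) (x₀ : E₁) :
    ∃ G : (ℝ → E₂) → E₂, Measurable G ∧ ∀ w, IsTamePath w → ∀ μ κ,
      LPContracting a 1 S F g₁ g₂ (noiseTilde σ F w) γ K μ κ →
      graphMap a 1 S F g₁ g₂ (noiseTilde σ F w) (-γ) x₀ = G w := by
  -- The iterates are driven by `noiseReg`, which is measurable on all paths and agrees with the
  -- true noise on tame ones.
  refine ⟨fun u => limUnder atTop fun n => (lpIter a 1 S F g₁ g₂ (noiseReg σ F u) x₀ n).2 0,
    ?_, fun w hw μ κ hc => ?_⟩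
  · refine (StronglyMeasurable.limUnder (f := fun (n : ℕ) (u : ℝ → E₂) =>
      (lpIter a 1 S F g₁ g₂ (noiseReg σ F u) x₀ n).2 0) fun n => ?_).measurable
    exact (stronglyMeasurable_lpIter (stronglyMeasurable_noiseReg σ F)
      (continuous_uncurry_of_lip h.lip₁) (continuous_uncurry_of_lip h.lip₂) a 1 x₀ n).2.comp_measurable
        (measurable_id.prodMk measurable_const)
  · have hF : ∀ t ≥ (0 : ℝ), ‖NormedSpace.exp (t • F)‖ ≤ Real.exp (-(-γf) * t) := by
      simpa using h.exp_F
    beta_reduce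
    rw [noiseReg_eq hw (neg_pos.2 h.fast_neg) hF]
    exact (hc.tendsto_lpIter x₀).limUnder_eq.symm

end Measurability

/-! ### Self-similarity of the law on path space. -/

section Law

variable {Ω E : Type*} [MeasurableSpace Ω] {P : Measure Ω} [IsProbabilityMeasure P]
  [NormedAddCommGroup E] [NormedSpace ℝ E] [MeasurableSpace E] [BorelSpace E]
  [SecondCountableTopology E] {α : ℝ} {L : ℝ → Ω → E}

/-- The enumeration stays constant after the last point, so that it fits the sequence form of
independent increments. -/
lemma exists_monotone_enumeration (J : Finset ℝ) (hJ : J.Nonempty) :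
    ∃ t : ℕ → ℝ, Monotone t ∧ ∀ r ∈ J, ∃ k, t k = r := by
  obtain ⟨n, hn⟩ : ∃ n, J.card = n + 1 := ⟨J.card - 1, by have := hJ.card_pos; omega⟩
  refine ⟨fun k => J.orderEmbOfFin hn ⟨min k n, by omega⟩, fun a b hab => ?_, fun r hr => ?_⟩
  · refine (J.orderEmbOfFin hn).monotone ?_
    simp only [Fin.mk_le_mk]
    omega
  · obtain ⟨k, rfl⟩ : r ∈ Set.range (J.orderEmbOfFin hn) := by
      rw [Finset.range_orderEmbOfFin]; exact hr
    exact ⟨k, congrArg _ (Fin.ext (min_eq_left (by omega)))⟩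

/-- It suffices to compare finite-dimensional laws. Along a monotone sequence of times the
increments are independent, so their joint law is the product of marginals, which agree by
hypothesis. -/
lemma identDistrib_of_indep_increments {X Y : ℝ → Ω → E} (hX : ∀ t, Measurable (X t))
    (hY : ∀ t, Measurable (Y t)) (hX0 : ∀ᵐ ω ∂P, X 0 ω = 0) (hY0 : ∀ᵐ ω ∂P, Y 0 ω = 0)
    (hXi : HasIndepIncrements X P) (hYi : HasIndepIncrements Y P)
    (hXY : ∀ s t, s ≤ t →
      IdentDistrib (fun ω => X t ω - X s ω) (fun ω => Y t ω - Y s ω) P P) :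
    IdentDistrib (fun ω t => X t ω) (fun ω t => Y t ω) P P := by
  rw [identDistrib_iff_forall_finset_identDistrib (measurable_pi_iff.2 hX).aemeasurable
    (measurable_pi_iff.2 hY).aemeasurable]
  intro I
  -- Time `0` joins the grid because both processes vanish there, which anchors the values to the
  -- increments on either side.
  obtain ⟨t, ht, hk⟩ := exists_monotone_enumeration (insert 0 I) (Finset.insert_nonempty 0 I)
  choose! k hk using hk
  have hmX : ∀ i, Measurable fun ω => X (t (i + 1)) ω - X (t i) ω := fun i => (hX _).sub (hX _)
  have hmY : ∀ i, Measurable fun ω => Y (t (i + 1)) ω - Y (t i) ω := fun i => (hY _).sub (hY _)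
  have hinc : IdentDistrib (fun ω (i : ℕ) => X (t (i + 1)) ω - X (t i) ω)
      (fun ω (i : ℕ) => Y (t (i + 1)) ω - Y (t i) ω) P P := by
    refine ⟨(measurable_pi_iff.2 hmX).aemeasurable, (measurable_pi_iff.2 hmY).aemeasurable, ?_⟩
    rw [(iIndepFun_iff_map_fun_eq_infinitePi_map hmX).1 (hXi.nat ht),
      (iIndepFun_iff_map_fun_eq_infinitePi_map hmY).1 (hYi.nat ht)]
    congr 1
    ext1 i
    exact (hXY _ _ (ht i.le_succ)).map_eq
  let Φ : (ℕ → E) → (I → E) := fun d r =>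
    ∑ i ∈ Finset.range (k r), d i - ∑ i ∈ Finset.range (k 0), d i
  have hΦ : Measurable Φ := measurable_pi_iff.2 fun r =>
    (Finset.measurable_sum _ fun i _ => measurable_pi_apply i).sub
      (Finset.measurable_sum _ fun i _ => measurable_pi_apply i)
  have hrec : ∀ (Z : ℝ → Ω → E), (∀ᵐ ω ∂P, Z 0 ω = 0) →
      (fun ω => I.restrict (Z · ω)) =ᵐ[P] fun ω => Φ fun i => Z (t (i + 1)) ω - Z (t i) ω := by
    intro Z hZ0
    filter_upwards [hZ0] with ω hω
    ext1 r
    simp only [Φ]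
    rw [Finset.sum_range_sub (fun i => Z (t i) ω), Finset.sum_range_sub (fun i => Z (t i) ω),
      hk 0 (Finset.mem_insert_self _ _), hk r (Finset.mem_insert_of_mem r.2), hω]
    simp
  have hmeas : ∀ (Z : ℝ → Ω → E), (∀ t, Measurable (Z t)) →
      AEMeasurable (fun ω => I.restrict (Z · ω)) P := fun Z hZ =>
    ((Finset.measurable_restrict I).comp (measurable_pi_iff.2 hZ)).aemeasurable
  exact ((IdentDistrib.of_ae_eq (hmeas X hX) (hrec X hX0)).trans (hinc.comp hΦ)).trans
    (IdentDistrib.of_ae_eq (hmeas Y hY) (hrec Y hY0)).symm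

namespace IsTwoSidedStableLevy

lemma identDistrib_sub (hL : IsTwoSidedStableLevy α L P) {s t : ℝ} (hst : s ≤ t) :
    IdentDistrib (fun ω => L t ω - L s ω) (L (t - s)) P P := by
  have h1 := hL.stationary_increments 0 (t - s) s (sub_nonneg.2 hst)
  simp only [sub_add_cancel, zero_add] at h1
  refine h1.trans (IdentDistrib.of_ae_eq ((hL.measurable _).sub (hL.measurable _)).aemeasurable ?_)
  filter_upwards [hL.zero] with ω hω
  rw [hω, sub_zero]

/-- **Self-similarity** of the whole path. -/
theorem identDistrib_rescale (hL : IsTwoSidedStableLevy α L P) {c : ℝ} (hc : 0 < c) :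
    IdentDistrib (fun ω s => c ^ (-(1 / α)) • L (c * s) ω) (fun ω s => L s ω) P P := by
  have hpos : 0 < c ^ (1 / α) := Real.rpow_pos_of_pos hc _
  refine identDistrib_of_indep_increments (fun t => (hL.measurable _).const_smul _) hL.measurable
    ?_ hL.zero ?_ hL.indep_increments fun s t hst => ?_
  · filter_upwards [hL.zero] with ω hω
    rw [mul_zero, hω, smul_zero]
  · refine HasIndepIncrements.smul (X := fun s ω => L (c * s) ω) ?_ _
    intro n t ht
    exact hL.indep_increments n (fun i => c * t i) fun i j hij =>
      mul_le_mul_of_nonneg_left (ht hij) hc.le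
  · have h1 := hL.identDistrib_sub (mul_le_mul_of_nonneg_left hst hc.le)
    rw [← mul_sub] at h1
    have h2 := (h1.trans (hL.self_similar c hc (t - s))).comp
      (measurable_const_smul (c ^ (-(1 / α))))
    have h3 : (fun x : E => c ^ (-(1 / α)) • x) ∘ (fun ω => c ^ (1 / α) • L (t - s) ω)
        = L (t - s) := by
      ext ω
      rw [Function.comp_apply, smul_smul, Real.rpow_neg hc.le, inv_mul_cancel₀ hpos.ne', one_smul]
    rw [h3] at h2
    refine IdentDistrib.trans ?_ (hL.identDistrib_sub hst).symm
    simpa only [Function.comp_def, smul_sub] using h2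

end IsTwoSidedStableLevy

end Law

/-! ### Ottaviani's maximal inequality. -/

section MaximalInequality

variable {Ω E : Type*} [MeasurableSpace Ω] {P : Measure Ω} [IsProbabilityMeasure P]
  [NormedAddCommGroup E] [MeasurableSpace E] [BorelSpace E] [SecondCountableTopology E]

/-- **Ottaviani's inequality** for sums of independent random variables. -/
theorem measure_exists_norm_sum_gt_le {ξ : ℕ → Ω → E} (hm : ∀ i, Measurable (ξ i))
    (hind : iIndepFun ξ P) {a : ℝ} {n : ℕ}
    (hhalf : ∀ k ≤ n, P.real {ω | a < ‖∑ i ∈ Finset.Ico k n, ξ i ω‖} ≤ 1 / 2) :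
    P.real {ω | ∃ k ≤ n, 2 * a < ‖∑ i ∈ Finset.range k, ξ i ω‖} ≤
      2 * P.real {ω | a < ‖∑ i ∈ Finset.range n, ξ i ω‖} := by
  let S : ℕ → Ω → E := fun k ω => ∑ i ∈ Finset.range k, ξ i ω
  have hS : ∀ k, Measurable (S k) := fun k => Finset.measurable_sum _ fun i _ => hm i
  -- `A k` is the event that the level `2a` is first exceeded at time `k`; it depends on the
  -- variables of index below `k` only.
  let A : ℕ → Set Ω := fun k => {ω | 2 * a < ‖S k ω‖} ∩ ⋂ j ∈ Finset.range k, {ω | ‖S j ω‖ ≤ 2 * a}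
  let m : ℕ → MeasurableSpace Ω := fun i => MeasurableSpace.comap (ξ i) inferInstance
  have hmle : ∀ i, m i ≤ ‹MeasurableSpace Ω› := fun i => (hm i).comap_le
  have hξ : ∀ (T : Set ℕ), ∀ i ∈ T, Measurable[⨆ j ∈ T, m j] (ξ i) := by
    intro T i hi
    exact (comap_measurable (ξ i)).mono (le_iSup₂ (f := fun j (_ : j ∈ T) => m j) i hi) le_rfl
  have hAm : ∀ k, MeasurableSet[⨆ j ∈ Set.Iio k, m j] (A k) := by
    intro k
    have hSk : ∀ j ≤ k, Measurable[⨆ j ∈ Set.Iio k, m j] (S j) := by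
      intro j hj
      refine Finset.measurable_sum _ fun i hi => hξ _ i ?_
      exact (Finset.mem_range.1 hi).trans_le hj
    refine MeasurableSet.inter ((measurable_norm.comp (hSk k le_rfl)) measurableSet_Ioi) ?_
    refine Finset.measurableSet_biInter _ fun j hj => ?_
    exact (measurable_norm.comp (hSk j (Finset.mem_range.1 hj).le)) measurableSet_Iic
  have hA : ∀ k, MeasurableSet (A k) := fun k =>
    (iSup₂_le fun i _ => hmle i : (⨆ j ∈ Set.Iio k, m j) ≤ _) _ (hAm k)
  have hB : MeasurableSet {ω | a < ‖S n ω‖} := measurableSet_lt measurable_const (hS n).norm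
  have hstep : ∀ k ≤ n, P.real (A k) ≤ 2 * P.real (A k ∩ {ω | a < ‖S n ω‖}) := by
    intro k hk
    let D : Set Ω := {ω | a < ‖∑ i ∈ Finset.Ico k n, ξ i ω‖}
    have hDm : MeasurableSet[⨆ j ∈ Set.Ici k, m j] D := by
      have h : Measurable[⨆ j ∈ Set.Ici k, m j] fun ω => ∑ i ∈ Finset.Ico k n, ξ i ω :=
        Finset.measurable_sum _ fun i hi => hξ _ i (Finset.mem_Ico.1 hi).1
      exact (measurable_norm.comp h) measurableSet_Ioi
    have hD : MeasurableSet D := (iSup₂_le fun i _ => hmle i : (⨆ j ∈ Set.Ici k, m j) ≤ _) _ hDm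
    have hindep : Indep (⨆ j ∈ Set.Iio k, m j) (⨆ j ∈ Set.Ici k, m j) P :=
      indep_iSup_of_disjoint hmle hind (Set.disjoint_left.2 fun i h1 h2 =>
        absurd (Set.mem_Iio.1 h1) (not_lt.2 (Set.mem_Ici.1 h2)))
    have hprod : P.real (A k ∩ Dᶜ) = P.real (A k) * P.real Dᶜ := by
      have := (Indep_iff _ _ P).1 hindep (A k) Dᶜ (hAm k) hDm.compl
      simp only [measureReal_def, this, ENNReal.toReal_mul]
    have hDc : 1 / 2 ≤ P.real Dᶜ := by
      rw [probReal_compl_eq_one_sub hD]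
      linarith [hhalf k hk]
    -- If the remaining block has norm at most `a`, the final sum still exceeds `a`. The block is
    -- independent of `A k` and this happens with probability at least `1/2`.
    have hsub : A k ∩ Dᶜ ⊆ A k ∩ {ω | a < ‖S n ω‖} := by
      rintro ω ⟨h1, h2⟩
      refine ⟨h1, ?_⟩
      have h3 : 2 * a < ‖S k ω‖ := h1.1
      have h4 : ‖∑ i ∈ Finset.Ico k n, ξ i ω‖ ≤ a := not_lt.1 h2
      have h5 : S n ω = S k ω + ∑ i ∈ Finset.Ico k n, ξ i ω :=
        (Finset.sum_range_add_sum_Ico _ hk).symm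
      have h6 := norm_sub_le_norm_add (S k ω) (∑ i ∈ Finset.Ico k n, ξ i ω)
      change a < ‖S n ω‖
      rw [h5]
      linarith
    have h7 := measureReal_mono (μ := P) hsub
    rw [hprod] at h7
    nlinarith [measureReal_nonneg (μ := P) (s := A k)]
  have hdisj : (↑(Finset.range (n + 1)) : Set ℕ).PairwiseDisjoint A := by
    have hlt : ∀ i j, i < j → Disjoint (A i) (A j) := by
      intro i j hij
      refine Set.disjoint_left.2 fun ω h1 h2 => ?_
      have h3 : ‖S i ω‖ ≤ 2 * a := Set.mem_iInter₂.1 h2.2 i (Finset.mem_range.2 hij)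
      exact absurd h1.1 (not_lt.2 h3)
    intro i _ j _ hij
    rcases lt_or_gt_of_ne hij with h | h
    · exact hlt i j h
    · exact (hlt j i h).symm
  have hcover : {ω | ∃ k ≤ n, 2 * a < ‖∑ i ∈ Finset.range k, ξ i ω‖}
      ⊆ ⋃ k ∈ Finset.range (n + 1), A k := by
    rintro ω ⟨k, hk, hω⟩
    classical
    have hex : ∃ k, 2 * a < ‖S k ω‖ := ⟨k, hω⟩
    refine Set.mem_iUnion₂.2 ⟨Nat.find hex, Finset.mem_range.2
      (Nat.lt_succ_of_le ((Nat.find_min' hex hω).trans hk)), Nat.find_spec hex, ?_⟩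
    exact Set.mem_iInter₂.2 fun j hj => not_lt.1 (Nat.find_min hex (Finset.mem_range.1 hj))
  calc P.real {ω | ∃ k ≤ n, 2 * a < ‖∑ i ∈ Finset.range k, ξ i ω‖}
      ≤ P.real (⋃ k ∈ Finset.range (n + 1), A k) := measureReal_mono hcover (measure_ne_top _ _)
    _ ≤ ∑ k ∈ Finset.range (n + 1), P.real (A k) := measureReal_biUnion_finset_le _ _
    _ ≤ ∑ k ∈ Finset.range (n + 1), 2 * P.real (A k ∩ {ω | a < ‖S n ω‖}) :=
        Finset.sum_le_sum fun k hk => hstep k (Nat.lt_succ_iff.1 (Finset.mem_range.1 hk))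
    _ = 2 * P.real (⋃ k ∈ Finset.range (n + 1), (A k ∩ {ω | a < ‖S n ω‖})) := by
        rw [measureReal_biUnion_finset (fun i hi j hj hij =>
          (hdisj hi hj hij).mono inter_subset_left inter_subset_left)
          fun k _ => (hA k).inter hB, Finset.mul_sum]
    _ ≤ 2 * P.real {ω | a < ‖S n ω‖} := by
        gcongr
        · exact measure_ne_top _ _
        · exact Set.iUnion₂_subset fun k _ => inter_subset_right

end MaximalInequality

/-! ### Tails of the stable law and growth of the paths. -/

section Growth

variable {Ω E : Type*} [MeasurableSpace Ω] {P : Measure Ω} [IsProbabilityMeasure P]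
  [NormedAddCommGroup E] [NormedSpace ℝ E] [MeasurableSpace E] [BorelSpace E]
  [SecondCountableTopology E] {α : ℝ} {L : ℝ → Ω → E}

lemma exists_measureReal_norm_gt_le {X : Ω → E} (hX : Measurable X) {δ : ℝ} (hδ : 0 < δ) :
    ∃ A : ℝ, 0 < A ∧ P.real {ω | A < ‖X ω‖} ≤ δ := by
  have hanti : Antitone fun n : ℕ => {ω | (n : ℝ) < ‖X ω‖} := fun a b hab ω hω => by
    have h : (b : ℝ) < ‖X ω‖ := hω
    exact (Nat.cast_le.2 hab).trans_lt h
  have hlim := tendsto_measure_iInter_atTop (μ := P)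
    (fun n => (measurableSet_lt measurable_const hX.norm).nullMeasurableSet) hanti
    ⟨0, measure_ne_top _ _⟩
  have hempty : ⋂ n : ℕ, {ω | (n : ℝ) < ‖X ω‖} = ∅ := by
    refine Set.eq_empty_of_forall_notMem fun ω hω => ?_
    obtain ⟨n, hn⟩ := exists_nat_ge ‖X ω‖
    exact absurd (Set.mem_iInter.1 hω n) (not_lt.2 hn)
  rw [hempty, measure_empty] at hlim
  have hev := hlim.eventually_lt_const (ENNReal.ofReal_pos.2 hδ)
  obtain ⟨n, hn, hn1⟩ := (hev.and (eventually_ge_atTop 1)).exists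
  exact ⟨n, by exact_mod_cast hn1, ENNReal.toReal_le_of_le_ofReal hδ.le hn.le⟩

namespace IsTwoSidedStableLevy

lemma measureReal_norm_gt (hL : IsTwoSidedStableLevy α L P) {c : ℝ} (hc : 0 < c) (x : ℝ) :
    P.real {ω | c ^ (1 / α) * x < ‖L (-c) ω‖} = P.real {ω | x < ‖L (-1) ω‖} := by
  have hpos : 0 < c ^ (1 / α) := Real.rpow_pos_of_pos hc _
  have h := (hL.self_similar c hc (-1)).measure_mem_eq
    (s := {v : E | c ^ (1 / α) * x < ‖v‖}) (measurableSet_lt measurable_const measurable_norm)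
  rw [mul_neg, mul_one] at h
  have h2 : (fun ω => c ^ (1 / α) • L (-1) ω) ⁻¹' {v : E | c ^ (1 / α) * x < ‖v‖}
      = {ω | x < ‖L (-1) ω‖} := by
    ext ω
    simp only [mem_preimage, mem_ofPred_eq, norm_smul, Real.norm_of_nonneg hpos.le]
    exact mul_lt_mul_iff_right₀ hpos
  rw [h2] at h
  exact congrArg ENNReal.toReal h

lemma measureReal_norm_sub_gt (hL : IsTwoSidedStableLevy α L P) {c : ℝ} (hc : 0 < c) (x : ℝ) :
    P.real {ω | c ^ (1 / α) * x < ‖L 0 ω - L (-c) ω‖} = P.real {ω | x < ‖L (-1) ω‖} := by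
  rw [← hL.measureReal_norm_gt hc x]
  refine measureReal_congr ?_
  filter_upwards [hL.zero] with ω hω
  refine propext ?_
  change c ^ (1 / α) * x < ‖L 0 ω - L (-c) ω‖ ↔ c ^ (1 / α) * x < ‖L (-c) ω‖
  rw [hω, zero_sub, norm_neg]

/-- Ottaviani's inequality on a grid of `[-T, 0]`. The bound does not depend on the number of cells,
which permits refinement. -/
lemma measureReal_grid_le (hα : 0 < α) (hL : IsTwoSidedStableLevy α L P) {T : ℝ} (hT : 0 < T)
    {n : ℕ} (hn : 0 < n) {x : ℝ} (hx : 0 ≤ x) (hp : P.real {ω | x < ‖L (-1) ω‖} ≤ 1 / 2) :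
    P.real {ω | ∃ k ≤ n, 2 * (T ^ (1 / α) * x) < ‖L (-T + k * (T / n)) ω - L (-T) ω‖} ≤
      2 * P.real {ω | x < ‖L (-1) ω‖} := by
  have hn' : (0 : ℝ) < n := Nat.cast_pos.2 hn
  let t : ℕ → ℝ := fun k => -T + k * (T / n)
  have ht : Monotone t := fun a b hab => by
    have : (a : ℝ) ≤ b := Nat.cast_le.2 hab
    simp only [t]
    gcongr
  have ht0 : t 0 = -T := by simp [t]
  have htn : t n = 0 := by simp only [t]; field_simp; ring
  have hsum : ∀ k ω, ∑ i ∈ Finset.range k, (L (t (i + 1)) ω - L (t i) ω) = L (t k) ω - L (-T) ω :=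
    fun k ω => by rw [Finset.sum_range_sub (fun i => L (t i) ω), ht0]
  have hott := measure_exists_norm_sum_gt_le (P := P)
    (ξ := fun i ω => L (t (i + 1)) ω - L (t i) ω)
    (fun i => (hL.measurable _).sub (hL.measurable _)) (hL.indep_increments.nat ht)
    (a := T ^ (1 / α) * x) (n := n) fun k hk => ?_
  · simp only [hsum] at hott
    refine hott.trans (le_of_eq ?_)
    rw [htn, hL.measureReal_norm_sub_gt hT]
  · have hIco : ∀ ω, ∑ i ∈ Finset.Ico k n, (L (t (i + 1)) ω - L (t i) ω) = L 0 ω - L (t k) ω := by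
      intro ω
      rw [Finset.sum_Ico_eq_sub _ hk, hsum, hsum, htn]
      abel
    simp only [hIco]
    rcases hk.eq_or_lt with rfl | hlt
    · rw [htn]
      have hempty : {ω | T ^ (1 / α) * x < ‖L 0 ω - L 0 ω‖} = ∅ := by
        refine Set.eq_empty_of_forall_notMem fun ω hω => ?_
        have h : T ^ (1 / α) * x < ‖L 0 ω - L 0 ω‖ := hω
        rw [sub_self, norm_zero] at h
        exact absurd h (not_lt.2 (by positivity))
      rw [hempty]
      simp
    · obtain ⟨c, hc⟩ : ∃ c, t k = -c := ⟨-t k, (neg_neg _).symm⟩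
      have hcT : c ≤ T := by
        have := ht (Nat.zero_le k)
        rw [ht0, hc] at this
        linarith
      have hc0 : 0 < c := by
        have h1 : c = (n - k) * (T / n) := by
          have : c = -t k := by rw [hc, neg_neg]
          rw [this]
          simp only [t]
          field_simp
          ring
        rw [h1]
        have : (k : ℝ) < n := Nat.cast_lt.2 hlt
        exact mul_pos (sub_pos.2 this) (div_pos hT hn')
      rw [hc]
      refine le_trans (measureReal_mono ?_ (measure_ne_top _ _))
        ((hL.measureReal_norm_sub_gt hc0 x).le.trans hp)
      intro ω hω
      refine lt_of_le_of_lt ?_ hω.out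
      have : c ^ (1 / α) ≤ T ^ (1 / α) := Real.rpow_le_rpow hc0.le hcT (by positivity)
      exact mul_le_mul_of_nonneg_right this hx

/-- The polynomial **tail bound** for stable laws. -/
lemma measureReal_tail_le (hα : 0 < α) (hL : IsTwoSidedStableLevy α L P) {A : ℝ} (hA : 0 < A)
    (hp : P.real {ω | A < ‖L (-1) ω‖} ≤ 1 / 4) {n : ℕ} (hn : 0 < n) :
    P.real {ω | 4 * A * (n : ℝ) ^ (1 / α) < ‖L (-1) ω‖} ≤ 1 / n := by
  have hn' : (0 : ℝ) < n := Nat.cast_pos.2 hn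
  set p := P.real {ω | 4 * A * (n : ℝ) ^ (1 / α) < ‖L (-1) ω‖} with hpdef
  set a := (n : ℝ) ^ (1 / α) * A with ha
  have hgrid := hL.measureReal_grid_le hα hn' hn hA.le (hp.trans (by norm_num))
  rw [div_self hn'.ne'] at hgrid
  let t : ℕ → ℝ := fun k => -n + k
  have ht : Monotone t := fun i j hij => by
    have : (i : ℝ) ≤ j := Nat.cast_le.2 hij
    simp only [t]
    linarith
  -- If all partial sums are at most `2a`, every increment is at most `4a`; this explains the factor
  -- `4` in the statement.
  let B : ℕ → Set E := fun _ => {v | ‖v‖ ≤ 4 * a}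
  have hBm : ∀ i, MeasurableSet (B i) := fun i => measurableSet_le measurable_norm measurable_const
  have hind := (hL.indep_increments.nat ht).measure_inter_preimage_eq_mul (Finset.range n)
    (sets := B) fun i _ => hBm i
  have hone : ∀ i, P ((fun ω => L (t (i + 1)) ω - L (t i) ω) ⁻¹' B i) = ENNReal.ofReal (1 - p) := by
    intro i
    have h1 : IdentDistrib (fun ω => L (t (i + 1)) ω - L (t i) ω)
        (fun ω => L 0 ω - L (-1) ω) P P := by
      have := hL.stationary_increments (-1) 0 (t (i + 1)) (by norm_num)
      convert this using 3
      · simp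
      · simp [t]; ring_nf
    rw [h1.measure_mem_eq (hBm i)]
    let Q : Set Ω := {ω | 4 * A * (n : ℝ) ^ (1 / α) < ‖L (-1) ω‖}
    have h2 : P ((fun ω => L 0 ω - L (-1) ω) ⁻¹' B i) = P Qᶜ := by
      refine measure_congr ?_
      filter_upwards [hL.zero] with ω hω
      refine propext ?_
      change ‖L 0 ω - L (-1) ω‖ ≤ 4 * a ↔ ¬ (4 * A * (n : ℝ) ^ (1 / α) < ‖L (-1) ω‖)
      rw [hω, zero_sub, norm_neg, not_lt, ha]
      rw [show 4 * ((n : ℝ) ^ (1 / α) * A) = 4 * A * (n : ℝ) ^ (1 / α) by ring]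
    have h3 : P.real Qᶜ = 1 - p := probReal_compl_eq_one_sub
      (measurableSet_lt measurable_const (hL.measurable _).norm)
    rw [h2, ← h3, ofReal_measureReal]
  have hp1 : p ≤ 1 := measureReal_le_one
  have hp0 : 0 ≤ p := measureReal_nonneg
  have hind' : P.real (⋂ i ∈ Finset.range n, (fun ω => L (t (i + 1)) ω - L (t i) ω) ⁻¹' B i)
      = (1 - p) ^ n := by
    rw [measureReal_def, hind]
    simp only [hone, Finset.prod_const, Finset.card_range]
    rw [ENNReal.toReal_pow, ENNReal.toReal_ofReal (by linarith)]
  have hsub : {ω | ∃ k ≤ n, 2 * ((n : ℝ) ^ (1 / α) * A)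
      < ‖L (-(n : ℝ) + k * 1) ω - L (-(n : ℝ)) ω‖}ᶜ ⊆
      ⋂ i ∈ Finset.range n, (fun ω => L (t (i + 1)) ω - L (t i) ω) ⁻¹' B i := by
    intro ω hω
    refine Set.mem_iInter₂.2 fun i hi => ?_
    have hω' : ∀ k ≤ n, ‖L (t k) ω - L (-(n : ℝ)) ω‖ ≤ 2 * a := by
      intro k hk
      by_contra hcon
      exact hω ⟨k, hk, by simpa [t, ha] using hcon⟩
    have hi' := Finset.mem_range.1 hi
    have h1 := hω' i hi'.le
    have h2 := hω' (i + 1) hi'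
    change ‖L (t (i + 1)) ω - L (t i) ω‖ ≤ 4 * a
    rw [← sub_sub_sub_cancel_right (L (t (i + 1)) ω) (L (t i) ω) (L (-(n : ℝ)) ω)]
    exact (norm_sub_le _ _).trans (by linarith)
  have hhalf : 1 / 2 ≤ (1 - p) ^ n := by
    rw [← hind']
    refine le_trans ?_ (measureReal_mono hsub (measure_ne_top _ _))
    have hm : MeasurableSet {ω | ∃ k ≤ n, 2 * ((n : ℝ) ^ (1 / α) * A)
        < ‖L (-(n : ℝ) + k * 1) ω - L (-(n : ℝ)) ω‖} := by
      have : {ω | ∃ k ≤ n, 2 * ((n : ℝ) ^ (1 / α) * A)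
          < ‖L (-(n : ℝ) + k * 1) ω - L (-(n : ℝ)) ω‖} = ⋃ k : ℕ, ⋃ _ : k ≤ n,
          {ω | 2 * ((n : ℝ) ^ (1 / α) * A) < ‖L (-(n : ℝ) + k * 1) ω - L (-(n : ℝ)) ω‖} := by
        ext ω; simp
      rw [this]
      exact MeasurableSet.iUnion fun k => MeasurableSet.iUnion fun _ =>
        measurableSet_lt measurable_const ((hL.measurable _).sub (hL.measurable _)).norm
    rw [probReal_compl_eq_one_sub hm]
    linarith
  -- From `1/2 ≤ (1-p)^n`, Bernoulli and `(1-p)^n (1+p)^n ≤ 1` one gets `(1 + np)/2 ≤ 1`, that is `p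
  -- ≤ 1/n`.
  have hbern : 1 + (n : ℝ) * p ≤ (1 + p) ^ n := one_add_mul_le_pow (by linarith) n
  have hprod : (1 - p) ^ n * (1 + p) ^ n ≤ 1 := by
    rw [← mul_pow]
    exact pow_le_one₀ (mul_nonneg (by linarith) (by linarith)) (by nlinarith)
  have hfin : 1 / 2 * (1 + (n : ℝ) * p) ≤ 1 := by
    refine le_trans ?_ hprod
    gcongr
  rw [le_div_iff₀ hn']
  linarith

/-- Almost surely, on `[-2^m, 0]` the paths are bounded by a multiple of `4^m`, for `m` large. -/
lemma ae_eventually_bound (hα : 1 ≤ α) (hL : IsTwoSidedStableLevy α L P) :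
    ∃ A : ℝ, 0 < A ∧ ∀ᵐ ω ∂P, ∀ᶠ m : ℕ in atTop, ∀ t ∈ Icc (-(2 : ℝ) ^ m) 0,
      ‖L t ω - L (-(2 : ℝ) ^ m) ω‖ ≤ A * 4 ^ m := by
  have hα0 : 0 < α := by linarith
  obtain ⟨A, hA, hp⟩ := exists_measureReal_norm_gt_le (P := P) (hL.measurable (-1))
    (δ := 1 / 4) (by norm_num)
  refine ⟨8 * A, by positivity, ?_⟩
  -- One factor `(2^m)^{1/α}` scales time `-1` to `-2^m`; the other brings the tail down to the
  -- summable `2^{-m}`. Their product is at most `4^m` because `α ≥ 1`.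
  let a : ℕ → ℝ := fun m => (2 ^ m : ℝ) ^ (1 / α) * (4 * A * (2 ^ m : ℝ) ^ (1 / α))
  have ha : ∀ m, 2 * a m ≤ 8 * A * 4 ^ m := by
    intro m
    have h1 : (2 ^ m : ℝ) ^ (1 / α) ≤ 2 ^ m := by
      have := Real.rpow_le_rpow_of_exponent_le (x := (2 : ℝ) ^ m) (y := 1 / α) (z := 1)
        (one_le_pow₀ (by norm_num)) ((div_le_one hα0).2 hα)
      rwa [Real.rpow_one] at this
    have h0 : 0 ≤ (2 ^ m : ℝ) ^ (1 / α) := by positivity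
    calc 2 * a m = 8 * A * ((2 ^ m : ℝ) ^ (1 / α) * (2 ^ m : ℝ) ^ (1 / α)) := by
          simp only [a]; ring
      _ ≤ 8 * A * (2 ^ m * 2 ^ m) := by gcongr
      _ = 8 * A * 4 ^ m := by rw [← mul_pow]; norm_num
  let V : ℕ → ℕ → Set Ω := fun m j => {ω | ∃ k : ℕ, k ≤ 2 ^ (m + j) ∧
    2 * a m < ‖L (-(2 : ℝ) ^ m + (k : ℝ) * (2 ^ j : ℝ)⁻¹) ω - L (-(2 : ℝ) ^ m) ω‖}
  have hV : ∀ m, 1 ≤ m → ∀ j, P.real (V m j) ≤ 2 * (1 / 2) ^ m := by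
    intro m hm j
    have htail := hL.measureReal_tail_le hα0 hA hp (n := 2 ^ m) (by positivity)
    push_cast at htail
    have hhalf : (1 : ℝ) / 2 ^ m ≤ 1 / 2 := by
      refine one_div_le_one_div_of_le (by norm_num) ?_
      calc (2 : ℝ) = 2 ^ 1 := by norm_num
        _ ≤ 2 ^ m := pow_le_pow_right₀ (by norm_num) hm
    have hgrid := hL.measureReal_grid_le hα0 (T := (2 : ℝ) ^ m) (by positivity)
      (n := 2 ^ (m + j)) (by positivity) (x := 4 * A * (2 ^ m : ℝ) ^ (1 / α)) (by positivity)
      (htail.trans hhalf)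
    have hstep : (2 : ℝ) ^ m / ((2 ^ (m + j) : ℕ) : ℝ) = (2 ^ j : ℝ)⁻¹ := by
      push_cast
      rw [pow_add]
      field_simp
    rw [hstep] at hgrid
    refine hgrid.trans ?_
    rw [one_div_pow]
    linarith
  -- The dyadic grids are nested, so the estimate uniform in `j` passes to the union over all of
  -- them.
  have hVmono : ∀ m, Monotone (V m) := by
    intro m
    refine monotone_nat_of_le_succ fun j => ?_
    rintro ω ⟨k, hk, hω⟩
    refine ⟨2 * k, ?_, ?_⟩
    · rw [← add_assoc, pow_succ]; omega
    · have : ((2 * k : ℕ) : ℝ) * (2 ^ (j + 1) : ℝ)⁻¹ = k * (2 ^ j : ℝ)⁻¹ := by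
        push_cast
        rw [pow_succ]
        field_simp
      rw [this]
      exact hω
  have hU : ∀ m, 1 ≤ m → P (⋃ j, V m j) ≤ ENNReal.ofReal (2 * (1 / 2) ^ m) := by
    intro m hm
    rw [(hVmono m).measure_iUnion]
    refine iSup_le fun j => ?_
    rw [← ofReal_measureReal]
    exact ENNReal.ofReal_le_ofReal (hV m hm j)
  have hsum : ∑' m, P (⋃ j, V (m + 1) j) ≠ ⊤ := by
    have hs : Summable fun m : ℕ => (2 : ℝ) * (1 / 2) ^ (m + 1) :=
      ((summable_nat_add_iff 1).2 (summable_geometric_of_lt_one (by norm_num)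
        (by norm_num : (1 : ℝ) / 2 < 1))).mul_left 2
    exact ne_top_of_le_ne_top hs.tsum_ofReal_ne_top
      (ENNReal.tsum_le_tsum fun m => hU (m + 1) (by omega))
  filter_upwards [hL.cadlag, ae_eventually_notMem hsum] with ω hcad hω
  obtain ⟨N, hN⟩ := eventually_atTop.1 hω
  refine eventually_atTop.2 ⟨N + 1, fun m hm t ht => ?_⟩
  have hm' : ω ∉ ⋃ j, V m j := by
    have := hN (m - 1) (by omega)
    rwa [Nat.sub_add_cancel (by omega : 1 ≤ m)] at this
  refine le_trans ?_ (ha m)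
  have hgrid : ∀ j k : ℕ, k ≤ 2 ^ (m + j) →
      ‖L (-(2 : ℝ) ^ m + (k : ℝ) * (2 ^ j : ℝ)⁻¹) ω - L (-(2 : ℝ) ^ m) ω‖ ≤ 2 * a m := by
    intro j k hk
    by_contra hcon
    exact hm' (Set.mem_iUnion.2 ⟨j, k, hk, not_le.1 hcon⟩)
  -- At `t = 0` the grid point strictly to the right would leave `[-2^m, 0]`; there `0` itself is a
  -- grid point.
  rcases ht.2.eq_or_lt with rfl | ht0
  · have := hgrid 0 (2 ^ m) (by simp)
    simpa using this
  have hright : Tendsto (fun j : ℕ => gridRight (-(2 : ℝ) ^ m) ((2 ^ j : ℝ)⁻¹) t) atTop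
      (𝓝[≥] t) := by
    refine tendsto_gridRight (Eventually.of_forall fun j => by positivity) ?_ t
    simpa only [← inv_pow] using tendsto_pow_atTop_nhds_zero_of_lt_one
      (by norm_num : (0 : ℝ) ≤ 2⁻¹) (by norm_num)
  have hlim := ((hcad t).1.tendsto.comp hright).sub_const (L (-(2 : ℝ) ^ m) ω)
  refine le_of_tendsto hlim.norm (Eventually.of_forall fun j => ?_)
  have h0 : 0 ≤ (t - -(2 : ℝ) ^ m) / (2 ^ j : ℝ)⁻¹ :=
    div_nonneg (by linarith [ht.1]) (by positivity)
  have hfl : ((⌊(t - -(2 : ℝ) ^ m) / (2 ^ j : ℝ)⁻¹⌋ : ℤ) : ℝ)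
      = (⌊(t - -(2 : ℝ) ^ m) / (2 ^ j : ℝ)⁻¹⌋₊ : ℝ) := by
    rw [natCast_floor_eq_intCast_floor h0]
  have hlt : ⌊(t - -(2 : ℝ) ^ m) / (2 ^ j : ℝ)⁻¹⌋₊ < 2 ^ (m + j) := by
    rw [Nat.floor_lt h0, div_inv_eq_mul]
    push_cast
    rw [pow_add]
    exact mul_lt_mul_of_pos_right (by linarith) (by positivity)
  have := hgrid j _ hlt
  push_cast at this
  rw [← hfl] at this
  exact this

/-- Almost surely, the paths of a two-sided stable Lévy process with `α ≥ 1` grow at most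
quadratically. -/
lemma ae_isTamePath (hα : 1 ≤ α) (hL : IsTwoSidedStableLevy α L P) :
    ∀ᵐ ω ∂P, IsTamePath fun s => L s ω := by
  obtain ⟨A, hA, hbound⟩ := hL.ae_eventually_bound hα
  filter_upwards [hL.cadlag, hbound] with ω hcad hω
  refine ⟨fun t => (hcad t).1, fun t => (hcad t).2, fun c hc => ?_⟩
  obtain ⟨m₀, hm₀⟩ := eventually_atTop.1 hω
  have hsq : ∀ u : ℝ, 0 ≤ u → (1 + u) ^ 2 ≤ (max 1 (2 / c)) ^ 2 * Real.exp (c * u) := by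
    intro u hu
    have h1 : 1 + u ≤ max 1 (2 / c) * Real.exp (c / 2 * u) := by
      have h2 := Real.add_one_le_exp (c / 2 * u)
      calc 1 + u = 1 * 1 + 2 / c * (c / 2 * u) := by field_simp
        _ ≤ max 1 (2 / c) * 1 + max 1 (2 / c) * (c / 2 * u) := by
            gcongr
            · exact le_max_left _ _
            · exact le_max_right _ _
        _ = max 1 (2 / c) * (c / 2 * u + 1) := by ring
        _ ≤ _ := by gcongr
    calc (1 + u) ^ 2 ≤ (max 1 (2 / c) * Real.exp (c / 2 * u)) ^ 2 := by gcongr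
      _ = (max 1 (2 / c)) ^ 2 * Real.exp (c * u) := by
          rw [mul_pow, ← Real.exp_nat_mul]
          congr 2
          push_cast
          ring
  refine ⟨(2 * A * 4 ^ (m₀ + 1) + ‖L 0 ω‖) * (max 1 (2 / c)) ^ 2, fun s hs => ?_⟩
  -- With `2^k ≤ 1 + |s| < 2^{k+1}`, level `m₀ + 1 + k` is past the threshold, covers `s`, and its
  -- bound is a constant times `4^k ≤ (1 + |s|)²`.
  obtain ⟨k, hk, hk'⟩ := exists_nat_pow_near (x := 1 + -s) (y := (2 : ℝ)) (by linarith)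
    (by norm_num)
  have hM := hm₀ (m₀ + 1 + k) (by omega)
  have hle : (2 : ℝ) ^ (k + 1) ≤ 2 ^ (m₀ + 1 + k) :=
    pow_le_pow_right₀ (by norm_num) (by omega)
  have h1 := hM s ⟨by linarith, hs⟩
  have h2 := hM 0 ⟨by linarith [show (0 : ℝ) ≤ 2 ^ (m₀ + 1 + k) by positivity], le_rfl⟩
  have h3 : ‖L s ω‖ ≤ 2 * (A * 4 ^ (m₀ + 1 + k)) + ‖L 0 ω‖ := by
    calc ‖L s ω‖ = ‖(L s ω - L (-(2 : ℝ) ^ (m₀ + 1 + k)) ω)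
          - (L 0 ω - L (-(2 : ℝ) ^ (m₀ + 1 + k)) ω) + L 0 ω‖ := by congr 1; abel
      _ ≤ _ := by
        refine (norm_add_le _ _).trans ?_
        have := norm_sub_le (L s ω - L (-(2 : ℝ) ^ (m₀ + 1 + k)) ω)
          (L 0 ω - L (-(2 : ℝ) ^ (m₀ + 1 + k)) ω)
        linarith
  have h4 : (4 : ℝ) ^ k ≤ (1 + -s) ^ 2 := by
    calc (4 : ℝ) ^ k = (2 ^ k) ^ 2 := by rw [← pow_mul, mul_comm, pow_mul]; norm_num
      _ ≤ (1 + -s) ^ 2 := by gcongr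
  have h5 : 1 ≤ (1 + -s) ^ 2 := one_le_pow₀ (by linarith)
  have h6 := hsq (-s) (by linarith)
  rw [mul_neg, ← neg_mul] at h6
  calc ‖L s ω‖ ≤ 2 * A * 4 ^ (m₀ + 1) * 4 ^ k + ‖L 0 ω‖ * 1 := by
        rw [pow_add] at h3
        linarith
    _ ≤ 2 * A * 4 ^ (m₀ + 1) * (1 + -s) ^ 2 + ‖L 0 ω‖ * (1 + -s) ^ 2 := by gcongr
    _ = (2 * A * 4 ^ (m₀ + 1) + ‖L 0 ω‖) * (1 + -s) ^ 2 := by ring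
    _ ≤ (2 * A * 4 ^ (m₀ + 1) + ‖L 0 ω‖) * ((max 1 (2 / c)) ^ 2 * Real.exp (-c * s)) := by
        gcongr
    _ = _ := by ring

end IsTwoSidedStableLevy

end Growth

/-! ### Equality in law and convergence of the graph maps. -/

section Distribution

variable {Ω E₁ E₂ : Type*} [MeasurableSpace Ω] {P : Measure Ω} [IsProbabilityMeasure P]
  [NormedAddCommGroup E₁] [NormedSpace ℝ E₁] [CompleteSpace E₁]
  [NormedAddCommGroup E₂] [NormedSpace ℝ E₂] [CompleteSpace E₂] [MeasurableSpace E₂]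
  [BorelSpace E₂] [SecondCountableTopology E₂]
  {S : E₁ →L[ℝ] E₁} {F : E₂ →L[ℝ] E₂} {g₁ : E₁ → E₂ → E₁} {g₂ : E₁ → E₂ → E₂}
  {α γs γf K γ σ ε : ℝ} {L : ℝ → Ω → E₂} {ι : Type*}

namespace HasSpectralGap

lemma aemeasurable_hZero (h : HasSpectralGap S F g₁ g₂ γs γf K γ)
    (hL : IsTwoSidedStableLevy α L P) (hw : ∀ᵐ ω ∂P, IsTamePath fun s => L s ω)
    (x : ι → E₁) [Countable ι] :
    AEMeasurable (fun ω i => hZero σ γ S F g₁ g₂ (fun s => L s ω) (x i)) P := by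
  choose G hGm hG using fun i => exists_measurable_graphMap h 0 σ (x i)
  refine ⟨fun ω i => G i fun s => L s ω, measurable_pi_lambda _ fun i =>
    (hGm i).comp (measurable_pi_lambda _ hL.measurable), ?_⟩
  filter_upwards [hw] with ω hω
  exact funext fun i => hG i _ hω _ _ (h.contracting_zero hω)

lemma aemeasurable_hTilde (h : HasSpectralGap S F g₁ g₂ γs γf K γ)
    (hL : IsTwoSidedStableLevy α L P) (hw : ∀ᵐ ω ∂P, IsTamePath fun s => L s ω)
    (hε : ε ∈ Ioo 0 (maxEps γf K γ)) (x : ι → E₁) [Countable ι] :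
    AEMeasurable (fun ω i => hTilde σ γ ε S F g₁ g₂ (fun s => L s ω) (x i)) P := by
  choose G hGm hG using fun i => exists_measurable_graphMap h ε σ (x i)
  refine ⟨fun ω i => G i fun s => L s ω, measurable_pi_lambda _ fun i =>
    (hGm i).comp (measurable_pi_lambda _ hL.measurable), ?_⟩
  filter_upwards [hw] with ω hω
  exact funext fun i => hG i _ hω _ _ (h.contracting_tilde hω hε)

/-- By self-similarity of the noise, the graph maps of the slow manifolds of the original and of
the rescaled system have the same law. -/
theorem identDistrib_hHat_hTilde (h : HasSpectralGap S F g₁ g₂ γs γf K γ)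
    (hL : IsTwoSidedStableLevy α L P) (hw : ∀ᵐ ω ∂P, IsTamePath fun s => L s ω)
    (hε : ε ∈ Ioo 0 (maxEps γf K γ)) (x : ι → E₁) [Countable ι] :
    IdentDistrib (fun ω i => hHat α σ γ ε S F g₁ g₂ (fun s => L s ω) (x i))
      (fun ω i => hTilde σ γ ε S F g₁ g₂ (fun s => L s ω) (x i)) P P := by
  choose G hGm hG using fun i => exists_measurable_graphMap h ε σ (x i)
  have hGm' : Measurable fun (w : ℝ → E₂) i => G i w := measurable_pi_lambda _ hGm
  have hmid := (hL.identDistrib_rescale hε.1).comp hGm'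
  have hhat : (fun ω i => hHat α σ γ ε S F g₁ g₂ (fun s => L s ω) (x i)) =ᵐ[P]
      (fun (w : ℝ → E₂) i => G i w) ∘ fun ω s => ε ^ (-(1 / α)) • L (ε * s) ω := by
    filter_upwards [hw] with ω hω
    refine funext fun i => (h.hHat_eq_hTilde_rescale hω hε (x i)).trans ?_
    have hω' := hω.rescale (ε ^ (-(1 / α))) hε.1
    exact hG i _ hω' _ _ (h.contracting_tilde hω' hε)
  have htilde : (fun ω i => hTilde σ γ ε S F g₁ g₂ (fun s => L s ω) (x i)) =ᵐ[P]
      (fun (w : ℝ → E₂) i => G i w) ∘ fun ω s => L s ω := by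
    filter_upwards [hw] with ω hω
    exact funext fun i => hG i _ hω _ _ (h.contracting_tilde hω hε)
  exact ((IdentDistrib.of_ae_eq hmid.aemeasurable_fst hhat.symm).symm.trans hmid).trans
    (IdentDistrib.of_ae_eq hmid.aemeasurable_snd htilde.symm)

lemma norm_hTilde_sub_hZero_le (h : HasSpectralGap S F g₁ g₂ γs γf K γ) {w : ℝ → E₂}
    (hw : IsTamePath w) {C : ℝ} (hC : ∀ x y, ‖g₁ x y‖ ≤ C) (hε : ε ∈ Ioo 0 (maxEps γf K γ))
    (x₀ : E₁) :
    ‖hTilde σ γ ε S F g₁ g₂ w x₀ - hZero σ γ S F g₁ g₂ w x₀‖ ≤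
        K * γf ^ 2 * (‖S x₀‖ + C) / (γs * (γf + K) ^ 2) * (1 / (γf - ε * γs) - 1 / γf) ∧
      ‖hTilde σ γ ε S F g₁ g₂ w x₀ - hZero σ γ S F g₁ g₂ w x₀‖ ≤
        K * (‖S x₀‖ + C) / (γf + K) ^ 2 * ε := by
  have hC0 : 0 ≤ C := (norm_nonneg _).trans (hC 0 0)
  have h1 := LPContracting.norm_graphMap_sub_le hε.1 h.slow_pos hC (h.contracting_tilde (σ := σ) hw hε)
    (h.contracting_zero hw) x₀
  have h2 := error_bound_le (B := ‖S x₀‖ + C) (γf := γf) h.K_pos (by positivity) h.slow_pos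
    (by linarith [h.gap, h.rate_pos]) hε.1
  exact ⟨h1.trans h2.1, (h1.trans h2.1).trans h2.2⟩

end HasSpectralGap

/-- Convergence in distribution sees only the laws, so almost sure convergence of `h̃^ε` transfers
to `ĥ^ε`, which itself need not converge pathwise. -/
lemma TendstoInDistribution.of_identDistrib {κ X : Type*} {Ω' : κ → Type*} {Ω₀ : Type*}
    [∀ i, MeasurableSpace (Ω' i)] [MeasurableSpace Ω₀] {μ : (i : κ) → Measure (Ω' i)}
    [∀ i, IsProbabilityMeasure (μ i)] {μ₀ : Measure Ω₀} [IsProbabilityMeasure μ₀]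
    [TopologicalSpace X] [MeasurableSpace X] [OpensMeasurableSpace X] {Y Y' : (i : κ) → Ω' i → X}
    {Z : Ω₀ → X} {l : Filter κ} (hY : TendstoInDistribution Y l Z μ μ₀)
    (h : ∀ i, IdentDistrib (Y' i) (Y i) (μ i) (μ i)) : TendstoInDistribution Y' l Z μ μ₀ where
  forall_aemeasurable i := (h i).aemeasurable_fst
  aemeasurable_limit := hY.aemeasurable_limit
  tendsto := by
    refine hY.tendsto.congr fun i => Subtype.ext ?_
    exact (h i).map_eq.symm

/-- Convergence in distribution of the slow manifolds to the critical manifold. -/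
theorem HasSpectralGap.tendstoInDistribution_hHat (h : HasSpectralGap S F g₁ g₂ γs γf K γ)
    (hL : IsTwoSidedStableLevy α L P) (hw : ∀ᵐ ω ∂P, IsTamePath fun s => L s ω) {C : ℝ}
    (hC : ∀ x y, ‖g₁ x y‖ ≤ C) {k : ℕ} (x : Fin k → E₁) :
    TendstoInDistribution
      (fun (ε : Ioo (0 : ℝ) (maxEps γf K γ)) ω i =>
        hHat α σ γ (ε : ℝ) S F g₁ g₂ (fun s => L s ω) (x i))
      (comap ((↑) : Ioo (0 : ℝ) (maxEps γf K γ) → ℝ) (𝓝 0))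
      (fun ω i => hZero σ γ S F g₁ g₂ (fun s => L s ω) (x i)) (fun _ => P) P := by
  refine TendstoInDistribution.of_identDistrib (tendstoInDistribution_of_ae_tendsto
    (fun ε => h.aemeasurable_hTilde (σ := σ) hL hw ε.2 x) (h.aemeasurable_hZero hL hw x) ?_)
    fun ε => h.identDistrib_hHat_hTilde hL hw ε.2 x
  filter_upwards [hw] with ω hω
  refine tendsto_pi_nhds.2 fun i => tendsto_iff_norm_sub_tendsto_zero.2 ?_
  refine squeeze_zero (fun _ => norm_nonneg _)
    (fun ε => (h.norm_hTilde_sub_hZero_le hω hC ε.2 (x i)).2) ?_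
  simpa using (tendsto_comap (f := ((↑) : Ioo (0 : ℝ) (maxEps γf K γ) → ℝ))
    (x := 𝓝 0)).const_mul (K * (‖S (x i)‖ + C) / (γf + K) ^ 2)

end Distribution

end SlowFast

end

/-! ### The main theorem. -/

theorem theorem5 {Ω : Type*} [MeasurableSpace Ω] (P : Measure Ω) [IsProbabilityMeasure P]
    (n₁ n₂ : ℕ)
    -- the noise
    (α : ℝ) (hα : 1 < α ∧ α < 2) (L : ℝ → Ω → EuclideanSpace ℝ (Fin n₂))
    (hL : SlowFast.IsTwoSidedStableLevy α L P) (σ : ℝ) (hσ : 0 < σ)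
    -- the linear parts
    (S : EuclideanSpace ℝ (Fin n₁) →L[ℝ] EuclideanSpace ℝ (Fin n₁))
    (F : EuclideanSpace ℝ (Fin n₂) →L[ℝ] EuclideanSpace ℝ (Fin n₂))
    (γs γf : ℝ) (hγs : 0 < γs) (hγf : γf < 0)
    (hS : ∀ t ≤ (0 : ℝ), ∀ x, ‖NormedSpace.exp (t • S) x‖ ≤ Real.exp (γs * t) * ‖x‖)
    (hF : ∀ t ≥ (0 : ℝ), ∀ y, ‖NormedSpace.exp (t • F) y‖ ≤ Real.exp (γf * t) * ‖y‖)
    -- the nonlinear parts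
    (g₁ : EuclideanSpace ℝ (Fin n₁) → EuclideanSpace ℝ (Fin n₂) → EuclideanSpace ℝ (Fin n₁))
    (g₂ : EuclideanSpace ℝ (Fin n₁) → EuclideanSpace ℝ (Fin n₂) → EuclideanSpace ℝ (Fin n₂))
    (K : ℝ) (hK : 0 < K)
    (hg₁ : ∀ x₁ y₁ x₂ y₂, ‖g₁ x₁ y₁ - g₁ x₂ y₂‖ ≤ K * (‖x₁ - x₂‖ + ‖y₁ - y₂‖))
    (hg₂ : ∀ x₁ y₁ x₂ y₂, ‖g₂ x₁ y₁ - g₂ x₂ y₂‖ ≤ K * (‖x₁ - x₂‖ + ‖y₁ - y₂‖))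
    (C : ℝ) (hC : ∀ x y, ‖g₁ x y‖ ≤ C)
    -- the spectral gap condition `K < -γf`, with the exponent `γ` of the weighted spaces
    (γ : ℝ) (hγ : 0 < γ) (hgap : K < -(γ + γf)) :
    -- almost surely the noise `ξ(θ_t ω)` is well defined and `M^0(ω)` is the graph of `h^0(ω, ·)`
    (∀ᵐ ω ∂P,
      (∀ t, SlowFast.OUConverges F (SlowFast.shift t (fun s => L s ω))) ∧
      SlowFast.IsGraph 0 1 S F g₁ g₂ (SlowFast.noiseTilde σ F (fun s => L s ω)) (-γ)) ∧
    ∃ δ > 0,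
      -- almost surely, for all `ε ∈ (0, δ)`, the same for `η^{1/ε}(θ_t ω)`, `M^ε(ω)`, `ĥ^ε(ω, ·)`,
      -- and for the slow manifold of the rescaled system and `h̃^ε(ω, ·)`
      (∀ᵐ ω ∂P, ∀ ε ∈ Ioo 0 δ,
        (∀ t, SlowFast.OUConverges (ε⁻¹ • F) (SlowFast.shift t (fun s => L s ω))) ∧
        SlowFast.IsGraph 1 ε⁻¹ S F g₁ g₂
          (SlowFast.noiseHat α ε σ F (fun s => L s ω)) (-γ / ε) ∧
        SlowFast.IsGraph ε 1 S F g₁ g₂ (SlowFast.noiseTilde σ F (fun s => L s ω)) (-γ)) ∧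
      -- `ĥ^ε` and `h̃^ε` have the same distribution (as random fields in `x₀`)
      (∀ ε ∈ Ioo 0 δ, ∀ (k : ℕ) (x : Fin k → EuclideanSpace ℝ (Fin n₁)),
        IdentDistrib
          (fun ω i => SlowFast.hHat α σ γ ε S F g₁ g₂ (fun s => L s ω) (x i))
          (fun ω i => SlowFast.hTilde σ γ ε S F g₁ g₂ (fun s => L s ω) (x i)) P P) ∧
      -- almost surely `h̃^ε = h^0 + O(ε)`, with explicit bounds
      (∀ᵐ ω ∂P, ∀ ε ∈ Ioo 0 δ, ∀ x₀ : EuclideanSpace ℝ (Fin n₁),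
        ‖SlowFast.hTilde σ γ ε S F g₁ g₂ (fun s => L s ω) x₀ -
            SlowFast.hZero σ γ S F g₁ g₂ (fun s => L s ω) x₀‖ ≤
          K * γf ^ 2 * (‖S x₀‖ + C) / (γs * (γf + K) ^ 2) * (1 / (γf - ε * γs) - 1 / γf) ∧
        ‖SlowFast.hTilde σ γ ε S F g₁ g₂ (fun s => L s ω) x₀ -
            SlowFast.hZero σ γ S F g₁ g₂ (fun s => L s ω) x₀‖ ≤
          K * (‖S x₀‖ + C) / (γf + K) ^ 2 * ε) ∧
      -- convergence in distribution of `ĥ^ε` to `h^0` (as random fields in `x₀`)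
      (∀ (k : ℕ) (x : Fin k → EuclideanSpace ℝ (Fin n₁)),
        TendstoInDistribution
          (fun (ε : Ioo (0 : ℝ) δ) ω i =>
            SlowFast.hHat α σ γ (ε : ℝ) S F g₁ g₂ (fun s => L s ω) (x i))
          (comap ((↑) : Ioo (0 : ℝ) δ → ℝ) (𝓝 0))
          (fun ω i => SlowFast.hZero σ γ S F g₁ g₂ (fun s => L s ω) (x i))
          (fun _ => P) P) := by
  have h : SlowFast.HasSpectralGap S F g₁ g₂ γs γf K γ :=
    { slow_pos := hγs
      fast_neg := hγf
      exp_S := fun t ht => ContinuousLinearMap.opNorm_le_bound _ (Real.exp_nonneg _) (hS t ht)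
      exp_F := fun t ht => ContinuousLinearMap.opNorm_le_bound _ (Real.exp_nonneg _) (hF t ht)
      K_pos := hK
      lip₁ := hg₁
      lip₂ := hg₂
      rate_pos := hγ
      gap := hgap }
  -- One null set serves all `ε` and all `x₀`, since tameness does not involve them.
  have hw := hL.ae_isTamePath hα.1.le
  refine ⟨?_, SlowFast.maxEps γf K γ, h.maxEps_pos, ?_,
    fun ε hε k x => h.identDistrib_hHat_hTilde hL hw hε x, ?_,
    fun k x => h.tendstoInDistribution_hHat hL hw hC x⟩
  · filter_upwards [hw] with ω hω
    refine ⟨fun t => (hω.shift t).ouConverges (κ := -γf) (neg_pos.2 hγf) ?_,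
      (h.contracting_zero hω).isGraph⟩
    simpa using h.exp_F
  · filter_upwards [hw] with ω hω ε hε
    have hε' := inv_pos.2 hε.1
    refine ⟨fun t => (hω.shift t).ouConverges (mul_pos (neg_pos.2 hγf) hε')
      (SlowFast.norm_exp_smul_inv_smul_le hε' h.exp_F), ?_, (h.contracting_tilde hω hε).isGraph⟩
    rw [neg_div, div_eq_mul_inv]
    exact (h.contracting_hat hω hε).isGraph
  · filter_upwards [hw] with ω hω ε hε x₀
    exact h.norm_hTilde_sub_hZero_le hω hC hε x₀
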